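/- **Setting.** Let $X\subset\mathbb P^2=\mathbb P^2(\mathbb C)$ be a compact set with a $C^1$ lamination by Riemann surfaces, covered by finitely many flow boxes $B_i$. That is, each $B_i$ is a relatively open subset of $X$ with a homeomorphism $\phi_i=(h_i,\lambda_i):B_i\to\Delta\times T_i$, where $\Delta\subset\mathbb C$ is the open unit disc and $T_i\subset\mathbb C=\mathbb R^2$; the map $\phi_i^{-1}(z,t)$ is holomorphic in $z$; $\phi_i$ extends to a $C^1$ diffeomorphism from an open neighborhood of $\overline{B_i}$ in $\mathbb P^2$ onto an open subset of $\mathbb C\times\mathbb C$; and the changes of coordinates are locally of the form $\phi_j\circ\phi_i^{-1}(z,t)=(h_{ij}(z,t),\lambda_{ij}(t))$. The local leaves of $B_i$ are the plaques $\{\lambda_i=t\}$, $t\in T_i$. The homogeneous coordinates $[z:w:t]$ are chosen so that $p=[0:0:1]\in X$ and so that, for some flow box containing $p$, the local leaf through $p$ has near $p$ the form $w=f(z)$ in the affine chart $t=1$, with $f$ holomorphic and $f(z)=O(z^2)$. For $\epsilon\in\mathbb C$ let $\Phi_\epsilon[z:w:t]=[z:w+\epsilon z:t]$. **Theorem 3.1.**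 There are an integer $N$ and an $\epsilon_0>0$ such that for every $\epsilon\in\mathbb C$ with $0<|\epsilon|<\epsilon_0$ the following holds. 1. For every $i$ and all local leaves $L_1,L_2$ of $B_i$, the curves $L_1$ and $\Phi_\epsilon(L_2)$ intersect in at most $N$ points, counted with multiplicity. 2. There is a neighborhood $U_\epsilon$ of the identity in $U(3)$ such that for all $\Psi_1,\Psi_2\in U_\epsilon$, every $i$ and all local leaves $L_1,L_2$ of $B_i$, the curves $\Psi_1(L_1)$ and $\Psi_2(\Phi_\epsilon(L_2))$ intersect in at most $N$ points, counted with multiplicity. -/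

import Mathlib

open Set Filter Topology
open scoped LinearAlgebra.Projectivization

noncomputable section

/-- The complex projective plane, with homogeneous coordinates `[z : w : t] = [v 0 : v 1 : v 2]`. -/
abbrev P2 : Type := ℙ ℂ (Fin 3 → ℂ)

/-- The quotient topology of `ℂ³ \ {0}`. -/
instance P2.instTopologicalSpace : TopologicalSpace P2 :=
  TopologicalSpace.coinduced (Projectivization.mk' (V := Fin 3 → ℂ) ℂ) inferInstance

/-- The projection `ℂ³ \ {0} → ℙ²`, with an arbitrary value at `0` (it is only used away
from `0`). -/
def P2.proj (v : Fin 3 → ℂ) : P2 :=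
  open Classical in
  if h : v ≠ 0 then Projectivization.mk ℂ v h
  else Projectivization.mk ℂ (fun _ => 1) (fun h1 => one_ne_zero (congrFun h1 0))

/-- A map on an open subset of `ℙ²` is `C¹` (over `ℝ`) at a point iff its pull-back to
`ℂ³ \ {0}` is `C¹` at the points above it. -/
def P2.C1FromAt (f : P2 → ℂ × ℂ) (x : P2) : Prop :=
  ∀ v : Fin 3 → ℂ, v ≠ 0 → P2.proj v = x → ContDiffAt ℝ 1 (fun u => f (P2.proj u)) v

/-- A map into `ℙ²` is `C¹` (over `ℝ`) at a point iff near that point it has a `C¹` lift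
to `ℂ³ \ {0}`. -/
def P2.C1IntoAt (g : ℂ × ℂ → P2) (y : ℂ × ℂ) : Prop :=
  ∃ s : ℂ × ℂ → (Fin 3 → ℂ), ContDiffAt ℝ 1 s y ∧ ∀ᶠ x in 𝓝 y, s x ≠ 0 ∧ P2.proj (s x) = g x

/-- A map from `ℂ` into `ℙ²` is holomorphic near a point iff near that point it has a holomorphic
lift to `ℂ³ \ {0}`. -/
def P2.HolomorphicAt (g : ℂ → P2) (z₀ : ℂ) : Prop :=
  ∃ s : ℂ → (Fin 3 → ℂ), AnalyticAt ℂ s z₀ ∧ ∀ᶠ z in 𝓝 z₀, s z ≠ 0 ∧ P2.proj (s z) = g z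

/-- A `C¹` flow box of a set `X ⊆ ℙ²`: a relatively open set `U ⊆ X` with a homeomorphism
`φ = (h, λ) : U → Δ × T`, where `Δ` is the open unit disc and `T ⊆ ℂ = ℝ²`, such that `φ⁻¹` is
holomorphic in `z ∈ Δ`, and such that `φ` extends to a `C¹` diffeomorphism (`chart`) from an open
neighbourhood of the closure of `U` in `ℙ²` onto an open subset of `ℂ × ℂ`.
The extension need not be holomorphic along anything outside `X`. -/
structure C1FlowBox (X : Set P2) where
  chart : OpenPartialHomeomorph P2 (ℂ × ℂ)
  transversal : Set ℂ
  contDiff_chart : ∀ x ∈ chart.source, P2.C1FromAt chart x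
  contDiff_symm : ∀ y ∈ chart.target, P2.C1IntoAt chart.symm y
  subset_target : Metric.ball (0 : ℂ) 1 ×ˢ transversal ⊆ chart.target
  closure_subset_source :
    closure (chart.symm '' (Metric.ball (0 : ℂ) 1 ×ˢ transversal)) ⊆ chart.source
  relatively_open : ∃ O : Set P2, IsOpen O ∧
    chart.symm '' (Metric.ball (0 : ℂ) 1 ×ˢ transversal) = X ∩ O
  holomorphic : ∀ t ∈ transversal, ∀ z ∈ Metric.ball (0 : ℂ) 1,
    P2.HolomorphicAt (fun ζ => chart.symm (ζ, t)) z

namespace C1FlowBox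

variable {X : Set P2}

/-- The open subset `U` of `X` underlying a flow box. -/
def carrier (B : C1FlowBox X) : Set P2 :=
  B.chart.symm '' (Metric.ball (0 : ℂ) 1 ×ˢ B.transversal)

/-- The plaque `{λ = t}`. -/
def plaque (B : C1FlowBox X) (t : ℂ) : Set P2 :=
  (fun z => B.chart.symm (z, t)) '' Metric.ball (0 : ℂ) 1

/-- The local leaves of a flow box are its plaques. -/
def IsLocalLeaf (B : C1FlowBox X) (L : Set P2) : Prop :=
  ∃ t ∈ B.transversal, L = B.plaque t

end C1FlowBox

/-- A `C¹` lamination by Riemann surfaces of the set `X ⊆ ℙ²`, given by a family of flow boxes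
covering `X`. The compatibility condition says that the transversal coordinate `λ_j` is locally
constant along the plaques of the `i`-th box, i.e. that locally
`φ_j ∘ φ_i⁻¹ (z, t) = (h_ij (z, t), λ_ij t)`; here `h_ij` is automatically holomorphic in `z`, as
the plaques of both boxes are holomorphic discs. -/
structure C1Lamination (X : Set P2) (ι : Type*) where
  box : ι → C1FlowBox X
  covers : X ⊆ ⋃ i, (box i).carrier
  compatible : ∀ i j, ∀ t ∈ (box i).transversal, ∀ z ∈ Metric.ball (0 : ℂ) 1,
    (box i).chart.symm (z, t) ∈ (box j).carrier →
      ∀ᶠ ζ in 𝓝 z, ((box j).chart ((box i).chart.symm (ζ, t))).2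
        = ((box j).chart ((box i).chart.symm (z, t))).2

/-- The set `L` is, near `p = [0 : 0 : 1]` and in the affine coordinates `[z : w : 1]`, the graph of
a holomorphic function `w = f z` with `f z = O(z²)`. -/
def IsTangentGraphAtOrigin (L : Set P2) : Prop :=
  ∃ f : ℂ → ℂ, AnalyticAt ℂ f 0 ∧ f 0 = 0 ∧ deriv f 0 = 0 ∧
    ∀ᶠ x : ℂ × ℂ in 𝓝 (0, 0), P2.proj ![x.1, x.2, 1] ∈ L ↔ x.2 = f x.1

/-- The linear automorphism `(z, w, t) ↦ (z, w + ε z, t)` of `ℂ³`. -/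
def shearLinear (ε : ℂ) : (Fin 3 → ℂ) ≃ₗ[ℂ] (Fin 3 → ℂ) where
  toFun v := ![v 0, v 1 + ε * v 0, v 2]
  invFun v := ![v 0, v 1 - ε * v 0, v 2]
  map_add' u v := by
    ext i; fin_cases i <;> simp; ring
  map_smul' c v := by
    ext i; fin_cases i <;> simp; ring
  left_inv v := by
    ext i; fin_cases i <;> simp
  right_inv v := by
    ext i; fin_cases i <;> simp

/-- `Φ_ε [z : w : t] = [z : w + ε z : t]`. -/
def shear (ε : ℂ) : P2 → P2 :=
  Projectivization.map (shearLinear ε).toLinearMap (shearLinear ε).injective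

/-- The action of the unitary group `U(3)` on `ℙ²`. -/
def unitaryMap (A : Matrix.unitaryGroup (Fin 3) ℂ) : P2 → P2 :=
  Projectivization.map (Matrix.UnitaryGroup.toLinearEquiv A).toLinearMap
    (Matrix.UnitaryGroup.toLinearEquiv A).injective

/-- `γ` lifts to `ℂ³ \ {0}` a holomorphic local parametrization, centred at `0`, of the smooth
complex curve `A` near the point `q`; linear independence of `γ 0` and `γ' 0` says that the
parametrization `proj ∘ γ` is an immersion at `0`. -/
def IsLocalParam (A : Set P2) (q : P2) (γ : ℂ → (Fin 3 → ℂ)) : Prop :=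
  AnalyticAt ℂ γ 0 ∧ P2.proj (γ 0) = q ∧ LinearIndependent ℂ ![γ 0, deriv γ 0] ∧
    ∀ᶠ s in 𝓝 (0 : ℂ), P2.proj (γ s) ∈ A

/-- `F` is a reduced holomorphic local equation, near the point `v` of `ℂ³ \ {0}`, of the cone over
the smooth complex curve `B`. -/
def IsLocalEquation (B : Set P2) (v : Fin 3 → ℂ) (F : (Fin 3 → ℂ) → ℂ) : Prop :=
  AnalyticAt ℂ F v ∧ fderiv ℂ F v ≠ 0 ∧ ∀ᶠ u in 𝓝 v, (F u = 0 ↔ P2.proj u ∈ B)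

/-- The intersection multiplicity at `q` of two smooth complex curves `A`, `B` in `ℙ²`: the order of
vanishing along `A` of a local equation of `B` (it is `⊤` if the curves coincide near `q`). For
smooth curves through `q` the order does not depend on the choices, so that the set below has
exactly one element. -/
def intersectionMultiplicity (A B : Set P2) (q : P2) : ℕ∞ :=
  sInf {m : ℕ∞ | ∃ (γ : ℂ → (Fin 3 → ℂ)) (F : (Fin 3 → ℂ) → ℂ),
    IsLocalParam A q γ ∧ IsLocalEquation B (γ 0) F ∧ m = analyticOrderAt (fun s => F (γ s)) 0}

/-- The curves `A` and `B` intersect in at most `N` points, counted with multiplicity. -/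
def MeetAtMost (N : ℕ) (A B : Set P2) : Prop :=
  ∀ S : Finset P2, (S : Set P2) ⊆ A ∩ B →
    ∑ q ∈ S, intersectionMultiplicity A B q ≤ (N : ℕ∞)

end

noncomputable section

open Metric Asymptotics

/-! ### One complex variable: Cauchy bounds, normal families, counting zeros -/

section OneVariable

/-! Near each point of `X` the plaques are graphs w = f_t(ζ) over a fixed disc. The C¹ hypothesis
makes holonomy bi-Lipschitz, so |f_t − f_s| at one point of the disc is at most C times its value at
any other: a Harnack inequality for pairs of leaves (`GraphChart.comp`). Intersections of the graph
t₁ with a shear of the graph t₂ are zeros of a holomorphic function, `gap`. By the Harnack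
inequality the gap is at most a constant times `spread` = |ε| + |f_{t₁}(0) − f_{t₂}(0)|. If it is
also at least c·spread somewhere in a smaller disc, a Jensen type bound
(`exists_bound_sum_analyticOrderAt`) limits the number of zeros independently of ε, t₁ and t₂. A
perturbation of relative size κ|ε| of the linear map does not spoil the lower bound, which leaves
room for the unitary maps. Compactness of `X` then gives one N.

What remains is to exclude the failure of the lower bound, called `Degenerate`. To first order,
gap/spread tends to G − e·ν, where G is the limit of (f_{t₁} − f_{t₂})/spread, e the limit of
ε/spread, and ν the normal component of the field z ∂/∂w along the limit graph. If this limit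
vanishes, then e ≠ 0 and ν is the limit of (f_{t₁} − f_{t₂})/ε, so the Harnack inequality shows that
ν vanishes nowhere or identically. Degeneracy does not depend on the chart (`Degenerate.transfer`)
and is a closed condition, so the degenerate leaves form a compact union of leaves. If nonempty, by
the maximum principle (`exists_mem_linear_eq_zero`) it meets the line z = 0. The field vanishes
there, hence ν ≡ 0 on a degenerate graph, and that graph lies in a line az + bt = 0
(`exists_line_of_normal_eq_zero`).

By analytic continuation the whole line is then made of leaf germs (`mem_lineSet`), and `X` is
contained in it (`subset_line`). Otherwise leaves accumulate on the line. Their normalized heights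
converge to nonvanishing sections over pieces of the line, and the spherical norm of the logarithmic
derivative, a rotation invariant quantity, would attain a maximum, which `false_of_norm_logDeriv_le`
forbids. Finally, `X` contains a graph w = f(z) over a neighbourhood of z = 0 in the chart t = 1,
and on it az + b = 0 forces a = b = 0. -/

lemma norm_sub_le_of_bounded_holomorphic {f : ℂ → ℂ} {R s κ : ℝ} (hsR : s < R)
    (hf : DifferentiableOn ℂ f (ball 0 R)) (hb : ∀ z ∈ ball (0 : ℂ) R, ‖f z‖ ≤ κ)
    {a b : ℂ} (ha : a ∈ ball (0 : ℂ) s) (hb' : b ∈ ball (0 : ℂ) s) :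
    ‖f a - f b‖ ≤ κ / (R - s) * ‖a - b‖ := by
  have hsub : ball (0 : ℂ) s ⊆ ball 0 R := ball_subset_ball hsR.le
  refine Convex.norm_image_sub_le_of_norm_deriv_le (s := ball (0 : ℂ) s) (fun z hz => ?_)
    (fun z hz => ?_) (convex_ball 0 s) hb' ha
  · exact hf.differentiableAt (isOpen_ball.mem_nhds (hsub hz))
  · have key : ∀ r : ℝ, 0 < r → r < R - s → ‖deriv f z‖ ≤ κ / r := by
      intro r hr hrs
      have hsub2 : closedBall z r ⊆ ball (0 : ℂ) R := by
        intro y hy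
        have h1 : dist y z ≤ r := hy
        have h2 : dist z 0 < s := hz
        have : dist y 0 ≤ dist y z + dist z 0 := dist_triangle _ _ _
        exact mem_ball.2 (by linarith)
      refine Complex.norm_deriv_le_of_forall_mem_sphere_norm_le hr ?_ ?_
      · exact (hf.mono hsub2).diffContOnCl_ball subset_rfl
      · exact fun y hy => hb y (hsub2 (sphere_subset_closedBall hy))
    have hlim : Tendsto (fun r : ℝ => κ / r) (𝓝[<] (R - s)) (𝓝 (κ / (R - s))) := by
      refine Tendsto.mono_left ?_ nhdsWithin_le_nhds
      exact (continuousAt_const.div continuousAt_id (by simp; linarith))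
    refine ge_of_tendsto hlim ?_
    filter_upwards [Ioo_mem_nhdsLT (show (0 : ℝ) < R - s by linarith)] with r hr
    exact key r hr.1 hr.2

/-- Montel's theorem along an ultrafilter: values in a compact disc converge pointwise without
passing to subsequences, and the common Lipschitz bound on smaller discs upgrades this to locally
uniform convergence. -/
lemma exists_tendstoLocallyUniformlyOn_of_bounded {I : Type*} (𝒱 : Ultrafilter I)
    {F : I → ℂ → ℂ} {R C : ℝ}
    (hF : ∀ᶠ i in (𝒱 : Filter I), DifferentiableOn ℂ (F i) (ball 0 R))
    (hb : ∀ᶠ i in (𝒱 : Filter I), ∀ z ∈ ball (0 : ℂ) R, ‖F i z‖ ≤ C) :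
    ∃ G : ℂ → ℂ, TendstoLocallyUniformlyOn F G 𝒱 (ball 0 R) ∧
      DifferentiableOn ℂ G (ball 0 R) := by
  have hlim : ∀ z ∈ ball (0 : ℂ) R, ∃ g, Tendsto (fun i => F i z) 𝒱 (𝓝 g) := by
    intro z hz
    have hc : IsCompact (closedBall (0 : ℂ) C) := isCompact_closedBall _ _
    obtain ⟨g, -, hg⟩ := hc.ultrafilter_le_nhds (𝒱.map fun i => F i z) (by
      simp only [Ultrafilter.coe_map, le_principal_iff, mem_map]
      filter_upwards [hb] with i hi
      simpa using hi z hz)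
    exact ⟨g, hg⟩
  choose! G hG using hlim
  have hT : TendstoLocallyUniformlyOn F G 𝒱 (ball 0 R) := by
    rw [Metric.tendstoLocallyUniformlyOn_iff]
    intro ε hε x hx
    have hx' : ‖x‖ < R := by simpa using hx
    obtain ⟨s, hxs, hsR⟩ := exists_between hx'
    set K := C / (R - s) with hK
    have hlip : ∀ᶠ i in (𝒱 : Filter I), ∀ a ∈ ball (0 : ℂ) s, ∀ b ∈ ball (0 : ℂ) s,
        ‖F i a - F i b‖ ≤ K * ‖a - b‖ := by
      filter_upwards [hF, hb] with i h1 h2 a ha b hb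
      exact norm_sub_le_of_bounded_holomorphic hsR h1 h2 ha hb
    have hsub : ball (0 : ℂ) s ⊆ ball 0 R := ball_subset_ball hsR.le
    have hGlip : ∀ a ∈ ball (0 : ℂ) s, ∀ b ∈ ball (0 : ℂ) s, ‖G a - G b‖ ≤ K * ‖a - b‖ := by
      intro a ha b hb
      refine le_of_tendsto ((hG a (hsub ha)).sub (hG b (hsub hb))).norm ?_
      filter_upwards [hlip] with i hi using hi a ha b hb
    have hxs' : x ∈ ball (0 : ℂ) s := by simpa using hxs
    have hKpos : 0 < 4 * (|K| + 1) := by positivity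
    refine ⟨ball 0 s ∩ ball x (ε / (4 * (|K| + 1))), ?_, ?_⟩
    · exact mem_nhdsWithin_of_mem_nhds (inter_mem (isOpen_ball.mem_nhds hxs')
        (ball_mem_nhds _ (by positivity)))
    · have h3 : ∀ᶠ i in (𝒱 : Filter I), ‖F i x - G x‖ < ε / 4 := by
        have := (tendsto_iff_norm_sub_tendsto_zero.1 (hG x hx))
        exact this.eventually (gt_mem_nhds (by positivity))
      filter_upwards [hlip, h3] with i hi h3 y hy
      have hd : ‖y - x‖ < ε / (4 * (|K| + 1)) := by simpa [dist_eq_norm] using hy.2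
      have hd2 : K * ‖y - x‖ ≤ ε / 4 := by
        have h5 : K * ‖y - x‖ ≤ (|K| + 1) * ‖y - x‖ :=
          mul_le_mul_of_nonneg_right (by linarith [le_abs_self K]) (norm_nonneg _)
        have h6 : (|K| + 1) * ‖y - x‖ ≤ (|K| + 1) * (ε / (4 * (|K| + 1))) :=
          mul_le_mul_of_nonneg_left hd.le (by positivity)
        have h7 : (|K| + 1) * (ε / (4 * (|K| + 1))) = ε / 4 := by
          have : |K| + 1 ≠ 0 := by positivity
          field_simp
        linarith
      have e1 := hi y hy.1 x hxs'
      have e2 := hGlip y hy.1 x hxs'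
      rw [dist_eq_norm]
      have : G y - F i y = (G y - G x) - (F i y - F i x) - (F i x - G x) := by ring
      rw [this]
      calc _ ≤ ‖G y - G x‖ + ‖F i y - F i x‖ + ‖F i x - G x‖ :=
            (norm_sub_le _ _).trans (add_le_add (norm_sub_le _ _) le_rfl)
        _ < ε := by linarith
  exact ⟨G, hT, hT.differentiableOn hF isOpen_ball⟩

lemma eqOn_zero_of_differentiableOn_ball {H : ℂ → ℂ} {r : ℝ} {z : ℂ}
    (hH : DifferentiableOn ℂ H (ball 0 r)) (hz : z ∈ ball (0 : ℂ) r)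
    (h : ∃ᶠ w in 𝓝[≠] z, H w = 0) : ∀ w ∈ ball (0 : ℂ) r, H w = 0 := fun _ hw =>
  (hH.analyticOnNhd isOpen_ball).eqOn_zero_of_preconnected_of_frequently_eq_zero
    (convex_ball 0 r).isPreconnected hz h hw

/-- Dividing out finitely many zeros. -/
lemma exists_eq_prod_mul_of_le_analyticOrderAt {H : ℂ → ℂ} {r : ℝ}
    (hH : DifferentiableOn ℂ H (ball 0 r)) (n : ℂ → ℕ) (Z : Finset ℂ)
    (hZ : ∀ a ∈ Z, a ∈ ball (0 : ℂ) r ∧ (n a : ℕ∞) ≤ analyticOrderAt H a) :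
    ∃ h : ℂ → ℂ, DifferentiableOn ℂ h (ball 0 r) ∧
      ∀ z ∈ ball (0 : ℂ) r, H z = (∏ a ∈ Z, (z - a) ^ n a) * h z := by
  classical
  induction Z using Finset.induction_on with
  | empty => exact ⟨H, hH, by simp⟩
  | insert b Z hb ih =>
    obtain ⟨h, hd, hh⟩ := ih fun a ha => hZ a (Finset.mem_insert_of_mem ha)
    obtain ⟨hbr, hbn⟩ := hZ b (Finset.mem_insert_self _ _)
    have han : AnalyticAt ℂ h b := hd.analyticAt (isOpen_ball.mem_nhds hbr)
    set P : ℂ → ℂ := fun z => ∏ a ∈ Z, (z - a) ^ n a with hP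
    have hPan : AnalyticAt ℂ P b := by
      have : Differentiable ℂ P := by fun_prop
      exact this.analyticAt b
    have hPb : P b ≠ 0 := by
      rw [hP]
      refine Finset.prod_ne_zero_iff.2 fun a ha => pow_ne_zero _ (sub_ne_zero.2 ?_)
      rintro rfl; exact hb ha
    have hord : analyticOrderAt H b = analyticOrderAt h b := by
      have h1 : H =ᶠ[𝓝 b] P * h := by
        filter_upwards [isOpen_ball.mem_nhds hbr] with z hz using hh z hz
      rw [analyticOrderAt_congr h1, analyticOrderAt_mul hPan han,
        (hPan.analyticOrderAt_eq_zero).2 hPb, zero_add]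
    rw [hord, natCast_le_analyticOrderAt han] at hbn
    obtain ⟨g, hg, hgh⟩ := hbn
    set k : ℂ → ℂ := fun z => if z = b then g b else h z / (z - b) ^ n b with hk
    have hkg : k =ᶠ[𝓝 b] g := by
      filter_upwards [hgh] with z hz
      by_cases hzb : z = b
      · simp [hk, hzb]
      · have : (z - b) ^ n b ≠ 0 := pow_ne_zero _ (sub_ne_zero.2 hzb)
        simp [hk, hzb, hz, this]
    refine ⟨k, ?_, ?_⟩
    · intro z hz
      by_cases hzb : z = b
      · subst hzb
        exact (hg.differentiableAt.congr_of_eventuallyEq hkg).differentiableWithinAt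
      · have h1 : k =ᶠ[𝓝 z] fun z => h z / (z - b) ^ n b := by
          filter_upwards [isOpen_ne.mem_nhds hzb] with w hw
          simp [hk, show w ≠ b from hw]
        have h2 : DifferentiableAt ℂ (fun z => h z / (z - b) ^ n b) z := by
          refine (hd.differentiableAt (isOpen_ball.mem_nhds hz)).div (by fun_prop)
            (pow_ne_zero _ (sub_ne_zero.2 hzb))
        exact (h2.congr_of_eventuallyEq h1).differentiableWithinAt
    · intro z hz
      rw [hh z hz, Finset.prod_insert hb]
      by_cases hzb : z = b
      · subst hzb
        have := hgh.self_of_nhds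
        simp only [hk, if_true]
        rw [this]; simp only [smul_eq_mul]; ring
      · have : (z - b) ^ n b ≠ 0 := pow_ne_zero _ (sub_ne_zero.2 hzb)
        simp only [hk, if_neg hzb]
        field_simp

/-- A holomorphic function that is not too small somewhere in a small disc has, in that disc, a
bounded number of zeros. -/
lemma exists_bound_sum_analyticOrderAt {C c : ℝ} (hc : 0 < c) :
    ∃ N : ℕ, ∀ (H : ℂ → ℂ) (r m : ℝ), 0 < m → DifferentiableOn ℂ H (ball 0 r) →
      (∀ z ∈ ball (0 : ℂ) r, ‖H z‖ ≤ C * m) →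
      (∃ z ∈ ball (0 : ℂ) (r / 4), c * m ≤ ‖H z‖) →
      ∀ Z : Finset ℂ, (∀ a ∈ Z, a ∈ ball (0 : ℂ) (r / 4)) →
        ∑ a ∈ Z, analyticOrderAt H a ≤ (N : ℕ∞) := by
  -- After division by the zeros in the ball of radius r/4, each factor is at least 5r/8 on the
  -- circle of radius 7r/8 and at most r/2 at z₀. The maximum principle for the quotient gains
  -- (r/2)/(5r/8) = 4/5 per zero.
  obtain ⟨N, hN⟩ : ∃ N : ℕ, C * (4 / 5 : ℝ) ^ N < c := by
    have : Tendsto (fun N : ℕ => C * (4 / 5 : ℝ) ^ N) atTop (𝓝 (C * 0)) :=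
      (tendsto_pow_atTop_nhds_zero_of_lt_one (by norm_num) (by norm_num)).const_mul C
    rw [mul_zero] at this
    exact (this.eventually (gt_mem_nhds hc)).exists
  refine ⟨N, fun H r m hm hH hb ⟨z₀, hz₀, hz₀c⟩ Z hZ => ?_⟩
  have hr : 0 < r := by
    have := (norm_nonneg z₀).trans_lt (by simpa using hz₀)
    linarith
  have hsub : ball (0 : ℂ) (r / 4) ⊆ ball 0 r := ball_subset_ball (by linarith)
  have hC : 0 ≤ C := by
    have h1 := hb z₀ (hsub hz₀)
    have h2 : 0 < C * m := lt_of_lt_of_le (by positivity) (hz₀c.trans h1)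
    exact (pos_of_mul_pos_left h2 hm.le).le
  have htop : ∀ a ∈ Z, analyticOrderAt H a ≠ ⊤ := by
    intro a ha htop
    rw [analyticOrderAt_eq_top] at htop
    have : ∃ᶠ w in 𝓝[≠] a, H w = 0 := (htop.filter_mono nhdsWithin_le_nhds).frequently
    have := eqOn_zero_of_differentiableOn_ball hH (hsub (hZ a ha)) this z₀ (hsub hz₀)
    rw [this, norm_zero] at hz₀c
    exact absurd hz₀c (not_le.2 (by positivity))
  set n : ℂ → ℕ := fun a => (analyticOrderAt H a).toNat with hn
  have hcast : ∀ a ∈ Z, (n a : ℕ∞) = analyticOrderAt H a := fun a ha =>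
    ENat.natCast_toNat (htop a ha)
  obtain ⟨h, hd, hh⟩ := exists_eq_prod_mul_of_le_analyticOrderAt hH n Z
    fun a ha => ⟨hsub (hZ a ha), (hcast a ha).le⟩
  rw [← Finset.sum_congr rfl hcast, ← Nat.cast_sum, Nat.cast_le]
  by_contra hlt
  push Not at hlt
  set K := ∑ a ∈ Z, n a with hK
  set s := 7 * r / 8 with hs
  have hs0 : 0 < s := by positivity
  have hsr : closedBall (0 : ℂ) s ⊆ ball 0 r := closedBall_subset_ball (by rw [hs]; linarith)
  have hd1 : DiffContOnCl ℂ h (ball 0 s) := (hd.mono hsr).diffContOnCl_ball subset_rfl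
  have hbd : ∀ z ∈ frontier (ball (0 : ℂ) s), ‖h z‖ ≤ C * m / (5 * r / 8) ^ K := by
    intro z hz
    rw [frontier_ball _ hs0.ne'] at hz
    have hz' : ‖z‖ = s := by simpa using hz
    have h1 := hh z (hsr (sphere_subset_closedBall hz))
    have h2 := hb z (hsr (sphere_subset_closedBall hz))
    rw [h1, norm_mul, norm_prod] at h2
    have h3 : (5 * r / 8) ^ K ≤ ∏ a ∈ Z, ‖(z - a) ^ n a‖ := by
      rw [hK, ← Finset.prod_pow_eq_pow_sum]
      refine Finset.prod_le_prod (fun a _ => by positivity) fun a ha => ?_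
      rw [norm_pow]
      refine pow_le_pow_left₀ (by positivity) ?_ _
      have h4 : ‖a‖ < r / 4 := by simpa using hZ a ha
      have h5 := norm_sub_norm_le z a
      rw [hz'] at h5
      rw [hs] at h5
      linarith
    rw [le_div_iff₀ (by positivity), mul_comm]
    exact (mul_le_mul_of_nonneg_right h3 (norm_nonneg _)).trans h2
  have hz₀s : z₀ ∈ closure (ball (0 : ℂ) s) := subset_closure
    (ball_subset_ball (by rw [hs]; linarith) hz₀)
  have h6 := Complex.norm_le_of_forall_mem_frontier_norm_le isBounded_ball hd1 hbd hz₀s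
  have h7 : ∏ a ∈ Z, ‖(z₀ - a) ^ n a‖ ≤ (r / 2) ^ K := by
    rw [hK, ← Finset.prod_pow_eq_pow_sum]
    refine Finset.prod_le_prod (fun a _ => norm_nonneg _) fun a ha => ?_
    rw [norm_pow]
    refine pow_le_pow_left₀ (norm_nonneg _) ?_ _
    have h4 : ‖a‖ < r / 4 := by simpa using hZ a ha
    have h5 : ‖z₀‖ < r / 4 := by simpa using hz₀
    have := norm_sub_le z₀ a
    linarith
  have h8 : ‖H z₀‖ ≤ (r / 2) ^ K * (C * m / (5 * r / 8) ^ K) := by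
    rw [hh z₀ (hsub hz₀), norm_mul, norm_prod]
    exact mul_le_mul h7 h6 (norm_nonneg _) (by positivity)
  have h9 : (r / 2) ^ K * (C * m / (5 * r / 8) ^ K) = C * (4 / 5) ^ K * m := by
    have : r / 2 = 4 / 5 * (5 * r / 8) := by ring
    rw [this, mul_pow]
    field_simp
  have h10 : (4 / 5 : ℝ) ^ K ≤ (4 / 5) ^ N :=
    pow_le_pow_of_le_one (by norm_num) (by norm_num) hlt.le
  have h11 : C * (4 / 5 : ℝ) ^ K * m ≤ C * (4 / 5) ^ N * m :=
    mul_le_mul_of_nonneg_right (mul_le_mul_of_nonneg_left h10 hC) hm.le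
  have h12 : C * (4 / 5 : ℝ) ^ N * m < c * m := mul_lt_mul_of_pos_right hN hm
  linarith

end OneVariable

/-! ### Topology of the projective plane -/

namespace P2

lemma proj_of_ne_zero {v : Fin 3 → ℂ} (h : v ≠ 0) : proj v = Projectivization.mk ℂ v h := by
  simp [proj, h]

lemma proj_smul (v : Fin 3 → ℂ) {c : ℂ} (hc : c ≠ 0) : proj (c • v) = proj v := by
  by_cases h : v = 0
  · simp [h]
  · rw [proj_of_ne_zero h, proj_of_ne_zero (smul_ne_zero hc h), Projectivization.mk_eq_mk_iff']
    exact ⟨c, rfl⟩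

lemma proj_eq_proj_iff {u v : Fin 3 → ℂ} (hu : u ≠ 0) (hv : v ≠ 0) :
    proj u = proj v ↔ ∃ c : ℂ, c ≠ 0 ∧ u = c • v := by
  rw [proj_of_ne_zero hu, proj_of_ne_zero hv, Projectivization.mk_eq_mk_iff']
  constructor
  · rintro ⟨c, hc⟩
    refine ⟨c, ?_, hc.symm⟩
    rintro rfl
    exact hu (by rw [← hc, zero_smul])
  · rintro ⟨c, -, hc⟩
    exact ⟨c, hc.symm⟩

lemma exists_proj_eq (x : P2) : ∃ v : Fin 3 → ℂ, v ≠ 0 ∧ proj v = x := by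
  refine ⟨x.rep, x.rep_nonzero, ?_⟩
  rw [proj_of_ne_zero x.rep_nonzero, x.mk_rep]

lemma map_proj (A : (Fin 3 → ℂ) ≃ₗ[ℂ] (Fin 3 → ℂ)) {v : Fin 3 → ℂ} (hv : v ≠ 0) :
    Projectivization.map A.toLinearMap A.injective (proj v) = proj (A v) := by
  have : A v ≠ 0 := by simpa using hv
  rw [proj_of_ne_zero hv, proj_of_ne_zero this, Projectivization.map_mk]
  rfl

lemma isOpen_iff {s : Set P2} :
    IsOpen s ↔ IsOpen {v : {v : Fin 3 → ℂ // v ≠ 0} | proj v.1 ∈ s} := by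
  rw [isOpen_coinduced]
  have : (Projectivization.mk' ℂ (V := Fin 3 → ℂ)) ⁻¹' s = {v | proj v.1 ∈ s} := by
    ext v
    simp [proj_of_ne_zero v.2]
  rw [this]

lemma continuousAt_proj {v : Fin 3 → ℂ} (hv : v ≠ 0) : ContinuousAt proj v := by
  have ho : IsOpen {v : Fin 3 → ℂ | v ≠ 0} := isOpen_ne
  have : ContinuousOn proj {v : Fin 3 → ℂ | v ≠ 0} := by
    rw [continuousOn_iff_continuous_domRestrict]
    refine continuous_def.2 fun s hs => ?_
    exact isOpen_iff.1 hs
  exact this.continuousAt (ho.mem_nhds hv)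

lemma continuous_of_continuousAt_comp_proj {Y : Type*} [TopologicalSpace Y] {g : P2 → Y}
    (h : ∀ v : Fin 3 → ℂ, v ≠ 0 → ContinuousAt (fun u => g (proj u)) v) : Continuous g := by
  refine continuous_def.2 fun s hs => isOpen_iff.2 ?_
  have : Continuous fun v : {v : Fin 3 → ℂ // v ≠ 0} => g (proj v.1) := by
    refine continuous_iff_continuousAt.2 fun v => ?_
    exact ContinuousAt.comp (f := Subtype.val) (g := fun u => g (proj u)) (h v.1 v.2)
      continuous_subtype_val.continuousAt
  exact hs.preimage this

/-- The saturation of `U` under scaling is a union of dilates of `U`, hence open. -/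
lemma isOpen_image_proj {U : Set (Fin 3 → ℂ)} (hU : IsOpen U) (h0 : ∀ v ∈ U, v ≠ 0) :
    IsOpen (proj '' U) := by
  rw [isOpen_iff]
  have : {v : {v : Fin 3 → ℂ // v ≠ 0} | proj v.1 ∈ proj '' U} =
      ⋃ c : {c : ℂ // c ≠ 0}, (fun v : {v : Fin 3 → ℂ // v ≠ 0} => c.1 • v.1) ⁻¹' U := by
    ext v
    simp only [mem_ofPred_eq, mem_image, mem_iUnion, mem_preimage]
    constructor
    · rintro ⟨u, hu, huv⟩
      obtain ⟨c, hc, rfl⟩ := (proj_eq_proj_iff (h0 u hu) v.2).1 huv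
      exact ⟨⟨c, hc⟩, hu⟩
    · rintro ⟨c, hc⟩
      exact ⟨_, hc, proj_smul _ c.2⟩
  rw [this]
  refine isOpen_iUnion fun c => hU.preimage ?_
  fun_prop

lemma image_proj_mem_nhds {v : Fin 3 → ℂ} (hv : v ≠ 0) {U : Set (Fin 3 → ℂ)} (hU : U ∈ 𝓝 v) :
    proj '' U ∈ 𝓝 (proj v) := by
  obtain ⟨W, hWU, hW, hvW⟩ := _root_.mem_nhds_iff.1 (inter_mem hU (isOpen_ne.mem_nhds hv))
  refine mem_of_superset ((isOpen_image_proj hW fun u hu => (hWU hu).2).mem_nhds ⟨v, hvW, rfl⟩) ?_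
  exact image_mono fun u hu => (hWU hu).1

/-- The function |a × v| / |v| is homogeneous of degree zero and continuous, and it vanishes exactly
at the point represented by a, so it separates that point from any other. -/
instance instT2Space : T2Space P2 := by
  refine ⟨fun x y hxy => ?_⟩
  obtain ⟨a, ha, rfl⟩ := exists_proj_eq x
  obtain ⟨b, hb, rfl⟩ := exists_proj_eq y
  have hrep : ∀ v : Fin 3 → ℂ, v ≠ 0 → ∃ c : ℂ, c ≠ 0 ∧ (proj v).rep = c • v := fun v hv =>
    (proj_eq_proj_iff (proj v).rep_nonzero hv).1
      (by rw [proj_of_ne_zero (proj v).rep_nonzero, (proj v).mk_rep])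
  let g : P2 → ℝ := fun x => ‖crossProduct a x.rep‖ / ‖x.rep‖
  have hg : ∀ v : Fin 3 → ℂ, v ≠ 0 → g (proj v) = ‖crossProduct a v‖ / ‖v‖ := by
    intro v hv
    obtain ⟨c, hc, h⟩ := hrep v hv
    simp only [g, h, map_smul, norm_smul]
    exact mul_div_mul_left _ _ (norm_ne_zero_iff.2 hc)
  have hgc : Continuous g := by
    refine continuous_of_continuousAt_comp_proj fun v hv => ?_
    have h1 : (fun u => g (proj u)) =ᶠ[𝓝 v] fun u => ‖crossProduct a u‖ / ‖u‖ := by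
      filter_upwards [isOpen_ne.mem_nhds hv] with u hu using hg u hu
    refine ContinuousAt.congr ?_ h1.symm
    have : Continuous (crossProduct a) := LinearMap.continuous_of_finiteDimensional _
    exact (this.norm.continuousAt).div continuous_norm.continuousAt (norm_ne_zero_iff.2 hv)
  have h1 : g (proj a) = 0 := by rw [hg a ha, cross_self]; simp
  have h2 : g (proj b) ≠ 0 := by
    rw [hg b hb]
    refine div_ne_zero (norm_ne_zero_iff.2 ?_) (norm_ne_zero_iff.2 hb)
    rw [crossProduct_ne_zero_iff_linearIndependent, LinearIndependent.pair_iff' ha]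
    intro c hc
    have hc0 : c ≠ 0 := by rintro rfl; exact hb (by rw [← hc, zero_smul])
    exact hxy (by rw [← hc, proj_smul _ hc0])
  obtain ⟨u, v, hu, hv, h3, h4, h5⟩ := t2_separation (h1.trans_ne h2.symm)
  exact ⟨g ⁻¹' u, g ⁻¹' v, hu.preimage hgc, hv.preimage hgc, h3, h4, h5.preimage g⟩

end P2

/-! ### Affine charts attached to a basis -/

lemma vec_one_ne_zero (ζ w : ℂ) : (![1, ζ, w] : Fin 3 → ℂ) ≠ 0 := fun h => by
  simpa using congrFun h 0

/-- The point with affine coordinates `x` in the affine chart of `ℙ²` given by the basis `M`. -/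
def affPt (M : (Fin 3 → ℂ) ≃L[ℂ] (Fin 3 → ℂ)) (x : ℂ × ℂ) : P2 := P2.proj (M ![1, x.1, x.2])

section Affine

variable (M : (Fin 3 → ℂ) ≃L[ℂ] (Fin 3 → ℂ))

lemma affVec_ne_zero (x : ℂ × ℂ) : M ![1, x.1, x.2] ≠ 0 := by
  simp

lemma smul_affVec {u : Fin 3 → ℂ} (h : u 0 ≠ 0) : u = u 0 • ![1, u 1 / u 0, u 2 / u 0] := by
  ext i; fin_cases i <;> simp <;> field_simp

lemma proj_eq_affPt {v : Fin 3 → ℂ} (h : M.symm v 0 ≠ 0) :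
    P2.proj v = affPt M (M.symm v 1 / M.symm v 0, M.symm v 2 / M.symm v 0) := by
  conv_lhs => rw [← M.apply_symm_apply v, smul_affVec h, map_smul, P2.proj_smul _ h]
  rfl

lemma eq_of_proj_eq_affPt {v : Fin 3 → ℂ} (hv : v ≠ 0) {x : ℂ × ℂ} (h : P2.proj v = affPt M x) :
    M.symm v 0 ≠ 0 ∧ M.symm v 1 / M.symm v 0 = x.1 ∧ M.symm v 2 / M.symm v 0 = x.2 := by
  obtain ⟨c, hc, rfl⟩ := (P2.proj_eq_proj_iff hv (affVec_ne_zero M x)).1 h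
  simp [hc]

lemma affPt_injective : Function.Injective (affPt M) := by
  intro x y h
  have := eq_of_proj_eq_affPt M (affVec_ne_zero M x) (x := y) h
  simp only [ContinuousLinearEquiv.symm_apply_apply] at this
  ext
  · simpa using this.2.1
  · simpa using this.2.2

lemma continuous_vec : Continuous fun x : ℂ × ℂ => (![1, x.1, x.2] : Fin 3 → ℂ) := by
  refine continuous_pi fun i => ?_
  fin_cases i <;> simp <;> fun_prop

lemma continuous_affPt : Continuous (affPt M) := by
  refine continuous_iff_continuousAt.2 fun x => ?_
  exact ContinuousAt.comp (f := fun x : ℂ × ℂ => M ![1, x.1, x.2])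
    (P2.continuousAt_proj (affVec_ne_zero M x)) (M.continuous.comp continuous_vec).continuousAt

lemma affPt_image_mem_nhds {x : ℂ × ℂ} {U : Set (ℂ × ℂ)} (hU : U ∈ 𝓝 x) :
    affPt M '' U ∈ 𝓝 (affPt M x) := by
  set k : (Fin 3 → ℂ) → ℂ × ℂ := fun v => (M.symm v 1 / M.symm v 0, M.symm v 2 / M.symm v 0)
  have h0 : M.symm (M ![1, x.1, x.2]) 0 ≠ 0 := by simp
  have hc : ContinuousAt (fun v => M.symm v 0) (M ![1, x.1, x.2]) := by fun_prop
  have hk : ContinuousAt k (M ![1, x.1, x.2]) := by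
    refine ContinuousAt.prodMk (ContinuousAt.div ?_ ?_ h0) (ContinuousAt.div ?_ ?_ h0) <;> fun_prop
  have hkx : k (M ![1, x.1, x.2]) = x := by simp [k]
  have hk' : k ⁻¹' U ∈ 𝓝 (M ![1, x.1, x.2]) := hk (by rwa [hkx])
  refine mem_of_superset (P2.image_proj_mem_nhds (affVec_ne_zero M x)
    (inter_mem hk' (hc.eventually_ne h0))) ?_
  rintro _ ⟨v, ⟨hv, hv0⟩, rfl⟩
  exact ⟨k v, hv, (proj_eq_affPt M hv0).symm⟩

lemma isOpenEmbedding_affPt : IsOpenEmbedding (affPt M) := by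
  refine IsOpenEmbedding.of_continuous_injective_isOpenMap (continuous_affPt M)
    (affPt_injective M) ?_
  exact IsOpenMap.of_nhds_le fun x => by
    intro s hs
    exact mem_of_superset (affPt_image_mem_nhds M hs) (image_preimage_subset _ _)

end Affine

/-! ### Graph charts and their construction from flow boxes -/

/-- Local coordinates on `ℙ²` in which the plaques of one flow box of the lamination are graphs of
holomorphic functions over a fixed disc. -/
structure GraphChart {X : Set P2} {ι : Type*} (ℒ : C1Lamination X ι) where
  idx : ι
  basis : (Fin 3 → ℂ) ≃L[ℂ] (Fin 3 → ℂ)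
  R : ℝ
  ρ : ℝ
  C : ℝ
  T : Set ℂ
  f : ℂ → ℂ → ℂ
  R_pos : 0 < R
  R_le : R ≤ 1
  ρ_pos : 0 < ρ
  T_subset : T ⊆ (ℒ.box idx).transversal
  hol : ∀ t ∈ T, DifferentiableOn ℂ (f t) (ball 0 R)
  norm_le : ∀ t ∈ T, ∀ ζ ∈ ball (0 : ℂ) R, ‖f t ζ‖ ≤ 1
  mem_plaque : ∀ t ∈ T, ∀ ζ ∈ ball (0 : ℂ) R, affPt basis (ζ, f t ζ) ∈ (ℒ.box idx).plaque t
  -- All points of `X` in the bidisc are captured, whichever flow box they were first seen in.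
  cover : ∀ ζ ∈ ball (0 : ℂ) R, ∀ w ∈ ball (0 : ℂ) ρ, affPt basis (ζ, w) ∈ X → ∃ t ∈ T, f t ζ = w
  -- The Harnack inequality between leaves. It is the quantitative content of the C¹ hypothesis.
  comp : ∀ t ∈ T, ∀ s ∈ T, ∀ ζ ∈ ball (0 : ℂ) R, ∀ ζ' ∈ ball (0 : ℂ) R,
    ‖f t ζ - f s ζ‖ ≤ C * ‖f t ζ' - f s ζ'‖

namespace C1FlowBox

variable {X : Set P2} (B : C1FlowBox X)

lemma mem_target {z t : ℂ} (hz : z ∈ ball (0 : ℂ) 1) (ht : t ∈ B.transversal) :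
    (z, t) ∈ B.chart.target := B.subset_target ⟨hz, ht⟩

lemma chart_symm_apply {z t : ℂ} (hz : z ∈ ball (0 : ℂ) 1) (ht : t ∈ B.transversal) :
    B.chart (B.chart.symm (z, t)) = (z, t) := B.chart.right_inv (B.mem_target hz ht)

lemma contDiffAt_chart_affPt (M : (Fin 3 → ℂ) ≃L[ℂ] (Fin 3 → ℂ)) {y : ℂ × ℂ}
    (hy : affPt M y ∈ B.chart.source) : ContDiffAt ℝ 1 (fun y => B.chart (affPt M y)) y := by
  have h1 := B.contDiff_chart _ hy _ (affVec_ne_zero M y) rfl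
  have h3 : ContDiff ℝ 1 fun y : ℂ × ℂ => (![1, y.1, y.2] : Fin 3 → ℂ) := by
    refine contDiff_pi.2 fun i => ?_
    fin_cases i <;> simp <;> fun_prop
  have h4 : ContDiff ℝ 1 (M : (Fin 3 → ℂ) → (Fin 3 → ℂ)) :=
    (M.toContinuousLinearMap.restrictScalars ℝ).contDiff
  exact ContDiffAt.comp (f := fun y : ℂ × ℂ => M ![1, y.1, y.2]) y h1 (h4.comp h3).contDiffAt

/-- A holomorphic parametrization of a plaque, in affine coordinates. -/
lemma exists_affine_param (M : (Fin 3 → ℂ) ≃L[ℂ] (Fin 3 → ℂ)) {z t : ℂ} {y : ℂ × ℂ}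
    (hz : z ∈ ball (0 : ℂ) 1) (ht : t ∈ B.transversal)
    (hy : affPt M y = B.chart.symm (z, t)) {γ : ℂ → (Fin 3 → ℂ)} (hγ : AnalyticAt ℂ γ z)
    (hγp : ∀ᶠ ζ in 𝓝 z, γ ζ ≠ 0 ∧ P2.proj (γ ζ) = B.chart.symm (ζ, t)) :
    ∃ (a b : ℂ → ℂ) (a' b' : ℂ), HasDerivAt a a' z ∧ HasDerivAt b b' z ∧ a z = y.1 ∧ b z = y.2 ∧
      (∀ᶠ ζ in 𝓝 z, affPt M (a ζ, b ζ) = B.chart.symm (ζ, t)) ∧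
      a' * M.symm (γ z) 0 = M.symm (deriv γ z) 1 - y.1 * M.symm (deriv γ z) 0 ∧
      b' * M.symm (γ z) 0 = M.symm (deriv γ z) 2 - y.2 * M.symm (deriv γ z) 0 ∧
      ∀ c' : ℂ × ℂ →L[ℝ] ℂ × ℂ, HasFDerivAt (fun y => B.chart (affPt M y)) c' y →
        ∀ h : ℂ, c' (h * a', h * b') = (h, 0) := by
  obtain ⟨h0, h1, h2⟩ := eq_of_proj_eq_affPt M hγp.self_of_nhds.1
    (x := y) (hγp.self_of_nhds.2.trans hy.symm)
  have hd : ∀ i, HasDerivAt (fun ζ => M.symm (γ ζ) i) (M.symm (deriv γ z) i) z := by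
    intro i
    have h3 : HasDerivAt (fun ζ => M.symm (γ ζ)) (M.symm (deriv γ z)) z :=
      M.symm.toContinuousLinearMap.hasFDerivAt.comp_hasDerivAt z hγ.differentiableAt.hasDerivAt
    exact hasDerivAt_pi.1 h3 i
  have ha := (hd 1).div (hd 0) h0
  have hb := (hd 2).div (hd 0) h0
  have hev : ∀ᶠ ζ in 𝓝 z, affPt M (M.symm (γ ζ) 1 / M.symm (γ ζ) 0,
      M.symm (γ ζ) 2 / M.symm (γ ζ) 0) = B.chart.symm (ζ, t) := by
    filter_upwards [hγp, (hd 0).continuousAt.eventually_ne h0] with ζ h3 h4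
    rw [← h3.2, ← proj_eq_affPt M h4]
  refine ⟨_, _, _, _, ha, hb, h1, h2, hev, ?_, ?_, ?_⟩
  · rw [← h1]; field_simp
  · rw [← h2]; field_simp
  · intro c' hc' h
    have hab : HasDerivAt (fun ζ => ((M.symm (γ ζ) 1 / M.symm (γ ζ) 0,
      M.symm (γ ζ) 2 / M.symm (γ ζ) 0) : ℂ × ℂ)) _ z := ha.prodMk hb
    have hab' := (hab.hasFDerivAt).restrictScalars ℝ
    have hy' : y = (M.symm (γ z) 1 / M.symm (γ z) 0, M.symm (γ z) 2 / M.symm (γ z) 0) :=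
      Prod.ext h1.symm h2.symm
    rw [hy'] at hc'
    have hcomp := HasFDerivAt.comp z hc' hab'
    -- In the flow box coordinates the parametrization is ζ ↦ (ζ, t), whose real derivative at h is
    -- (h, 0).
    have hid : (fun y => B.chart (affPt M y)) ∘ (fun ζ => ((M.symm (γ ζ) 1 / M.symm (γ ζ) 0,
      M.symm (γ ζ) 2 / M.symm (γ ζ) 0) : ℂ × ℂ)) =ᶠ[𝓝 z] fun ζ => (ζ, t) := by
      filter_upwards [hev, isOpen_ball.mem_nhds hz] with ζ h3 h4
      simp only [Function.comp_apply, h3]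
      exact B.chart_symm_apply h4 ht
    have h5 : HasFDerivAt (fun ζ : ℂ => (ζ, t)) _ z :=
      (hasFDerivAt_id (𝕜 := ℝ) z).prodMk (hasFDerivAt_const t z)
    have h6 := congrArg (fun L : ℂ →L[ℝ] ℂ × ℂ => L h)
      ((hcomp.congr_of_eventuallyEq hid.symm).unique h5)
    simpa using h6

/-- The C¹ lift of the inverse chart, read in affine coordinates, is a differentiable local left
inverse, so the derivative has a left inverse. -/
lemma injective_fderiv_chart_affPt (M : (Fin 3 → ℂ) ≃L[ℂ] (Fin 3 → ℂ)) {y : ℂ × ℂ}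
    (hy : affPt M y ∈ B.chart.source) {c' : ℂ × ℂ →L[ℝ] ℂ × ℂ}
    (hc' : HasFDerivAt (fun y => B.chart (affPt M y)) c' y) : Function.Injective c' := by
  obtain ⟨s, hs, hsp⟩ := B.contDiff_symm _ (B.chart.map_source hy)
  set k : ℂ × ℂ → ℂ × ℂ := fun q => (M.symm (s q) 1 / M.symm (s q) 0, M.symm (s q) 2 / M.symm (s q) 0)
  have hsy := hsp.self_of_nhds
  rw [B.chart.left_inv hy] at hsy
  obtain ⟨h0, -, -⟩ := eq_of_proj_eq_affPt M hsy.1 hsy.2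
  have hsd := hs.differentiableAt one_ne_zero
  have hi : ∀ i, DifferentiableAt ℝ (fun q => M.symm (s q) i) (B.chart (affPt M y)) := by
    intro i
    have : DifferentiableAt ℝ (fun q => M.symm (s q)) (B.chart (affPt M y)) :=
      ((M.symm.toContinuousLinearMap.restrictScalars ℝ).differentiableAt).comp _ hsd
    exact differentiableAt_pi.1 this i
  have hk : DifferentiableAt ℝ k (B.chart (affPt M y)) := by
    have hinv : DifferentiableAt ℝ (fun q => (M.symm (s q) 0)⁻¹) (B.chart (affPt M y)) :=
      (hi 0).inv h0
    simp only [k, div_eq_mul_inv]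
    exact ((hi 1).mul hinv).prodMk ((hi 2).mul hinv)
  have hcont : ContinuousAt (fun y => B.chart (affPt M y)) y := hc'.continuousAt
  have hid : k ∘ (fun y => B.chart (affPt M y)) =ᶠ[𝓝 y] id := by
    filter_upwards [hcont.eventually hsp,
      (continuous_affPt M).continuousAt.eventually (B.chart.open_source.mem_nhds hy)] with q h1 h2
    rw [B.chart.left_inv h2] at h1
    obtain ⟨-, h3, h4⟩ := eq_of_proj_eq_affPt M h1.1 h1.2
    exact Prod.ext h3 h4
  have h5 := ((hk.hasFDerivAt.comp y hc').congr_of_eventuallyEq hid.symm).unique (hasFDerivAt_id y)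
  intro u v huv
  have h6 := congrArg (fun L : ℂ × ℂ →L[ℝ] ℂ × ℂ => L u) h5
  have h7 := congrArg (fun L : ℂ × ℂ →L[ℝ] ℂ × ℂ => L v) h5
  simp only [ContinuousLinearMap.comp_apply, ContinuousLinearMap.id_apply] at h6 h7
  rw [← h6, ← h7, huv]

end C1FlowBox

namespace C1Lamination

variable {X : Set P2} {ι : Type*} (ℒ : C1Lamination X ι)

/-- A flow box supplies graph coordinates in every affine chart whose vertical direction is
transverse to the plaque through its origin. -/
theorem exists_graphChart_of_box (j : ι) {z₀ t₀ : ℂ} (hz₀ : z₀ ∈ ball (0 : ℂ) 1)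
    (ht₀ : t₀ ∈ (ℒ.box j).transversal) {γ : ℂ → (Fin 3 → ℂ)} (hγ : AnalyticAt ℂ γ z₀)
    (hγp : ∀ᶠ ζ in 𝓝 z₀, γ ζ ≠ 0 ∧ P2.proj (γ ζ) = (ℒ.box j).chart.symm (ζ, t₀))
    (M : (Fin 3 → ℂ) ≃L[ℂ] (Fin 3 → ℂ)) (hM : affPt M (0, 0) = (ℒ.box j).chart.symm (z₀, t₀))
    (hd : M.symm (deriv γ z₀) 1 ≠ 0) : ∃ D : GraphChart ℒ, D.basis = M := by
  set B := ℒ.box j with hB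
  set c : ℂ × ℂ → ℂ × ℂ := fun y => B.chart (affPt M y) with hc
  have hsrc0 : affPt M (0, 0) ∈ B.chart.source := by
    rw [hM]; exact B.chart.map_target (B.mem_target hz₀ ht₀)
  have hc0 : c (0, 0) = (z₀, t₀) := by
    simp only [hc, hM]; exact B.chart_symm_apply hz₀ ht₀
  have hcC := B.contDiffAt_chart_affPt M hsrc0
  obtain ⟨c', hc'⟩ : ∃ c' : ℂ × ℂ →L[ℝ] ℂ × ℂ, HasFDerivAt c c' (0, 0) :=
    ⟨_, (hcC.differentiableAt one_ne_zero).hasFDerivAt⟩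
  have hinj := B.injective_fderiv_chart_affPt M hsrc0 hc'
  -- Keep the horizontal coordinate and replace the vertical one by the transversal coordinate λ. A
  -- local inverse sends (ζ, t) to the point of the plaque t over ζ, so its second component is the
  -- graph function.
  set Θ : ℂ × ℂ → ℂ × ℂ := fun y => (y.1, (c y).2) with hΘ
  have hΘC : ∀ y, affPt M y ∈ B.chart.source → ContDiffAt ℝ 1 Θ y := fun y hy =>
    contDiffAt_fst.prodMk (contDiffAt_snd.comp y (B.contDiffAt_chart_affPt M hy))
  set Θ' : ℂ × ℂ →L[ℝ] ℂ × ℂ := (ContinuousLinearMap.fst ℝ ℂ ℂ).prod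
    ((ContinuousLinearMap.snd ℝ ℂ ℂ).comp c') with hΘ'
  have hΘd : HasFDerivAt Θ Θ' (0, 0) := hasFDerivAt_fst.prodMk (hc'.snd)
  obtain ⟨a, b, a', b', ha, hb, ha0, hb0, hab, haγ, -, habc⟩ :=
    B.exists_affine_param M hz₀ ht₀ hM hγ hγp
  have ha' : a' ≠ 0 := by
    rintro rfl
    simp only [zero_mul, sub_zero] at haγ
    exact hd haγ.symm
  -- A kernel vector is vertical and tangent to the plaque. Plaque tangents are the multiples of
  -- (a', b') with a' ≠ 0, so it is zero.
  have hΘinj : Function.Injective Θ' := by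
    rw [injective_iff_map_eq_zero]
    rintro ⟨u, w⟩ huw
    have h1 : u = 0 := by simpa [hΘ'] using congrArg Prod.fst huw
    have h2 : (c' (u, w)).2 = 0 := by simpa [hΘ'] using congrArg Prod.snd huw
    subst h1
    have h3 := habc c' hc' (c' (0, w)).1
    have h4 : c' (0, w) = ((c' (0, w)).1, 0) := Prod.ext rfl h2
    have h5 := hinj (h4.trans h3.symm)
    have h6 : (c' (0, w)).1 = 0 := by
      have := congrArg Prod.fst h5
      simpa [ha', eq_comm] using this
    have := congrArg Prod.snd h5
    rw [h6] at this
    simpa using this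
  set e : (ℂ × ℂ) ≃L[ℝ] (ℂ × ℂ) :=
    (LinearEquiv.ofInjectiveEndo (Θ' : ℂ × ℂ →ₗ[ℝ] ℂ × ℂ) hΘinj).toContinuousLinearEquiv with he
  have heΘ : (e : ℂ × ℂ →L[ℝ] ℂ × ℂ) = Θ' := by
    ext1 <;> rfl
  have hΘe : HasFDerivAt Θ (e : ℂ × ℂ →L[ℝ] ℂ × ℂ) (0, 0) := by rwa [heΘ]
  set P := (hΘC _ hsrc0).toOpenPartialHomeomorph Θ hΘe one_ne_zero with hP
  have hPc : ∀ y, P y = Θ y := fun y => rfl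
  have hPs : ((0, 0) : ℂ × ℂ) ∈ P.source :=
    (hΘC _ hsrc0).mem_toOpenPartialHomeomorph_source hΘe one_ne_zero
  have hP0 : P (0, 0) = (0, t₀) := by rw [hPc]; simp only [hΘ, hc0]
  have hPt : ((0, t₀) : ℂ × ℂ) ∈ P.target := hP0 ▸ P.map_source hPs
  have hPsymm0 : P.symm (0, t₀) = (0, 0) := by rw [← hP0, P.left_inv hPs]
  have hPsC : ContDiffAt ℝ 1 P.symm (0, t₀) := by
    refine P.contDiffAt_symm (f₀' := e) hPt ?_ ?_
    · rw [hPsymm0]; exact hΘe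
    · rw [hPsymm0]; exact hΘC _ hsrc0
  -- `K₁` bounds |t − s| by the difference of heights over a point and `K₂` bounds the difference of
  -- heights by |t − s|. Their product is the Harnack constant.
  obtain ⟨K₁, S₁, hS₁, hL₁⟩ := hcC.exists_lipschitzOnWith
  obtain ⟨K₂, S₂, hS₂, hL₂⟩ := hPsC.exists_lipschitzOnWith
  have hPsev := hPsC.eventually (by simp)
  obtain ⟨O, hO, hOX⟩ := B.relatively_open
  have hxO : affPt M (0, 0) ∈ O := by
    have : affPt M (0, 0) ∈ X ∩ O := by
      rw [← hOX, hM]; exact ⟨_, ⟨hz₀, ht₀⟩, rfl⟩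
    exact this.2
  have hcont := (continuous_affPt M).continuousAt (x := ((0, 0) : ℂ × ℂ))
  have hccont : ContinuousAt c (0, 0) := hcC.continuousAt
  set G : Set (ℂ × ℂ) := {y | y ∈ P.source ∧ affPt M y ∈ B.chart.source ∧ affPt M y ∈ O ∧
    (c y).1 ∈ ball (0 : ℂ) 1 ∧ ‖y.2‖ < 1 ∧ y ∈ S₁} with hG
  have hGn : ∀ᶠ y in 𝓝 ((0, 0) : ℂ × ℂ), y ∈ G := by
    have h1 : ∀ᶠ y in 𝓝 ((0, 0) : ℂ × ℂ), (c y).1 ∈ ball (0 : ℂ) 1 := by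
      have : ContinuousAt (fun y => (c y).1) (0, 0) := continuousAt_fst.comp hccont
      exact this (isOpen_ball.mem_nhds (by show (c (0, 0)).1 ∈ _; rw [hc0]; exact hz₀))
    have h2 : ∀ᶠ y in 𝓝 ((0, 0) : ℂ × ℂ), ‖y.2‖ < 1 := by
      have : ContinuousAt (fun y : ℂ × ℂ => ‖y.2‖) (0, 0) := by fun_prop
      exact this (gt_mem_nhds (by simp))
    filter_upwards [P.open_source.mem_nhds hPs, hcont (B.chart.open_source.mem_nhds hsrc0),
      hcont (hO.mem_nhds hxO), h1, h2, hS₁] with y h3 h4 h5 h6 h7 h8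
    exact ⟨h3, h4, h5, h6, h7, h8⟩
  have hG2 : ∀ᶠ q in 𝓝 ((0, t₀) : ℂ × ℂ), q ∈ P.target ∧ q ∈ S₂ ∧ ContDiffAt ℝ 1 P.symm q ∧
      P.symm q ∈ G := by
    have h1 : ∀ᶠ q in 𝓝 ((0, t₀) : ℂ × ℂ), P.symm q ∈ G := by
      have := hPsC.continuousAt
      rw [ContinuousAt, hPsymm0] at this
      exact this.eventually hGn
    filter_upwards [P.open_target.mem_nhds hPt, hS₂, hPsev, h1] with q h1 h2 h3 h4
    exact ⟨h1, h2, h3, h4⟩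
  obtain ⟨r, hr, hrG⟩ := Metric.eventually_nhds_iff_ball.1 hG2
  rw [← ball_prod_same] at hrG
  have hG3 : ∀ᶠ y in 𝓝 ((0, 0) : ℂ × ℂ), y ∈ P.source ∧ affPt M y ∈ B.chart.source ∧
      affPt M y ∈ O ∧ (c y).2 ∈ ball t₀ r := by
    have h1 : ∀ᶠ y in 𝓝 ((0, 0) : ℂ × ℂ), (c y).2 ∈ ball t₀ r := by
      have : ContinuousAt (fun y => (c y).2) (0, 0) := continuousAt_snd.comp hccont
      exact this (isOpen_ball.mem_nhds (by show (c (0, 0)).2 ∈ _; rw [hc0]; exact mem_ball_self hr))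
    filter_upwards [hGn, h1] with y h2 h3
    exact ⟨h2.1, h2.2.1, h2.2.2.1, h3⟩
  obtain ⟨ρ, hρ, hρG⟩ := Metric.eventually_nhds_iff_ball.1 hG3
  rw [← ball_prod_same] at hρG
  set R := min (min r ρ) 1 with hR
  have hRpos : 0 < R := by simp [hR, hr, hρ]
  have hRr : R ≤ r := (min_le_left _ _).trans (min_le_left _ _)
  have hRρ : R ≤ ρ := (min_le_left _ _).trans (min_le_right _ _)
  set T := B.transversal ∩ ball t₀ r with hT
  set f : ℂ → ℂ → ℂ := fun t ζ => (P.symm (ζ, t)).2 with hf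
  have hmain : ∀ t ∈ T, ∀ ζ ∈ ball (0 : ℂ) R, (ζ, t) ∈ P.target ∧ (ζ, t) ∈ S₂ ∧
      ContDiffAt ℝ 1 P.symm (ζ, t) ∧ P.symm (ζ, t) = (ζ, f t ζ) ∧ (ζ, f t ζ) ∈ G ∧
      (c (ζ, f t ζ)).2 = t := by
    intro t ht ζ hζ
    obtain ⟨h1, h2, h3, h4⟩ := hrG (ζ, t) ⟨ball_subset_ball hRr hζ, ht.2⟩
    have h5 : Θ (P.symm (ζ, t)) = (ζ, t) := by rw [← hPc]; exact P.right_inv h1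
    have h6 : P.symm (ζ, t) = (ζ, f t ζ) := by
      refine Prod.ext ?_ rfl
      simpa [hΘ] using congrArg Prod.fst h5
    refine ⟨h1, h2, h3, h6, h6 ▸ h4, ?_⟩
    rw [h6] at h5
    simpa [hΘ] using congrArg Prod.snd h5
  have hplaque : ∀ t ∈ T, ∀ ζ ∈ ball (0 : ℂ) R, ∃ z ∈ ball (0 : ℂ) 1,
      affPt M (ζ, f t ζ) = B.chart.symm (z, t) := by
    intro t ht ζ hζ
    obtain ⟨-, -, -, -, h5, h6⟩ := hmain t ht ζ hζ
    refine ⟨(c (ζ, f t ζ)).1, h5.2.2.2.1, ?_⟩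
    have h7 : c (ζ, f t ζ) = ((c (ζ, f t ζ)).1, t) := Prod.ext rfl h6
    rw [← h7]
    exact (B.chart.left_inv h5.2.1).symm
  refine ⟨⟨j, M, R, ρ, K₂ * K₁, T, f, hRpos, min_le_right _ _, hρ, inter_subset_left,
    ?_, ?_, ?_, ?_, ?_⟩, rfl⟩
  · intro t ht ζ hζ
    refine DifferentiableAt.differentiableWithinAt ?_
    obtain ⟨h1, h2, h3, h4, h5, h6⟩ := hmain t ht ζ hζ
    obtain ⟨z, hz, hzt⟩ := hplaque t ht ζ hζ
    obtain ⟨σ, hσ, hσp⟩ := B.holomorphic t ht.1 z hz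
    obtain ⟨a, b, a', b', ha, hb, ha0, hb0, hab, -, -, habc⟩ :=
      B.exists_affine_param M hz ht.1 hzt hσ hσp
    have hfd : DifferentiableAt ℝ (f t) ζ := by
      have h7 : DifferentiableAt ℝ (fun ζ => P.symm (ζ, t)) ζ :=
        DifferentiableAt.comp (g := P.symm) ζ (h3.differentiableAt one_ne_zero) (by fun_prop)
      exact h7.snd
    -- So far `f t` is only real differentiable. Since b = f_t ∘ a with a and b holomorphic and a' ≠
    -- 0, its real derivative is multiplication by b'/a'.
    obtain ⟨F, hF⟩ : ∃ F : ℂ →L[ℝ] ℂ, HasFDerivAt (f t) F ζ := ⟨_, hfd.hasFDerivAt⟩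
    have heq : b =ᶠ[𝓝 z] f t ∘ a := by
      have hcab : ContinuousAt (fun ζ => (a ζ, b ζ)) z := ha.continuousAt.prodMk hb.continuousAt
      have h8 : ∀ᶠ ζ in 𝓝 z, (a ζ, b ζ) ∈ P.source :=
        hcab (P.open_source.mem_nhds (by show (a z, b z) ∈ _; rw [ha0, hb0]; exact h5.1))
      filter_upwards [hab, h8, isOpen_ball.mem_nhds hz] with w h9 h10 h11
      have h12 : P (a w, b w) = (a w, t) := by
        rw [hPc]
        simp only [hΘ, hc, h9, B.chart_symm_apply h11 ht.1]
      simp only [Function.comp_apply, hf]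
      rw [← h12, P.left_inv h10]
    have hFab : ∀ h : ℂ, F (h * a') = h * b' := by
      intro h
      have hF' : HasFDerivAt (f t) F (a z) := by rw [ha0]; exact hF
      have h9 := (hF'.comp z (ha.hasFDerivAt.restrictScalars ℝ)).congr_of_eventuallyEq heq
      have h10 := congrArg (fun L : ℂ →L[ℝ] ℂ => L h)
        (h9.unique (hb.hasFDerivAt.restrictScalars ℝ))
      simpa using h10
    have hca := (B.contDiffAt_chart_affPt M h5.2.1).differentiableAt one_ne_zero
    have ha' : a' ≠ 0 := by
      rintro rfl
      have hb' : b' = 0 := by simpa using (hFab 1).symm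
      have := habc _ hca.hasFDerivAt 1
      rw [hb', mul_zero, Prod.mk_zero_zero, map_zero] at this
      simpa using congrArg Prod.fst this
    have : HasFDerivAt (𝕜 := ℂ) (f t) (ContinuousLinearMap.toSpanSingleton ℂ (b' / a')) ζ := by
      refine hasFDerivAt_of_restrictScalars ℝ hF ?_
      ext1 h
      have := hFab (h / a')
      rw [div_mul_cancel₀ _ ha'] at this
      simp [this, div_mul_eq_mul_div, mul_div_assoc]
    exact this.differentiableAt
  · intro t ht ζ hζ
    exact (hmain t ht ζ hζ).2.2.2.2.1.2.2.2.2.1.le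
  · intro t ht ζ hζ
    obtain ⟨z, hz, hzt⟩ := hplaque t ht ζ hζ
    exact ⟨z, hz, hzt.symm⟩
  · intro ζ hζ w hw hX
    obtain ⟨h1, h2, h3, h4⟩ := hρG (ζ, w) ⟨ball_subset_ball hRρ hζ, hw⟩
    have h5 : affPt M (ζ, w) ∈ X ∩ O := ⟨hX, h3⟩
    rw [← hOX] at h5
    obtain ⟨⟨z, t⟩, ⟨hz, ht⟩, hzt⟩ := h5
    have h6 : c (ζ, w) = (z, t) := by
      simp only [hc, ← hzt]; exact B.chart_symm_apply hz ht
    rw [h6] at h4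
    refine ⟨t, ⟨ht, h4⟩, ?_⟩
    have h7 : P (ζ, w) = (ζ, t) := by rw [hPc]; simp only [hΘ, h6]
    simp only [hf]
    rw [← h7, P.left_inv h1]
  · intro t ht s hs ζ hζ ζ' hζ'
    obtain ⟨-, a2, -, a4, -, -⟩ := hmain t ht ζ hζ
    obtain ⟨-, b2, -, b4, -, -⟩ := hmain s hs ζ hζ
    obtain ⟨-, -, -, -, a5, a6⟩ := hmain t ht ζ' hζ'
    obtain ⟨-, -, -, -, b5, b6⟩ := hmain s hs ζ' hζ'
    have h1 : ‖f t ζ - f s ζ‖ ≤ K₂ * ‖t - s‖ := by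
      have h := hL₂.dist_le_mul _ a2 _ b2
      rw [a4, b4, Prod.dist_eq, Prod.dist_eq] at h
      simp only [dist_self, dist_eq_norm] at h
      rw [max_eq_right (norm_nonneg _), max_eq_right (norm_nonneg _)] at h
      exact h
    have h2 : ‖t - s‖ ≤ K₁ * ‖f t ζ' - f s ζ'‖ := by
      have h := hL₁.dist_le_mul _ a5.2.2.2.2.2 _ b5.2.2.2.2.2
      rw [Prod.dist_eq (x := (ζ', f t ζ')), Prod.dist_eq] at h
      have h' := (le_max_right _ _).trans h
      change dist (c _).2 (c _).2 ≤ _ at h'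
      rw [a6, b6] at h'
      simp only [dist_self, dist_eq_norm] at h'
      rw [max_eq_right (norm_nonneg _)] at h'
      exact h'
    calc _ ≤ K₂ * ‖t - s‖ := h1
      _ ≤ K₂ * (K₁ * ‖f t ζ' - f s ζ'‖) := mul_le_mul_of_nonneg_left h2 K₂.2
      _ = _ := by ring

end C1Lamination

/-! ### Plaques against graphs, and passage between charts -/

lemma exists_equiv_of_linearIndependent {u v : Fin 3 → ℂ} (h : LinearIndependent ℂ ![u, v]) :
    ∃ M : (Fin 3 → ℂ) ≃L[ℂ] (Fin 3 → ℂ), M ![1, 0, 0] = u ∧ M ![0, 1, 0] = v := by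
  obtain ⟨w, hw⟩ := exists_linearIndependent_snoc_of_lt_finrank h (by simp)
  set b : Fin 3 → (Fin 3 → ℂ) := Fin.snoc ![u, v] w with hb
  let B := basisOfLinearIndependentOfCardEqFinrank (b := b) hw (by simp)
  let M := (B.equivFun.symm).toContinuousLinearEquiv
  have hM : ∀ c : Fin 3 → ℂ, M c = ∑ i, c i • b i := by
    intro c
    have : M c = B.equivFun.symm c := rfl
    rw [this, Module.Basis.equivFun_symm_apply]
    simp [B]
  refine ⟨M, ?_, ?_⟩
  · rw [hM, Fin.sum_univ_three]
    simp [hb]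
  · rw [hM, Fin.sum_univ_three]
    simp [hb]

/-- The target carries no topology, so this serves both for transversal coordinates and for
membership propositions. -/
lemma eq_of_eventually_eq_of_isPreconnected {α β : Type*} [TopologicalSpace α] {s : Set α}
    (hs : IsPreconnected s) {g : α → β} (h : ∀ x ∈ s, ∀ᶠ y in 𝓝[s] x, g y = g x) {x y : α}
    (hx : x ∈ s) (hy : y ∈ s) : g y = g x :=
  hs.induction₂ (fun a b => g b = g a) h (fun _ _ _ _ _ _ h1 h2 => h2.trans h1)
    (fun _ _ _ _ h => h.symm) hx hy

namespace C1FlowBox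

variable {X : Set P2} (B : C1FlowBox X)

lemma plaque_subset_carrier {t : ℂ} (ht : t ∈ B.transversal) : B.plaque t ⊆ B.carrier := by
  rintro _ ⟨z, hz, rfl⟩
  exact ⟨(z, t), ⟨hz, ht⟩, rfl⟩

lemma carrier_subset : B.carrier ⊆ X := by
  obtain ⟨O, -, h⟩ := B.relatively_open
  intro x hx
  have : x ∈ X ∩ O := h ▸ hx
  exact this.1

lemma chart_of_mem_plaque {t : ℂ} (ht : t ∈ B.transversal) {x : P2} (hx : x ∈ B.plaque t) :
    (B.chart x).1 ∈ ball (0 : ℂ) 1 ∧ (B.chart x).2 = t ∧ x ∈ B.chart.source ∧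
      x = B.chart.symm ((B.chart x).1, t) := by
  obtain ⟨z, hz, rfl⟩ := hx
  have := B.chart_symm_apply hz ht
  refine ⟨?_, ?_, ?_, ?_⟩
  · simpa [this] using hz
  · simp [this]
  · exact B.chart.map_target (B.mem_target hz ht)
  · simp [this]

lemma mem_plaque_of_mem_carrier {x : P2} (hx : x ∈ B.carrier) :
    (B.chart x).2 ∈ B.transversal ∧ x ∈ B.plaque (B.chart x).2 := by
  obtain ⟨⟨z, t⟩, ⟨hz, ht⟩, rfl⟩ := hx
  have := B.chart_symm_apply hz ht
  rw [this]
  exact ⟨ht, z, hz, rfl⟩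

lemma eventually_mem_carrier {x : P2} (hx : x ∈ B.carrier) : ∀ᶠ y in 𝓝 x, y ∈ X → y ∈ B.carrier := by
  obtain ⟨O, hO, h⟩ := B.relatively_open
  have hxO : x ∈ X ∩ O := h ▸ hx
  filter_upwards [hO.mem_nhds hxO.2] with y hy hyX
  have : y ∈ X ∩ O := ⟨hyX, hy⟩
  rw [← h] at this
  exact this

end C1FlowBox

namespace GraphChart

variable {X : Set P2} {ι : Type*} {ℒ : C1Lamination X ι} (D : GraphChart ℒ)

/-- The point over `ζ` of the graph with parameter `t`. -/
def pt (t ζ : ℂ) : P2 := affPt D.basis (ζ, D.f t ζ)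

lemma pt_mem {t ζ : ℂ} (ht : t ∈ D.T) (hζ : ζ ∈ ball (0 : ℂ) D.R) : D.pt t ζ ∈ X :=
  (ℒ.box D.idx).carrier_subset
    ((ℒ.box D.idx).plaque_subset_carrier (D.T_subset ht) (D.mem_plaque t ht ζ hζ))

lemma continuousAt_pt {t ζ : ℂ} (ht : t ∈ D.T) (hζ : ζ ∈ ball (0 : ℂ) D.R) :
    ContinuousAt (D.pt t) ζ := by
  have h := ((D.hol t ht).differentiableAt (isOpen_ball.mem_nhds hζ)).continuousAt
  exact ContinuousAt.comp (f := fun ζ => (ζ, D.f t ζ)) (continuous_affPt D.basis).continuousAt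
    (continuousAt_id.prodMk h)

lemma chart_pt {t ζ : ℂ} (ht : t ∈ D.T) (hζ : ζ ∈ ball (0 : ℂ) D.R) :
    ((ℒ.box D.idx).chart (D.pt t ζ)).2 = t :=
  ((ℒ.box D.idx).chart_of_mem_plaque (D.T_subset ht) (D.mem_plaque t ht ζ hζ)).2.1

/-- Transversal coordinates are locally constant along the graphs. -/
lemma eventually_chart_pt_eq {t ζ : ℂ} (ht : t ∈ D.T) (hζ : ζ ∈ ball (0 : ℂ) D.R) (k : ι)
    (hk : D.pt t ζ ∈ (ℒ.box k).carrier) :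
    ∀ᶠ ζ' in 𝓝 ζ, ((ℒ.box k).chart (D.pt t ζ')).2 = ((ℒ.box k).chart (D.pt t ζ)).2 := by
  have hall : ∀ ζ' ∈ ball (0 : ℂ) D.R, _ := fun ζ' hζ' =>
    (ℒ.box D.idx).chart_of_mem_plaque (D.T_subset ht) (D.mem_plaque t ht ζ' hζ')
  obtain ⟨h1, h2, h3, h4⟩ := hall ζ hζ
  have hc := ℒ.compatible D.idx k t (D.T_subset ht) _ h1 (by rw [← h4]; exact hk)
  rw [← h4] at hc
  have hcont : ContinuousAt (fun ζ' => ((ℒ.box D.idx).chart (D.pt t ζ')).1) ζ :=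
    continuousAt_fst.comp (ContinuousAt.comp (f := D.pt t)
      ((ℒ.box D.idx).chart.continuousAt h3) (D.continuousAt_pt ht hζ))
  filter_upwards [hcont.eventually hc, isOpen_ball.mem_nhds hζ] with ζ' h5 h6
  have h7 := (hall ζ' h6).2.2.2
  have h8 : (ℒ.box D.idx).chart.symm (((ℒ.box D.idx).chart (D.pt t ζ')).1, t) = D.pt t ζ' := h7.symm
  rw [h8] at h5
  exact h5

/-- Flow boxes are relatively open in `X`, and the transversal coordinate is locally constant along
the graph; together these keep the graph in the same plaque. -/
lemma eventually_mem_plaque {t ζ : ℂ} (ht : t ∈ D.T) (hζ : ζ ∈ ball (0 : ℂ) D.R) (k : ι)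
    {s : ℂ} (hs : s ∈ (ℒ.box k).transversal) (hk : D.pt t ζ ∈ (ℒ.box k).plaque s) :
    ∀ᶠ ζ' in 𝓝 ζ, D.pt t ζ' ∈ (ℒ.box k).plaque s := by
  have hc := (ℒ.box k).plaque_subset_carrier hs hk
  have h1 := (D.continuousAt_pt ht hζ).eventually ((ℒ.box k).eventually_mem_carrier hc)
  filter_upwards [h1, D.eventually_chart_pt_eq ht hζ k hc, isOpen_ball.mem_nhds hζ] with ζ' h2 h3 h4
  have h5 := ((ℒ.box k).mem_plaque_of_mem_carrier (h2 (D.pt_mem ht h4))).2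
  rwa [h3, ((ℒ.box k).chart_of_mem_plaque hs hk).2.1] at h5

lemma norm_sub_le {t : ℂ} (ht : t ∈ D.T) {s : ℝ} (hs : s < D.R) {a b : ℂ}
    (ha : a ∈ ball (0 : ℂ) s) (hb : b ∈ ball (0 : ℂ) s) :
    ‖D.f t a - D.f t b‖ ≤ 1 / (D.R - s) * ‖a - b‖ :=
  norm_sub_le_of_bounded_holomorphic hs (D.hol t ht) (D.norm_le t ht) ha hb

/-- Near a common point, the graphs of one chart are graphs of any other chart. -/
theorem exists_transfer (D' : GraphChart ℒ) {ζ₀ w₀ ζ₁ w₁ : ℂ} (hζ₀ : ζ₀ ∈ ball (0 : ℂ) D.R)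
    (hζ₁ : ζ₁ ∈ ball (0 : ℂ) D'.R) (hw₁ : w₁ ∈ ball (0 : ℂ) D'.ρ)
    (h : affPt D.basis (ζ₀, w₀) = affPt D'.basis (ζ₁, w₁)) {η : ℝ} (hη : 0 < η) :
    ∃ δ > 0, ∀ t ∈ D.T, ‖D.f t ζ₀ - w₀‖ < δ → ∃ t' ∈ D'.T, ∀ ζ ∈ ball ζ₀ δ,
      ζ ∈ ball (0 : ℂ) D.R ∧ ∃ ζ' ∈ ball (0 : ℂ) D'.R, ζ' ∈ ball ζ₁ η ∧
        D.pt t ζ = D'.pt t' ζ' := by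
  have hV : (ball (0 : ℂ) D'.R ∩ ball ζ₁ η) ×ˢ ball (0 : ℂ) D'.ρ ∈ 𝓝 (ζ₁, w₁) :=
    prod_mem_nhds (inter_mem (isOpen_ball.mem_nhds hζ₁) (ball_mem_nhds _ hη))
      (isOpen_ball.mem_nhds hw₁)
  have hV2 := (continuous_affPt D.basis).continuousAt (x := (ζ₀, w₀))
    (h ▸ affPt_image_mem_nhds D'.basis hV)
  obtain ⟨r, hr, hrV⟩ := Metric.mem_nhds_iff.1 hV2
  rw [← ball_prod_same] at hrV
  have hζ₀' : ‖ζ₀‖ < D.R := by simpa using hζ₀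
  obtain ⟨s, hs0, hsR⟩ := exists_between hζ₀'
  set K := 1 / (D.R - s) with hK
  have hKpos : 0 < K := by rw [hK]; exact one_div_pos.2 (by linarith)
  -- The height differs from w₀ by at most Kδ + δ, so these bounds keep the piece of graph inside
  -- the bidisc of radius r, and the last one keeps it over the ball of radius s.
  set δ := min (min (r / 2) (r / (2 * K))) (s - ‖ζ₀‖) with hδ
  have hδ1 : δ ≤ r / 2 := (min_le_left _ _).trans (min_le_left _ _)
  have hδ2 : δ ≤ r / (2 * K) := (min_le_left _ _).trans (min_le_right _ _)
  have hδ3 : δ ≤ s - ‖ζ₀‖ := min_le_right _ _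
  have hδpos : 0 < δ := by
    simp only [hδ, lt_min_iff]
    refine ⟨⟨by positivity, by positivity⟩, by linarith⟩
  refine ⟨δ, hδpos, fun t ht htw => ?_⟩
  have hsub : ∀ ζ ∈ ball ζ₀ δ, ζ ∈ ball (0 : ℂ) s := by
    intro ζ hζ
    have h1 : ‖ζ - ζ₀‖ < δ := by simpa [dist_eq_norm] using hζ
    have h2 := norm_add_le (ζ - ζ₀) ζ₀
    rw [sub_add_cancel] at h2
    simpa using (by linarith : ‖ζ‖ < s)
  have hsubR : ball (0 : ℂ) s ⊆ ball 0 D.R := ball_subset_ball hsR.le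
  have hloc : ∀ ζ ∈ ball ζ₀ δ, ∃ t' ∈ D'.T, ∃ ζ' ∈ ball (0 : ℂ) D'.R, ζ' ∈ ball ζ₁ η ∧
      D.pt t ζ = D'.pt t' ζ' := by
    intro ζ hζ
    have h1 : ‖ζ - ζ₀‖ < δ := by simpa [dist_eq_norm] using hζ
    have h2 := D.norm_sub_le ht hsR (hsub ζ hζ) (a := ζ) (b := ζ₀) (by simpa using hs0)
    have h3 : K * ‖ζ - ζ₀‖ ≤ r / 2 := by
      have := mul_le_mul_of_nonneg_left (h1.le.trans hδ2) hKpos.le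
      refine this.trans (le_of_eq ?_)
      field_simp
    have h4 : ‖D.f t ζ - w₀‖ < r := by
      have := norm_add_le (D.f t ζ - D.f t ζ₀) (D.f t ζ₀ - w₀)
      rw [sub_add_sub_cancel] at this
      linarith
    have h5 : (ζ, D.f t ζ) ∈ ball ζ₀ r ×ˢ ball w₀ r := by
      refine ⟨?_, ?_⟩
      · simpa [dist_eq_norm] using (by linarith : ‖ζ - ζ₀‖ < r)
      · simpa [dist_eq_norm] using h4
    obtain ⟨⟨ζ', w'⟩, ⟨⟨h6, h7⟩, h8⟩, h9⟩ := hrV h5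
    have hX : affPt D'.basis (ζ', w') ∈ X := by
      rw [h9]; exact D.pt_mem ht (hsubR (hsub ζ hζ))
    obtain ⟨t', ht', hf⟩ := D'.cover ζ' h6 w' h8 hX
    refine ⟨t', ht', ζ', h6, h7, ?_⟩
    simp only [pt, hf]
    exact h9.symm
  have hmem0 : ζ₀ ∈ ball ζ₀ δ := mem_ball_self hδpos
  -- Each point lies on some graph of `D'`, a priori depending on the point. Its parameter is the
  -- transversal coordinate of the box of `D'`, which is constant on the connected disc, so one
  -- graph suffices.
  have hconst : ∀ ζ ∈ ball ζ₀ δ, ((ℒ.box D'.idx).chart (D.pt t ζ)).2 =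
      ((ℒ.box D'.idx).chart (D.pt t ζ₀)).2 := by
    intro ζ hζ
    refine eq_of_eventually_eq_of_isPreconnected (convex_ball ζ₀ δ).isPreconnected
      (g := fun ζ => ((ℒ.box D'.idx).chart (D.pt t ζ)).2) (fun a ha => ?_) hmem0 hζ
    obtain ⟨t', ht', ζ', h1, -, h3⟩ := hloc a ha
    refine (D.eventually_chart_pt_eq ht (hsubR (hsub a ha)) D'.idx ?_).filter_mono
      nhdsWithin_le_nhds
    rw [h3]
    exact (ℒ.box D'.idx).plaque_subset_carrier (D'.T_subset ht') (D'.mem_plaque t' ht' ζ' h1)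
  obtain ⟨t', ht', ζ', h1, -, h3⟩ := hloc ζ₀ hmem0
  refine ⟨t', ht', fun ζ hζ => ⟨hsubR (hsub ζ hζ), ?_⟩⟩
  obtain ⟨t'', ht'', ζ'', h4, h5, h6⟩ := hloc ζ hζ
  have h7 := hconst ζ hζ
  rw [h6, h3, D'.chart_pt ht'' h4, D'.chart_pt ht' h1] at h7
  subst h7
  exact ⟨ζ'', h4, h5, h6⟩

/-- Near the centre of a chart, every plaque of every flow box is contained in one graph. -/
theorem exists_nhds_plaque_subset {x : P2} (hx : x ∈ X)
    (hxD : affPt D.basis (0, 0) = x) (i : ι) {η : ℝ} (hη : 0 < η) :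
    ∃ W ∈ 𝓝 x, ∀ s ∈ (ℒ.box i).transversal, ∃ t ∈ D.T, ∀ q ∈ (ℒ.box i).plaque s ∩ W,
      ∃ ζ ∈ ball (0 : ℂ) D.R, ζ ∈ ball (0 : ℂ) η ∧ q = D.pt t ζ := by
  obtain ⟨t₁, ht₁, -⟩ := D.cover 0 (by simpa using D.R_pos) 0 (by simpa using D.ρ_pos)
    (by rw [hxD]; exact hx)
  set B := ℒ.box i
  -- The point need not lie in the box, but plaques may accumulate at it. This is where the
  -- extension of the chart past the closure of the box is needed.
  by_cases hcl : x ∈ closure B.carrier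
  · have hsrc : x ∈ B.chart.source := B.closure_subset_source hcl
    have hV : (ball (0 : ℂ) D.R ∩ ball 0 η) ×ˢ ball (0 : ℂ) D.ρ ∈ 𝓝 ((0 : ℂ), (0 : ℂ)) :=
      prod_mem_nhds (inter_mem (ball_mem_nhds _ D.R_pos) (ball_mem_nhds _ hη))
        (ball_mem_nhds _ D.ρ_pos)
    have hV2 := affPt_image_mem_nhds D.basis hV
    rw [hxD] at hV2
    have hcont := B.chart.continuousAt_symm (B.chart.map_source hsrc)
    rw [ContinuousAt, B.chart.left_inv hsrc] at hcont
    have hV3 := inter_mem (mem_map.1 (hcont hV2)) (B.chart.open_target.mem_nhds (B.chart.map_source hsrc))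
    obtain ⟨r, hr, hrV⟩ := Metric.mem_nhds_iff.1 hV3
    set z₀ := (B.chart x).1
    set s₀ := (B.chart x).2
    have hball : ball (B.chart x) r = ball z₀ r ×ˢ ball s₀ r := (ball_prod_same _ _ _).symm
    rw [hball] at hrV
    refine ⟨B.chart.source ∩ B.chart ⁻¹' (ball z₀ r ×ˢ ball s₀ r), ?_, fun s hs => ?_⟩
    · refine inter_mem (B.chart.open_source.mem_nhds hsrc) (B.chart.continuousAt hsrc ?_)
      rw [← hball]
      exact ball_mem_nhds _ hr
    by_cases hne : (B.plaque s ∩ (B.chart.source ∩ B.chart ⁻¹' (ball z₀ r ×ˢ ball s₀ r))).Nonempty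
    swap
    · exact ⟨t₁, ht₁, fun q hq => (hne ⟨q, hq⟩).elim⟩
    have hrep : ∀ q ∈ B.plaque s ∩ (B.chart.source ∩ B.chart ⁻¹' (ball z₀ r ×ˢ ball s₀ r)),
        ∃ z ∈ ball (0 : ℂ) 1 ∩ ball z₀ r, s ∈ ball s₀ r ∧ q = B.chart.symm (z, s) := by
      rintro q ⟨hq1, -, hq2⟩
      obtain ⟨h1, h2, h3, h4⟩ := B.chart_of_mem_plaque hs hq1
      exact ⟨_, ⟨h1, hq2.1⟩, h2 ▸ hq2.2, h4⟩
    obtain ⟨q₀, hq₀⟩ := hne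
    obtain ⟨z₁, hz₁, hs₀, -⟩ := hrep q₀ hq₀
    have hloc : ∀ z ∈ ball (0 : ℂ) 1 ∩ ball z₀ r, ∃ t ∈ D.T, ∃ ζ ∈ ball (0 : ℂ) D.R,
        ζ ∈ ball (0 : ℂ) η ∧ B.chart.symm (z, s) = D.pt t ζ := by
      intro z hz
      obtain ⟨⟨ζ, w⟩, ⟨⟨h1, h2⟩, h3⟩, h4⟩ := (hrV (show (z, s) ∈ _ from ⟨hz.2, hs₀⟩)).1
      have : affPt D.basis (ζ, w) ∈ X := by
        rw [h4]
        exact B.carrier_subset ⟨(z, s), ⟨hz.1, hs⟩, rfl⟩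
      obtain ⟨t, ht, hf⟩ := D.cover ζ h1 w h3 this
      refine ⟨t, ht, ζ, h1, h2, ?_⟩
      simp only [pt, hf]
      exact h4.symm
    -- The intersection of two discs is convex, so the part of the plaque in the neighbourhood is
    -- connected and lies on a single graph.
    have hconst : ∀ z ∈ ball (0 : ℂ) 1 ∩ ball z₀ r,
        ((ℒ.box D.idx).chart (B.chart.symm (z, s))).2 =
          ((ℒ.box D.idx).chart (B.chart.symm (z₁, s))).2 := by
      intro z hz
      refine eq_of_eventually_eq_of_isPreconnected
        ((convex_ball (0 : ℂ) 1).inter (convex_ball z₀ r)).isPreconnected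
        (g := fun z => ((ℒ.box D.idx).chart (B.chart.symm (z, s))).2) (fun a ha => ?_) hz₁ hz
      obtain ⟨t, ht, ζ, h1, -, h3⟩ := hloc a ha
      refine (ℒ.compatible i D.idx s hs a ha.1 ?_).filter_mono nhdsWithin_le_nhds
      rw [show (ℒ.box i).chart.symm (a, s) = D.pt t ζ from h3]
      exact (ℒ.box D.idx).plaque_subset_carrier (D.T_subset ht) (D.mem_plaque t ht ζ h1)
    obtain ⟨t, ht, ζ, h1, -, h3⟩ := hloc z₁ hz₁
    refine ⟨t, ht, fun q hq => ?_⟩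
    obtain ⟨z, hz, -, rfl⟩ := hrep q hq
    obtain ⟨t', ht', ζ', h1', h2', h3'⟩ := hloc z hz
    have h7 := hconst z hz
    rw [h3, h3', D.chart_pt ht h1, D.chart_pt ht' h1'] at h7
    subst h7
    exact ⟨ζ', h1', h2', h3'⟩
  · refine ⟨(closure B.carrier)ᶜ, isClosed_closure.isOpen_compl.mem_nhds hcl, fun s hs =>
      ⟨t₁, ht₁, fun q hq => ?_⟩⟩
    exact (hq.2 (subset_closure (B.plaque_subset_carrier hs hq.1))).elim

/-- A linear form vanishing on a piece of a graph vanishes on the tangent vectors of every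
parametrization of the plaque. -/
lemma linear_deriv_eq_zero {t ζ : ℂ} (ht : t ∈ D.T) (hζ : ζ ∈ ball (0 : ℂ) D.R)
    (l : (Fin 3 → ℂ) →L[ℂ] ℂ) (hl : ∀ᶠ ζ' in 𝓝 ζ, l (D.basis ![1, ζ', D.f t ζ']) = 0)
    {j : ι} {z₀ t₀ : ℂ} (hz₀ : z₀ ∈ ball (0 : ℂ) 1) (ht₀ : t₀ ∈ (ℒ.box j).transversal)
    {γ : ℂ → (Fin 3 → ℂ)} (hγ : AnalyticAt ℂ γ z₀)
    (hγp : ∀ᶠ ζ in 𝓝 z₀, γ ζ ≠ 0 ∧ P2.proj (γ ζ) = (ℒ.box j).chart.symm (ζ, t₀))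
    (hpt : D.pt t ζ = (ℒ.box j).chart.symm (z₀, t₀)) : l (deriv γ z₀) = 0 := by
  set B := ℒ.box j
  have hx : D.pt t ζ ∈ B.plaque t₀ := by rw [hpt]; exact ⟨z₀, hz₀, rfl⟩
  have hev := D.eventually_mem_plaque ht hζ j ht₀ hx
  set z : ℂ → ℂ := fun ζ' => (B.chart (D.pt t ζ')).1
  have hzζ : z ζ = z₀ := by simp only [z, hpt, B.chart_symm_apply hz₀ ht₀]
  have hzc : ContinuousAt z ζ := continuousAt_fst.comp
    (ContinuousAt.comp (f := D.pt t)
      (B.chart.continuousAt (B.chart_of_mem_plaque ht₀ hx).2.2.1) (D.continuousAt_pt ht hζ))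
  have hzt : Tendsto z (𝓝[≠] ζ) (𝓝[≠] z₀) := by
    refine tendsto_nhdsWithin_iff.2 ⟨?_, ?_⟩
    · rw [← hzζ]; exact hzc.tendsto.mono_left nhdsWithin_le_nhds
    · filter_upwards [hev.filter_mono nhdsWithin_le_nhds, self_mem_nhdsWithin] with ζ' h1 h2 h3
      have h4 := (B.chart_of_mem_plaque ht₀ h1).2.2.2
      rw [show (B.chart (D.pt t ζ')).1 = z₀ from h3, ← hpt] at h4
      exact h2 (congrArg Prod.fst (affPt_injective D.basis h4))
  have hzero : ∀ᶠ ζ' in 𝓝 ζ, l (γ (z ζ')) = 0 := by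
    rw [← hzζ] at hγp
    filter_upwards [hev, hl, hzc.eventually hγp] with ζ' h1 h2 h3
    have h4 := (B.chart_of_mem_plaque ht₀ h1).2.2.2
    have h5 : P2.proj (γ (z ζ')) = P2.proj (D.basis ![1, ζ', D.f t ζ']) := h3.2.trans h4.symm
    obtain ⟨c, -, hc⟩ := (P2.proj_eq_proj_iff h3.1 (affVec_ne_zero D.basis (ζ', D.f t ζ'))).1 h5
    rw [hc, map_smul, h2, smul_zero]
  have hfr : ∃ᶠ w in 𝓝[≠] z₀, l (γ w) = 0 :=
    hzt.frequently (hzero.filter_mono nhdsWithin_le_nhds).frequently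
  have han : AnalyticAt ℂ (fun w => l (γ w)) z₀ := (l.analyticAt _).comp hγ
  have h0 := han.frequently_zero_iff_eventually_zero.1 hfr
  have h1 : HasDerivAt (fun w => l (γ w)) (l (deriv γ z₀)) z₀ :=
    l.hasFDerivAt.comp_hasDerivAt z₀ hγ.differentiableAt.hasDerivAt
  have h2 : HasDerivAt (fun _ : ℂ => (0 : ℂ)) (l (deriv γ z₀)) z₀ :=
    h1.congr_of_eventuallyEq (EventuallyEq.symm h0)
  exact h2.unique (hasDerivAt_const _ _)

end GraphChart

namespace C1Lamination

variable {X : Set P2} {ι : Type*} (ℒ : C1Lamination X ι)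

/-- If γ' were a multiple of γ, both affine velocities would vanish, whereas the derivative of the
flow box chart sends the velocity to (1, 0). -/
lemma exists_param {x : P2} (hx : x ∈ X) : ∃ (j : ι) (z₀ t₀ : ℂ) (γ : ℂ → (Fin 3 → ℂ)),
    z₀ ∈ ball (0 : ℂ) 1 ∧ t₀ ∈ (ℒ.box j).transversal ∧ AnalyticAt ℂ γ z₀ ∧
    (∀ᶠ ζ in 𝓝 z₀, γ ζ ≠ 0 ∧ P2.proj (γ ζ) = (ℒ.box j).chart.symm (ζ, t₀)) ∧
    (ℒ.box j).chart.symm (z₀, t₀) = x ∧ LinearIndependent ℂ ![γ z₀, deriv γ z₀] := by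
  obtain ⟨j, hj⟩ := mem_iUnion.1 (ℒ.covers hx)
  obtain ⟨⟨z₀, t₀⟩, ⟨hz₀, ht₀⟩, hzt⟩ := hj
  obtain ⟨γ, hγ, hγp⟩ := (ℒ.box j).holomorphic t₀ ht₀ z₀ hz₀
  have hγ0 := hγp.self_of_nhds.1
  refine ⟨j, z₀, t₀, γ, hz₀, ht₀, hγ, hγp, hzt, ?_⟩
  rw [LinearIndependent.pair_iff' hγ0]
  intro c hc
  obtain ⟨u, hu⟩ := exists_linearIndependent_snoc_of_lt_finrank (R := ℂ)
    (LinearIndependent.of_subsingleton (v := ![γ z₀]) 0 hγ0) (by simp)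
  have hu' : LinearIndependent ℂ ![γ z₀, u] := by
    have e : (Fin.snoc ![γ z₀] u : Fin 2 → (Fin 3 → ℂ)) = ![γ z₀, u] := by
      ext i : 1; fin_cases i <;> rfl
    exact e ▸ hu
  obtain ⟨M, hM, -⟩ := exists_equiv_of_linearIndependent hu'
  have hM0 : affPt M (0, 0) = (ℒ.box j).chart.symm (z₀, t₀) := by
    rw [affPt, hM]; exact hγp.self_of_nhds.2
  have hMγ : M.symm (γ z₀) = ![1, 0, 0] := by rw [← hM, M.symm_apply_apply]
  obtain ⟨a, b, a', b', ha, hb, ha0, hb0, hab, ha1, hb1, habc⟩ :=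
    (ℒ.box j).exists_affine_param M hz₀ ht₀ hM0 hγ hγp
  rw [← hc, map_smul, hMγ] at ha1 hb1
  simp only [Pi.smul_apply, smul_eq_mul] at ha1 hb1
  have ha' : a' = 0 := by simpa using ha1
  have hb' : b' = 0 := by simpa using hb1
  have hsrc : affPt M (0, 0) ∈ (ℒ.box j).chart.source := by
    rw [hM0]; exact (ℒ.box j).chart.map_target ((ℒ.box j).mem_target hz₀ ht₀)
  have := habc _ (((ℒ.box j).contDiffAt_chart_affPt M hsrc).differentiableAt
    one_ne_zero).hasFDerivAt 1
  rw [ha', hb', mul_zero, Prod.mk_zero_zero, map_zero] at this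
  simpa using congrArg Prod.fst this

/-- With γ and γ' as first two basis vectors the plaque through the origin is horizontal, hence
transverse to the vertical direction. -/
theorem exists_graphChart {x : P2} (hx : x ∈ X) :
    ∃ D : GraphChart ℒ, affPt D.basis (0, 0) = x := by
  obtain ⟨j, z₀, t₀, γ, hz₀, ht₀, hγ, hγp, hzt, hli⟩ := ℒ.exists_param hx
  obtain ⟨M, hM, hM'⟩ := exists_equiv_of_linearIndependent hli
  have hM0 : affPt M (0, 0) = (ℒ.box j).chart.symm (z₀, t₀) := by
    rw [affPt, hM]; exact hγp.self_of_nhds.2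
  have hMγ : M.symm (deriv γ z₀) = ![0, 1, 0] := by rw [← hM', M.symm_apply_apply]
  obtain ⟨D, rfl⟩ := ℒ.exists_graphChart_of_box j hz₀ ht₀ hγ hγp M hM0 (by rw [hMγ]; simp)
  exact ⟨D, hM0.trans hzt⟩

end C1Lamination

/-- A locally uniform limit of holomorphic functions is a uniform strict derivative. -/
lemma isLittleO_sub_sub_deriv_of_tendstoLocallyUniformlyOn {I : Type*} {l : Filter I}
    {F : I → ℂ → ℂ} {g : ℂ → ℂ} {U : Set ℂ} (hU : IsOpen U)
    (h : TendstoLocallyUniformlyOn F g l U) (hF : ∀ᶠ i in l, DifferentiableOn ℂ (F i) U)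
    {ζ : ℂ} (hζ : ζ ∈ U) {a b : I → ℂ} (ha : Tendsto a l (𝓝 ζ)) (hb : Tendsto b l (𝓝 ζ)) :
    (fun i => F i (a i) - F i (b i) - deriv g ζ * (a i - b i)) =o[l] fun i => a i - b i := by
  rcases l.eq_or_neBot with rfl | hne
  · simp
  have hg : DifferentiableOn ℂ g U := h.differentiableOn hF hU
  have hd := h.deriv hF hU
  have hgc : ContinuousAt (deriv g) ζ := ((hg.deriv hU).continuousOn).continuousAt (hU.mem_nhds hζ)
  refine isLittleO_iff.2 fun c hc => ?_
  obtain ⟨t, ht, hti⟩ := Metric.tendstoLocallyUniformlyOn_iff.1 hd (c / 2) (by positivity) ζ hζ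
  rw [hU.nhdsWithin_eq hζ] at ht
  have h1 : ∀ᶠ y in 𝓝 ζ, dist (deriv g y) (deriv g ζ) < c / 2 :=
    hgc.eventually (ball_mem_nhds _ (by positivity))
  obtain ⟨r, hr, hrt⟩ := Metric.mem_nhds_iff.1 (inter_mem (inter_mem ht (hU.mem_nhds hζ)) h1)
  filter_upwards [hti, hF, ha (ball_mem_nhds _ hr), hb (ball_mem_nhds _ hr)] with i h2 h3 h4 h5
  have hdiff : ∀ y ∈ ball ζ r, HasDerivWithinAt (fun z => F i z - deriv g ζ * z)
      (deriv (F i) y - deriv g ζ) (ball ζ r) y := by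
    intro y hy
    have h6 := (h3.differentiableAt (hU.mem_nhds (hrt hy).1.2)).hasDerivAt
    have h7 := h6.sub ((hasDerivAt_id y).const_mul (deriv g ζ))
    simp only [mul_one] at h7
    exact h7.hasDerivWithinAt
  have hbd : ∀ y ∈ ball ζ r, ‖deriv (F i) y - deriv g ζ‖ ≤ c := by
    intro y hy
    have h6 := h2 y (hrt hy).1.1
    have h7 : dist (deriv g y) (deriv g ζ) < c / 2 := (hrt hy).2
    have h8 := dist_triangle (deriv (F i) y) (deriv g y) (deriv g ζ)
    rw [dist_comm (deriv (F i) y) (deriv g y)] at h8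
    have h9 : dist (deriv g y) (deriv (F i) y) < c / 2 := h6
    rw [← dist_eq_norm]
    linarith
  have := (convex_ball ζ r).norm_image_sub_le_of_norm_hasDerivWithin_le hdiff hbd h5 h4
  rw [show F i (a i) - F i (b i) - deriv g ζ * (a i - b i) =
    (F i (a i) - deriv g ζ * a i) - (F i (b i) - deriv g ζ * b i) by ring]
  exact this

/-! ### The gap function and its first order expansion -/

/-- The vector field `z ∂/∂w` generating the shears, as a linear map. -/
def shearField : (Fin 3 → ℂ) →L[ℂ] (Fin 3 → ℂ) :=
  LinearMap.toContinuousLinearMap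
    { toFun := fun v => ![0, v 0, 0]
      map_add' := fun u v => by ext i; fin_cases i <;> simp
      map_smul' := fun c v => by ext i; fin_cases i <;> simp }

@[simp] lemma shearField_apply (v : Fin 3 → ℂ) : shearField v = ![0, v 0, 0] := rfl

/-- The vertical distance of the point with homogeneous coordinates `p` to the graph of `g`. -/
def defect (g : ℂ → ℂ) (p : Fin 3 → ℂ) : ℂ := p 2 / p 0 - g (p 1 / p 0)

lemma defect_smul (g : ℂ → ℂ) (p : Fin 3 → ℂ) {c : ℂ} (hc : c ≠ 0) :
    defect g (c • p) = defect g p := by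
  simp [defect, mul_div_mul_left _ _ hc]

namespace GraphChart

variable {X : Set P2} {ι : Type*} {ℒ : C1Lamination X ι} (D : GraphChart ℒ)

def vec (t ζ : ℂ) : Fin 3 → ℂ := ![1, ζ, D.f t ζ]

@[simp] lemma vec_zero (t ζ : ℂ) : D.vec t ζ 0 = 1 := rfl
@[simp] lemma vec_one (t ζ : ℂ) : D.vec t ζ 1 = ζ := rfl
@[simp] lemma vec_two (t ζ : ℂ) : D.vec t ζ 2 = D.f t ζ := rfl

/-- The field `shearField` in the coordinates of the chart. -/
def field : (Fin 3 → ℂ) →L[ℂ] (Fin 3 → ℂ) :=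
  D.basis.symm.toContinuousLinearMap.comp (shearField.comp D.basis.toContinuousLinearMap)

lemma basis_field (v : Fin 3 → ℂ) : D.basis (D.field v) = shearField (D.basis v) := by
  simp only [field, ContinuousLinearMap.comp_apply, ContinuousLinearEquiv.coe_coe,
    ContinuousLinearEquiv.apply_symm_apply]

/-- The inverse shear in the coordinates of the chart. -/
def step (ε : ℂ) : (Fin 3 → ℂ) →L[ℂ] (Fin 3 → ℂ) := ContinuousLinearMap.id ℂ _ - ε • D.field

lemma step_apply (ε : ℂ) (v : Fin 3 → ℂ) (i : Fin 3) :
    D.step ε v i = v i - ε * D.field v i := rfl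

/-- The function of `ζ` whose zeros are the intersection points of the graph `t₁` with the image
under `N⁻¹` of the graph `t₂`. -/
def gap (N : (Fin 3 → ℂ) →L[ℂ] (Fin 3 → ℂ)) (t₁ t₂ ζ : ℂ) : ℂ := defect (D.f t₂) (N (D.vec t₁ ζ))

/-- The component of the field normal to the graph. -/
def normal (t ζ : ℂ) : ℂ :=
  D.field (D.vec t ζ) 2 - D.field (D.vec t ζ) 0 * D.f t ζ -
    deriv (D.f t) ζ * (D.field (D.vec t ζ) 1 - ζ * D.field (D.vec t ζ) 0)

lemma continuous_field_apply (i : Fin 3) : Continuous fun v => D.field v i :=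
  (continuous_apply i).comp D.field.continuous

lemma norm_vec_le {t ζ : ℂ} (ht : t ∈ D.T) (hζ : ζ ∈ ball (0 : ℂ) D.R) : ‖D.vec t ζ‖ ≤ 1 := by
  rw [pi_norm_le_iff_of_nonneg zero_le_one]
  have h1 : ‖ζ‖ < D.R := by simpa using hζ
  intro i
  fin_cases i
  · simp
  · simpa using h1.le.trans D.R_le
  · simpa using D.norm_le t ht ζ hζ

lemma tendsto_vec {I : Type*} {l : Filter I} {t₁ : I → ℂ} {t ζ : ℂ} {z : I → ℂ}
    (hz : Tendsto z l (𝓝 ζ)) (hf : Tendsto (fun i => D.f (t₁ i) (z i)) l (𝓝 (D.f t ζ))) :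
    Tendsto (fun i => D.vec (t₁ i) (z i)) l (𝓝 (D.vec t ζ)) := by
  refine tendsto_pi_nhds.2 fun i => ?_
  fin_cases i
  · exact tendsto_const_nhds
  · exact hz
  · exact hf

/-- By `comp`, closeness of heights over one point, even a moving one, gives uniform closeness over
the disc. -/
lemma tendstoLocallyUniformlyOn_f {I : Type*} {l : Filter I} {t₁ : I → ℂ} {t ζ : ℂ}
    (ht₁ : ∀ᶠ i in l, t₁ i ∈ D.T) (ht : t ∈ D.T) {z : I → ℂ} (hζ : ζ ∈ ball (0 : ℂ) D.R)
    (hz : Tendsto z l (𝓝 ζ)) (h : Tendsto (fun i => D.f (t₁ i) (z i)) l (𝓝 (D.f t ζ))) :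
    TendstoLocallyUniformlyOn (fun i => D.f (t₁ i)) (D.f t) l (ball 0 D.R) := by
  refine TendstoUniformlyOn.tendstoLocallyUniformlyOn ?_
  rw [Metric.tendstoUniformlyOn_iff]
  intro ε hε
  have h1 : Tendsto (fun i => D.C * ‖D.f t (z i) - D.f (t₁ i) (z i)‖) l (𝓝 (D.C * ‖(0 : ℂ)‖)) := by
    have hc : Tendsto (fun i => D.f t (z i)) l (𝓝 (D.f t ζ)) :=
      ((D.hol t ht).differentiableAt (isOpen_ball.mem_nhds hζ)).continuousAt.tendsto.comp hz
    have := ((hc.sub h).norm).const_mul D.C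
    rwa [sub_self] at this
  rw [norm_zero, mul_zero] at h1
  filter_upwards [h1.eventually (gt_mem_nhds hε), ht₁, hz (isOpen_ball.mem_nhds hζ)] with
    i h2 h3 h4 w hw
  rw [dist_eq_norm]
  exact (D.comp t ht _ h3 w hw _ h4).trans_lt h2

lemma tendsto_f {I : Type*} {l : Filter I} {t₁ : I → ℂ} {t ζ : ℂ} {z : I → ℂ}
    (h : TendstoLocallyUniformlyOn (fun i => D.f (t₁ i)) (D.f t) l (ball 0 D.R)) (ht : t ∈ D.T)
    (hζ : ζ ∈ ball (0 : ℂ) D.R) (hz : Tendsto z l (𝓝 ζ)) :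
    Tendsto (fun i => D.f (t₁ i) (z i)) l (𝓝 (D.f t ζ)) := by
  refine h.tendsto_comp ((D.hol t ht).continuousOn ζ hζ) hζ ?_
  exact tendsto_nhdsWithin_iff.2 ⟨hz, hz (isOpen_ball.mem_nhds hζ)⟩

/-- First order expansion of the gap function. -/
lemma tendsto_gap_div {I : Type*} {l : Filter I} {t₁ t₂ : I → ℂ} {t : ℂ} {ε δ : I → ℂ}
    {G : ℂ → ℂ} {e ζ : ℂ} {z : I → ℂ}
    (ht₂ : ∀ᶠ i in l, t₂ i ∈ D.T) (ht : t ∈ D.T)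
    (h₁ : TendstoLocallyUniformlyOn (fun i => D.f (t₁ i)) (D.f t) l (ball 0 D.R))
    (h₂ : TendstoLocallyUniformlyOn (fun i => D.f (t₂ i)) (D.f t) l (ball 0 D.R))
    (hε : Tendsto ε l (𝓝 0)) (he : Tendsto (fun i => ε i / δ i) l (𝓝 e))
    (hδ : ∀ᶠ i in l, δ i ≠ 0)
    (hG : TendstoLocallyUniformlyOn (fun i ζ => (D.f (t₁ i) ζ - D.f (t₂ i) ζ) / δ i) G l
      (ball 0 D.R)) (hGd : DifferentiableOn ℂ G (ball 0 D.R))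
    (hζ : ζ ∈ ball (0 : ℂ) D.R) (hz : Tendsto z l (𝓝 ζ)) :
    Tendsto (fun i => D.gap (D.step (ε i)) (t₁ i) (t₂ i) (z i) / δ i) l
      (𝓝 (G ζ - e * D.normal t ζ)) := by
  have hv := D.tendsto_vec hz (D.tendsto_f h₁ ht hζ hz)
  have hE : ∀ k, Tendsto (fun i => D.field (D.vec (t₁ i) (z i)) k) l (𝓝 (D.field (D.vec t ζ) k)) :=
    fun k => (D.continuous_field_apply k).continuousAt.tendsto.comp hv
  set α : I → ℂ := fun i => 1 - ε i * D.field (D.vec (t₁ i) (z i)) 0 with hα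
  have hα1 : Tendsto α l (𝓝 1) := by
    have := (tendsto_const_nhds (x := (1 : ℂ))).sub (hε.mul (hE 0))
    simpa using this
  have hα0 : ∀ᶠ i in l, α i ≠ 0 := hα1.eventually_ne one_ne_zero
  have hf1 := D.tendsto_f h₁ ht hζ hz
  set a : I → ℂ := fun i => D.step (ε i) (D.vec (t₁ i) (z i)) 1 / D.step (ε i) (D.vec (t₁ i) (z i)) 0
  have hp0 : ∀ i, D.step (ε i) (D.vec (t₁ i) (z i)) 0 = α i := fun i => by simp [step_apply, hα]
  have hax : ∀ᶠ i in l, a i - z i =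
      -(ε i * (D.field (D.vec (t₁ i) (z i)) 1 - z i * D.field (D.vec (t₁ i) (z i)) 0) / α i) := by
    filter_upwards [hα0] with i hi
    simp only [a, hp0]
    rw [step_apply, vec_one]
    field_simp
    simp only [hα]
    ring
  have hay : ∀ᶠ i in l, D.step (ε i) (D.vec (t₁ i) (z i)) 2 / α i - D.f (t₁ i) (z i) =
      -(ε i * (D.field (D.vec (t₁ i) (z i)) 2 -
        D.field (D.vec (t₁ i) (z i)) 0 * D.f (t₁ i) (z i)) / α i) := by
    filter_upwards [hα0] with i hi
    rw [step_apply, vec_two]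
    field_simp
    simp only [hα]
    ring
  have hαinv : Tendsto (fun i => (α i)⁻¹) l (𝓝 1) := by
    simpa using hα1.inv₀ one_ne_zero
  have hda : Tendsto (fun i => (a i - z i) / δ i) l
      (𝓝 (-(e * (D.field (D.vec t ζ) 1 - ζ * D.field (D.vec t ζ) 0)))) := by
    have := ((he.mul ((hE 1).sub (hz.mul (hE 0)))).mul hαinv).neg
    rw [mul_one] at this
    refine this.congr' ?_
    filter_upwards [hax] with i hi
    rw [hi]; ring
  have hdy : Tendsto (fun i => (D.step (ε i) (D.vec (t₁ i) (z i)) 2 / α i -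
      D.f (t₁ i) (z i)) / δ i) l
      (𝓝 (-(e * (D.field (D.vec t ζ) 2 - D.field (D.vec t ζ) 0 * D.f t ζ)))) := by
    have := ((he.mul ((hE 2).sub ((hE 0).mul hf1))).mul hαinv).neg
    rw [mul_one] at this
    refine this.congr' ?_
    filter_upwards [hay] with i hi
    rw [hi]; ring
  have haz : Tendsto a l (𝓝 ζ) := by
    have h3 : Tendsto (fun i => a i - z i) l (𝓝 0) := by
      have := ((hε.mul ((hE 1).sub (hz.mul (hE 0)))).mul hαinv).neg
      rw [zero_mul, zero_mul, neg_zero] at this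
      refine this.congr' ?_
      filter_upwards [hax] with i hi
      rw [hi]; ring
    have := h3.add hz
    simpa using this
  -- The shear moves the base point from z to a with a − z = O(δ). The strict derivative replaces
  -- f_{t₂}(a) − f_{t₂}(z) by f_t'(ζ)(a − z) up to o(δ), producing the derivative term of `normal`.
  have hlo := isLittleO_sub_sub_deriv_of_tendstoLocallyUniformlyOn isOpen_ball h₂
    (ht₂.mono fun i hi => D.hol _ hi) hζ haz hz
  have hO : (fun i => a i - z i) =O[l] δ := by
    have h4 : (fun i => (a i - z i) / δ i) =O[l] fun _ => (1 : ℂ) := hda.isBigO_one ℂ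
    have h5 := h4.mul (isBigO_refl δ l)
    refine (h5.congr' ?_ ?_)
    · filter_upwards [hδ] with i hi
      field_simp
    · simp only [one_mul]
      exact EventuallyEq.rfl
  have hrem := (hlo.trans_isBigO hO).tendsto_div_nhds_zero
  have hG' : Tendsto (fun i => (D.f (t₁ i) (z i) - D.f (t₂ i) (z i)) / δ i) l (𝓝 (G ζ)) :=
    hG.tendsto_comp (hGd.continuousOn ζ hζ) hζ
      (tendsto_nhdsWithin_iff.2 ⟨hz, hz (isOpen_ball.mem_nhds hζ)⟩)
  have hsum := ((hdy.add hG').sub hrem).sub (hda.const_mul (deriv (D.f t) ζ))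
  refine (hsum.congr fun i => ?_).trans (le_of_eq ?_)
  · simp only [gap, defect, hp0]
    have : a i = D.step (ε i) (D.vec (t₁ i) (z i)) 1 / α i := by simp only [a, hp0]
    rw [← this]
    ring
  · congr 1
    simp only [normal]
    ring

end GraphChart

/-! ### Degenerate graphs -/

namespace GraphChart

variable {X : Set P2} {ι : Type*} {ℒ : C1Lamination X ι} (D : GraphChart ℒ)

lemma zero_mem : (0 : ℂ) ∈ ball (0 : ℂ) D.R := mem_ball_self D.R_pos

lemma differentiableOn_vec {t : ℂ} (ht : t ∈ D.T) : DifferentiableOn ℂ (D.vec t) (ball 0 D.R) := by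
  refine differentiableOn_pi.2 fun i => ?_
  fin_cases i
  · exact differentiableOn_const _
  · exact differentiableOn_id
  · exact D.hol t ht

lemma differentiableOn_normal {t : ℂ} (ht : t ∈ D.T) :
    DifferentiableOn ℂ (D.normal t) (ball 0 D.R) := by
  have hE : ∀ k, DifferentiableOn ℂ (fun ζ => D.field (D.vec t ζ) k) (ball 0 D.R) := fun k =>
    differentiableOn_pi.1 (D.field.differentiable.comp_differentiableOn (D.differentiableOn_vec ht)) k
  exact ((hE 2).sub ((hE 0).mul (D.hol t ht))).sub
    (((D.hol t ht).deriv isOpen_ball).mul ((hE 1).sub (differentiableOn_id.mul (hE 0))))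

/-- The size of a pair of graphs and a shear parameter. -/
def spread (ε t₁ t₂ : ℂ) : ℝ := ‖ε‖ + ‖D.f t₁ 0 - D.f t₂ 0‖

lemma spread_pos {ε : ℂ} (hε : ε ≠ 0) (t₁ t₂ : ℂ) : 0 < D.spread ε t₁ t₂ :=
  add_pos_of_pos_of_nonneg (norm_pos_iff.2 hε) (norm_nonneg _)

/-- If the gaps of two converging sequences of graphs are small compared to the size of the data,
then the graphs are to first order obtained from each other by the flow of the field. -/
theorem tendsto_of_gap_small {I : Type*} (𝒱 : Ultrafilter I) {t₁ t₂ ε : I → ℂ} {t : ℂ}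
    (ht₁ : ∀ᶠ i in (𝒱 : Filter I), t₁ i ∈ D.T) (ht₂ : ∀ᶠ i in (𝒱 : Filter I), t₂ i ∈ D.T)
    (ht : t ∈ D.T) (h₁ : Tendsto (fun i => D.f (t₁ i) 0) 𝒱 (𝓝 (D.f t 0)))
    (h₂ : Tendsto (fun i => D.f (t₂ i) 0) 𝒱 (𝓝 (D.f t 0)))
    (hε : Tendsto ε 𝒱 (𝓝 0)) (hε0 : ∀ᶠ i in (𝒱 : Filter I), ε i ≠ 0)
    {ζ₁ : ℂ} {r : ℝ} (hr : 0 < r) (hζ₁ : ζ₁ ∈ ball (0 : ℂ) D.R)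
    (hgap : ∀ ζ ∈ ball ζ₁ r, ζ ∈ ball (0 : ℂ) D.R →
      Tendsto (fun i => D.gap (D.step (ε i)) (t₁ i) (t₂ i) ζ / (D.spread (ε i) (t₁ i) (t₂ i) : ℂ))
        𝒱 (𝓝 0)) :
    (∀ ζ ∈ ball (0 : ℂ) D.R,
      Tendsto (fun i => (D.f (t₁ i) ζ - D.f (t₂ i) ζ) / ε i) 𝒱 (𝓝 (D.normal t ζ))) ∧
    ∀ ζ ∈ ball (0 : ℂ) D.R, ∀ z : I → ℂ, Tendsto z 𝒱 (𝓝 ζ) →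
      Tendsto (fun i => D.gap (D.step (ε i)) (t₁ i) (t₂ i) (z i) /
        (D.spread (ε i) (t₁ i) (t₂ i) : ℂ)) 𝒱 (𝓝 0) := by
  set δ : I → ℂ := fun i => (D.spread (ε i) (t₁ i) (t₂ i) : ℂ) with hδdef
  have hδnorm : ∀ᶠ i in (𝒱 : Filter I), 0 < D.spread (ε i) (t₁ i) (t₂ i) :=
    hε0.mono fun i hi => D.spread_pos hi _ _
  have hδ : ∀ᶠ i in (𝒱 : Filter I), δ i ≠ 0 := hδnorm.mono fun i hi => by
    simpa [hδdef] using hi.ne'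
  have hnδ : ∀ᶠ i in (𝒱 : Filter I), ‖δ i‖ = D.spread (ε i) (t₁ i) (t₂ i) :=
    hδnorm.mono fun i hi => by simp [hδdef, abs_of_pos hi]
  have hU₁ := D.tendstoLocallyUniformlyOn_f ht₁ ht D.zero_mem tendsto_const_nhds h₁
  have hU₂ := D.tendstoLocallyUniformlyOn_f ht₂ ht D.zero_mem tendsto_const_nhds h₂
  obtain ⟨G, hG, hGd⟩ := exists_tendstoLocallyUniformlyOn_of_bounded 𝒱 (R := D.R) (C := |D.C|)
    (F := fun i ζ => (D.f (t₁ i) ζ - D.f (t₂ i) ζ) / δ i)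
    (by
      filter_upwards [ht₁, ht₂] with i h3 h4
      exact ((D.hol _ h3).sub (D.hol _ h4)).div_const _)
    (by
      filter_upwards [ht₁, ht₂, hδnorm, hnδ] with i h3 h4 h5 h6 ζ hζ
      rw [norm_div, h6, div_le_iff₀ h5]
      refine (D.comp _ h3 _ h4 ζ hζ 0 D.zero_mem).trans ?_
      refine (mul_le_mul_of_nonneg_right (le_abs_self D.C) (norm_nonneg _)).trans ?_
      exact mul_le_mul_of_nonneg_left (by simp [spread]) (abs_nonneg _))
  obtain ⟨e, -, he⟩ : ∃ e ∈ closedBall (0 : ℂ) 1, Tendsto (fun i => ε i / δ i) 𝒱 (𝓝 e) := by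
    obtain ⟨e, h3, h4⟩ := (isCompact_closedBall (0 : ℂ) 1).ultrafilter_le_nhds
      (𝒱.map fun i => ε i / δ i) (by
        simp only [Ultrafilter.coe_map, le_principal_iff, mem_map]
        filter_upwards [hδnorm, hnδ] with i h5 h6
        simp only [mem_preimage, mem_closedBall_zero_iff, norm_div, h6]
        rw [div_le_one h5]
        simp [spread])
    exact ⟨e, h3, h4⟩
  have hexp : ∀ ζ ∈ ball (0 : ℂ) D.R, ∀ z : I → ℂ, Tendsto z 𝒱 (𝓝 ζ) →
      Tendsto (fun i => D.gap (D.step (ε i)) (t₁ i) (t₂ i) (z i) / δ i) 𝒱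
        (𝓝 (G ζ - e * D.normal t ζ)) := fun ζ hζ z hz =>
    D.tendsto_gap_div ht₂ ht hU₁ hU₂ hε he hδ hG hGd hζ hz
  -- The gaps are only assumed small near ζ₁. The identity theorem for the limit extends this to the
  -- whole disc.
  have hzero : ∀ ζ ∈ ball (0 : ℂ) D.R, G ζ - e * D.normal t ζ = 0 := by
    have hd : DifferentiableOn ℂ (fun ζ => G ζ - e * D.normal t ζ) (ball 0 D.R) :=
      hGd.sub ((D.differentiableOn_normal ht).const_mul e)
    refine eqOn_zero_of_differentiableOn_ball hd hζ₁ ?_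
    refine Eventually.frequently (Eventually.filter_mono nhdsWithin_le_nhds ?_)
    filter_upwards [ball_mem_nhds ζ₁ hr, isOpen_ball.mem_nhds hζ₁] with ζ h3 h4
    exact tendsto_nhds_unique (hexp ζ h4 _ tendsto_const_nhds) (hgap ζ h3 h4)
  -- The normalization by `spread` prevents both limits from vanishing. If e = 0, then G ≡ 0, a
  -- contradiction, so ε and `spread` have the same order.
  have hsum : ‖e‖ + ‖G 0‖ = 1 := by
    have h3 : Tendsto (fun i => (D.f (t₁ i) 0 - D.f (t₂ i) 0) / δ i) 𝒱 (𝓝 (G 0)) :=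
      hG.tendsto_at D.zero_mem
    have h4 := he.norm.add h3.norm
    refine tendsto_nhds_unique h4 (tendsto_const_nhds.congr' ?_)
    filter_upwards [hδnorm, hnδ] with i h5 h6
    rw [norm_div, norm_div, h6, ← add_div]
    exact (div_self h5.ne').symm
  have he0 : e ≠ 0 := by
    rintro rfl
    have := hzero 0 D.zero_mem
    rw [zero_mul, sub_zero] at this
    rw [this] at hsum
    simp at hsum
  refine ⟨fun ζ hζ => ?_, fun ζ hζ z hz => ?_⟩
  · have h3 : Tendsto (fun i => (D.f (t₁ i) ζ - D.f (t₂ i) ζ) / δ i) 𝒱 (𝓝 (G ζ)) :=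
      hG.tendsto_at hζ
    have h4 := h3.div he he0
    have h5 : G ζ / e = D.normal t ζ := by
      rw [sub_eq_zero.1 (hzero ζ hζ)]; field_simp
    rw [h5] at h4
    refine h4.congr' ?_
    filter_upwards [hδ] with i hi
    simp only [Pi.div_apply]
    rw [div_div_div_cancel_right₀ hi]
  · have := hexp ζ hζ z hz
    rwa [hzero ζ hζ] at this

/-- A graph is degenerate if it is a limit of pairs of graphs and shears with very small gap. -/
def Degenerate (t : ℂ) : Prop :=
  ∀ η : ℝ, 0 < η → ∃ ε : ℂ, ε ≠ 0 ∧ ‖ε‖ < η ∧ ∃ t₁ ∈ D.T, ∃ t₂ ∈ D.T,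
    ‖D.f t₁ 0 - D.f t 0‖ < η ∧ ‖D.f t₂ 0 - D.f t 0‖ < η ∧
    ∀ ζ ∈ ball (0 : ℂ) (D.R / 8), ‖D.gap (D.step ε) t₁ t₂ ζ‖ ≤ η * D.spread ε t₁ t₂

/-- Witnesses for η = 1/(i+1) are fed into `tendsto_of_gap_small`. The hyperfilter makes every
bounded quantity converge. -/
theorem Degenerate.exists_seq {D : GraphChart ℒ} {t : ℂ} (h : D.Degenerate t) (ht : t ∈ D.T) :
    ∃ t₁ t₂ ε : ℕ → ℂ, (∀ i, t₁ i ∈ D.T) ∧ (∀ i, t₂ i ∈ D.T) ∧ (∀ i, ε i ≠ 0) ∧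
      Tendsto ε (hyperfilter ℕ) (𝓝 0) ∧
      Tendsto (fun i => D.f (t₁ i) 0) (hyperfilter ℕ) (𝓝 (D.f t 0)) ∧
      Tendsto (fun i => D.f (t₂ i) 0) (hyperfilter ℕ) (𝓝 (D.f t 0)) ∧
      (∀ ζ ∈ ball (0 : ℂ) D.R,
        Tendsto (fun i => (D.f (t₁ i) ζ - D.f (t₂ i) ζ) / ε i) (hyperfilter ℕ)
          (𝓝 (D.normal t ζ))) ∧
      ∀ ζ ∈ ball (0 : ℂ) D.R, ∀ z : ℕ → ℂ, Tendsto z (hyperfilter ℕ) (𝓝 ζ) →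
        Tendsto (fun i => D.gap (D.step (ε i)) (t₁ i) (t₂ i) (z i) /
          (D.spread (ε i) (t₁ i) (t₂ i) : ℂ)) (hyperfilter ℕ) (𝓝 0) := by
  have hpos : ∀ i : ℕ, (0 : ℝ) < 1 / ((i : ℝ) + 1) := fun i => by positivity
  choose ε hε0 hε t₁ ht₁ t₂ ht₂ h₁ h₂ hg using fun i : ℕ => h _ (hpos i)
  have hl : ((hyperfilter ℕ : Ultrafilter ℕ) : Filter ℕ) ≤ atTop := by
    rw [← Nat.cofinite_eq_atTop]; exact hyperfilter_le_cofinite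
  have h0 : Tendsto (fun i : ℕ => 1 / ((i : ℝ) + 1)) (hyperfilter ℕ) (𝓝 0) :=
    tendsto_one_div_add_atTop_nhds_zero_nat.mono_left hl
  have hε' : Tendsto ε (hyperfilter ℕ) (𝓝 0) :=
    squeeze_zero_norm (fun i => (hε i).le) h0
  have h₁' : Tendsto (fun i => D.f (t₁ i) 0) (hyperfilter ℕ) (𝓝 (D.f t 0)) :=
    tendsto_iff_norm_sub_tendsto_zero.2 (squeeze_zero (fun _ => norm_nonneg _)
      (fun i => (h₁ i).le) h0)
  have h₂' : Tendsto (fun i => D.f (t₂ i) 0) (hyperfilter ℕ) (𝓝 (D.f t 0)) :=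
    tendsto_iff_norm_sub_tendsto_zero.2 (squeeze_zero (fun _ => norm_nonneg _)
      (fun i => (h₂ i).le) h0)
  refine ⟨t₁, t₂, ε, ht₁, ht₂, hε0, hε', h₁', h₂', ?_⟩
  refine D.tendsto_of_gap_small (hyperfilter ℕ) (Eventually.of_forall ht₁)
    (Eventually.of_forall ht₂) ht h₁' h₂' hε' (Eventually.of_forall hε0) (ζ₁ := 0) (r := D.R / 8)
    (by linarith [D.R_pos]) D.zero_mem fun ζ hζ _ => ?_
  refine squeeze_zero_norm (fun i => ?_) h0
  have hs := D.spread_pos (hε0 i) (t₁ i) (t₂ i)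
  rw [norm_div, Complex.norm_real, Real.norm_of_nonneg hs.le, div_le_iff₀ hs]
  exact hg i ζ hζ

/-- Convergence along moving points is equivalent to the uniform smallness that degeneracy asks for,
since points violating it would have a limit in a compact disc. -/
theorem degenerate_of_tendsto {t₁ t₂ ε : ℕ → ℂ} {t : ℂ}
    (ht₁ : ∀ᶠ i in (hyperfilter ℕ : Filter ℕ), t₁ i ∈ D.T)
    (ht₂ : ∀ᶠ i in (hyperfilter ℕ : Filter ℕ), t₂ i ∈ D.T)
    (h₁ : Tendsto (fun i => D.f (t₁ i) 0) (hyperfilter ℕ) (𝓝 (D.f t 0)))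
    (h₂ : Tendsto (fun i => D.f (t₂ i) 0) (hyperfilter ℕ) (𝓝 (D.f t 0)))
    (hε : Tendsto ε (hyperfilter ℕ) (𝓝 0)) (hε0 : ∀ᶠ i in (hyperfilter ℕ : Filter ℕ), ε i ≠ 0)
    (hgap : ∀ ζ ∈ ball (0 : ℂ) D.R, ∀ z : ℕ → ℂ, Tendsto z (hyperfilter ℕ) (𝓝 ζ) →
        Tendsto (fun i => D.gap (D.step (ε i)) (t₁ i) (t₂ i) (z i) /
          (D.spread (ε i) (t₁ i) (t₂ i) : ℂ)) (hyperfilter ℕ) (𝓝 0)) : D.Degenerate t := by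
  intro η hη
  have hev : ∀ᶠ i in (hyperfilter ℕ : Filter ℕ), ∀ ζ ∈ ball (0 : ℂ) (D.R / 8),
      ‖D.gap (D.step (ε i)) (t₁ i) (t₂ i) ζ‖ ≤ η * D.spread (ε i) (t₁ i) (t₂ i) := by
    by_contra hcon
    rw [← Ultrafilter.eventually_not] at hcon
    -- A violating point if there is one, and 0 otherwise.
    have : ∀ i, ∃ ζ ∈ ball (0 : ℂ) (D.R / 8),
        (¬ ∀ ζ ∈ ball (0 : ℂ) (D.R / 8),
          ‖D.gap (D.step (ε i)) (t₁ i) (t₂ i) ζ‖ ≤ η * D.spread (ε i) (t₁ i) (t₂ i)) →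
        η * D.spread (ε i) (t₁ i) (t₂ i) < ‖D.gap (D.step (ε i)) (t₁ i) (t₂ i) ζ‖ := by
      intro i
      by_cases hi : ∀ ζ ∈ ball (0 : ℂ) (D.R / 8),
          ‖D.gap (D.step (ε i)) (t₁ i) (t₂ i) ζ‖ ≤ η * D.spread (ε i) (t₁ i) (t₂ i)
      · exact ⟨0, mem_ball_self (by linarith [D.R_pos]), fun h => (h hi).elim⟩
      · have hi' := hi
        push Not at hi'
        obtain ⟨ζ, h3, h4⟩ := hi'
        exact ⟨ζ, h3, fun _ => h4⟩
    choose z hz hzg using this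
    obtain ⟨ζ, hζ, hzζ⟩ := (isCompact_closedBall (0 : ℂ) (D.R / 8)).ultrafilter_le_nhds
      ((hyperfilter ℕ).map z) (by
        simp only [Ultrafilter.coe_map, le_principal_iff, mem_map]
        exact Eventually.of_forall fun i => ball_subset_closedBall (hz i))
    have hζR : ζ ∈ ball (0 : ℂ) D.R := closedBall_subset_ball (by linarith [D.R_pos]) hζ
    have h3 := (hgap ζ hζR z hzζ).norm.eventually (gt_mem_nhds (show ‖(0 : ℂ)‖ < η by simpa))
    obtain ⟨i, h4, h5, h6⟩ := (h3.and (hcon.and hε0)).exists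
    have hs := D.spread_pos h6 (t₁ i) (t₂ i)
    rw [norm_div, Complex.norm_real, Real.norm_of_nonneg hs.le, div_lt_iff₀ hs] at h4
    exact absurd (hzg i h5) (not_lt.2 h4.le)
  have h3 : ∀ᶠ i in (hyperfilter ℕ : Filter ℕ), ‖ε i‖ < η := by
    have := hε.norm.eventually (gt_mem_nhds (show ‖(0 : ℂ)‖ < η by simpa))
    exact this
  have h4 := (tendsto_iff_norm_sub_tendsto_zero.1 h₁).eventually (gt_mem_nhds hη)
  have h5 := (tendsto_iff_norm_sub_tendsto_zero.1 h₂).eventually (gt_mem_nhds hη)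
  obtain ⟨i, a1, a2, a3, a4, a5, a6, a7⟩ :=
    (hev.and (h3.and (h4.and (h5.and (ht₁.and (ht₂.and hε0)))))).exists
  exact ⟨ε i, a7, a2, t₁ i, a5, t₂ i, a6, a3, a4, a1⟩

/-- On a degenerate graph the normal component of the field vanishes identically or nowhere. -/
theorem Degenerate.normal_eq_zero {D : GraphChart ℒ} {t : ℂ} (h : D.Degenerate t) (ht : t ∈ D.T)
    {ζ₀ : ℂ} (hζ₀ : ζ₀ ∈ ball (0 : ℂ) D.R) (h0 : D.normal t ζ₀ = 0) :
    ∀ ζ ∈ ball (0 : ℂ) D.R, D.normal t ζ = 0 := by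
  obtain ⟨t₁, t₂, ε, ht₁, ht₂, -, -, -, -, hn, -⟩ := h.exists_seq ht
  intro ζ hζ
  -- The Harnack inequality for (f_{t₁} − f_{t₂})/ε passes to the limit as |ν(ζ)| ≤ C |ν(ζ₀)|, with
  -- ν = `normal t`.
  have h1 := (hn ζ₀ hζ₀).norm.const_mul D.C
  rw [h0, norm_zero, mul_zero] at h1
  have h2 := hn ζ hζ
  refine tendsto_nhds_unique h2 (squeeze_zero_norm (fun i => ?_) h1)
  rw [norm_div, norm_div, mul_div_assoc']
  exact div_le_div_of_nonneg_right (D.comp _ (ht₁ i) _ (ht₂ i) _ hζ _ hζ₀) (norm_nonneg _)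

lemma degenerate_of_forall {t : ℂ} (h : ∀ η : ℝ, 0 < η → ∃ t' ∈ D.T, D.Degenerate t' ∧
    ‖D.f t' 0 - D.f t 0‖ < η) : D.Degenerate t := by
  intro η hη
  obtain ⟨t', -, h', htt'⟩ := h (η / 2) (by positivity)
  obtain ⟨ε, hε, hεη, t₁, ht₁, t₂, ht₂, h1, h2, h3⟩ := h' (η / 2) (by positivity)
  refine ⟨ε, hε, by linarith, t₁, ht₁, t₂, ht₂, ?_, ?_, fun ζ hζ => (h3 ζ hζ).trans ?_⟩
  · have := norm_add_le (D.f t₁ 0 - D.f t' 0) (D.f t' 0 - D.f t 0)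
    rw [sub_add_sub_cancel] at this
    linarith
  · have := norm_add_le (D.f t₂ 0 - D.f t' 0) (D.f t' 0 - D.f t 0)
    rw [sub_add_sub_cancel] at this
    linarith
  · have := D.spread_pos hε t₁ t₂
    nlinarith

end GraphChart

/-! ### Degeneracy does not depend on the chart -/

namespace GraphChart

variable {X : Set P2} {ι : Type*} {ℒ : C1Lamination X ι} (D : GraphChart ℒ)

/-- Two graphs with a common point coincide, since `comp` then has right side zero. -/
lemma f_eq_of_eq {t s ζ₀ : ℂ} (ht : t ∈ D.T) (hs : s ∈ D.T) (hζ₀ : ζ₀ ∈ ball (0 : ℂ) D.R)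
    (h : D.f t ζ₀ = D.f s ζ₀) {ζ : ℂ} (hζ : ζ ∈ ball (0 : ℂ) D.R) : D.f t ζ = D.f s ζ := by
  have := D.comp t ht s hs ζ hζ ζ₀ hζ₀
  rw [h, sub_self, norm_zero, mul_zero] at this
  exact sub_eq_zero.1 (norm_le_zero_iff.1 this)

lemma eq_of_pt_eq {t s ζ ξ : ℂ} (h : D.pt t ζ = D.pt s ξ) : ζ = ξ ∧ D.f t ζ = D.f s ξ := by
  have := affPt_injective D.basis h
  exact ⟨congrArg Prod.fst this, congrArg Prod.snd this⟩

/-- The change of homogeneous coordinates between two charts. -/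
def change (D' : GraphChart ℒ) : (Fin 3 → ℂ) ≃L[ℂ] (Fin 3 → ℂ) := D.basis.trans D'.basis.symm

lemma change_field (D' : GraphChart ℒ) (v : Fin 3 → ℂ) :
    D.change D' (D.field v) = D'.field (D.change D' v) := by
  apply D'.basis.injective
  simp only [change, ContinuousLinearEquiv.trans_apply, ContinuousLinearEquiv.apply_symm_apply,
    basis_field]

lemma change_vec (D' : GraphChart ℒ) {t ζ t' ζ' : ℂ} (h : D.pt t ζ = D'.pt t' ζ') :
    D.change D' (D.vec t ζ) 0 ≠ 0 ∧
      D.change D' (D.vec t ζ) = D.change D' (D.vec t ζ) 0 • D'.vec t' ζ' ∧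
      D.change D' (D.vec t ζ) 1 / D.change D' (D.vec t ζ) 0 = ζ' ∧
      D.change D' (D.vec t ζ) 2 / D.change D' (D.vec t ζ) 0 = D'.f t' ζ' := by
  obtain ⟨h0, h1, h2⟩ := eq_of_proj_eq_affPt D'.basis (affVec_ne_zero D.basis (ζ, D.f t ζ)) h
  change D.change D' (D.vec t ζ) 0 ≠ 0 at h0
  change D.change D' (D.vec t ζ) 1 / D.change D' (D.vec t ζ) 0 = ζ' at h1
  change D.change D' (D.vec t ζ) 2 / D.change D' (D.vec t ζ) 0 = D'.f t' ζ' at h2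
  refine ⟨h0, ?_, h1, h2⟩
  conv_lhs => rw [smul_affVec h0, h1, h2]
  rfl

/-- Affine charts are open embeddings, so convergence of points in the plane is convergence of both
coordinates in `D'`. Convergence over one moving point then suffices. -/
lemma tendstoLocallyUniformlyOn_transfer {D D' : GraphChart ℒ} {I : Type*} {l : Filter I}
    {s s' κ z : I → ℂ} {t t' ζ₀ ζ₁ : ℂ} (ht : t ∈ D.T) (ht' : t' ∈ D'.T)
    (hζ₀ : ζ₀ ∈ ball (0 : ℂ) D.R) (hζ₁ : ζ₁ ∈ ball (0 : ℂ) D'.R)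
    (hpt : D.pt t ζ₀ = D'.pt t' ζ₁) (hs' : ∀ᶠ i in l, s' i ∈ D'.T) (hz : Tendsto z l (𝓝 ζ₀))
    (h : TendstoLocallyUniformlyOn (fun i => D.f (s i)) (D.f t) l (ball 0 D.R))
    (heq : ∀ᶠ i in l, D.pt (s i) (z i) = D'.pt (s' i) (κ i)) :
    Tendsto κ l (𝓝 ζ₁) ∧
      TendstoLocallyUniformlyOn (fun i => D'.f (s' i)) (D'.f t') l (ball 0 D'.R) := by
  have h1 : Tendsto (fun i => D.pt (s i) (z i)) l (𝓝 (D.pt t ζ₀)) :=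
    (continuous_affPt D.basis).continuousAt.tendsto.comp
      (hz.prodMk_nhds (D.tendsto_f h ht hζ₀ hz))
  rw [hpt] at h1
  have h2 : Tendsto (fun i => D'.pt (s' i) (κ i)) l (𝓝 (D'.pt t' ζ₁)) := h1.congr' heq
  have h3 : Tendsto (fun i => (κ i, D'.f (s' i) (κ i))) l (𝓝 (ζ₁, D'.f t' ζ₁)) :=
    (isOpenEmbedding_affPt D'.basis).isInducing.tendsto_nhds_iff.2 h2
  have h4 : Tendsto κ l (𝓝 ζ₁) := continuousAt_fst.tendsto.comp h3
  have h5 : Tendsto (fun i => D'.f (s' i) (κ i)) l (𝓝 (D'.f t' ζ₁)) :=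
    continuousAt_snd.tendsto.comp h3
  exact ⟨h4, D'.tendstoLocallyUniformlyOn_f hs' ht' hζ₁ h4 h5⟩

/-- Comparison of the gaps of corresponding graphs in two charts. -/
lemma tendsto_gap_transfer {D D' : GraphChart ℒ} {I : Type*} {l : Filter I} [l.NeBot]
    {t₁ t₂ t₁' t₂' ε z : I → ℂ} {t t' ζ ζ' : ℂ} (ht : t ∈ D.T)
    (ht₂' : ∀ᶠ i in l, t₂' i ∈ D'.T) (hζ : ζ ∈ ball (0 : ℂ) D.R) (hζ' : ζ' ∈ ball (0 : ℂ) D'.R)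
    (hU₁ : TendstoLocallyUniformlyOn (fun i => D.f (t₁ i)) (D.f t) l (ball 0 D.R))
    (hU₂ : TendstoLocallyUniformlyOn (fun i => D.f (t₂ i)) (D.f t) l (ball 0 D.R))
    (hU₁' : Tendsto (fun i => D'.f (t₁' i) ζ') l (𝓝 (D'.f t' ζ')))
    (hz : Tendsto z l (𝓝 ζ)) (hε : Tendsto ε l (𝓝 0))
    (h₁ : ∀ᶠ i in l, D.pt (t₁ i) (z i) = D'.pt (t₁' i) ζ')
    (h₂ : ∀ a : I → ℂ, Tendsto a l (𝓝 ζ) →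
      ∃ b : I → ℂ, ∀ᶠ i in l, D.pt (t₂ i) (a i) = D'.pt (t₂' i) (b i))
    (hgap : Tendsto (fun i => D.gap (D.step (ε i)) (t₁ i) (t₂ i) (z i) / ε i) l (𝓝 0)) :
    Tendsto (fun i => D'.gap (D'.step (ε i)) (t₁' i) (t₂' i) ζ' / ε i) l (𝓝 0) := by
  set S := D.change D' with hS
  have hv := D.tendsto_vec hz (D.tendsto_f hU₁ ht hζ hz)
  set v := D.vec t ζ with hvdef
  have hSk : ∀ k, Continuous fun u => S u k := fun k => (continuous_apply k).comp S.continuous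
  have hv' : Tendsto (fun i => D'.vec (t₁' i) ζ') l (𝓝 (D'.vec t' ζ')) :=
    D'.tendsto_vec tendsto_const_nhds hU₁'
  have hSv : S v = S v 0 • D'.vec t' ζ' := by
    have h3 : Tendsto (fun i => S (D.vec (t₁ i) (z i))) l (𝓝 (S v)) :=
      S.continuous.continuousAt.tendsto.comp hv
    have h4 : Tendsto (fun i => S (D.vec (t₁ i) (z i)) 0 • D'.vec (t₁' i) ζ') l
        (𝓝 (S v 0 • D'.vec t' ζ')) :=
      ((hSk 0).continuousAt.tendsto.comp hv).smul hv'
    refine tendsto_nhds_unique h3 (h4.congr' ?_)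
    filter_upwards [h₁] with i hi
    exact (D.change_vec D' hi).2.1.symm
  have hSv0 : S v 0 ≠ 0 := by
    intro h0
    rw [h0, zero_smul] at hSv
    have h3 : v = 0 := by simpa using hSv
    exact vec_one_ne_zero ζ (D.f t ζ) h3
  have hSv1 : S v 1 / S v 0 = ζ' := by
    rw [hSv]
    simp [hSv0]
  -- the image of the first point
  set p : I → (Fin 3 → ℂ) := fun i => D.step (ε i) (D.vec (t₁ i) (z i)) with hp
  have hpv : Tendsto p l (𝓝 v) := by
    have h3 : Tendsto (fun i => D.field (D.vec (t₁ i) (z i))) l (𝓝 (D.field v)) :=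
      D.field.continuous.continuousAt.tendsto.comp hv
    have h4 := hv.sub (hε.smul h3)
    rw [zero_smul, sub_zero] at h4
    exact h4
  have hpk : ∀ k, Tendsto (fun i => p i k) l (𝓝 (v k)) := fun k =>
    (continuous_apply k).continuousAt.tendsto.comp hpv
  have hp0 : Tendsto (fun i => p i 0) l (𝓝 1) := hpk 0
  have hp0' : ∀ᶠ i in l, p i 0 ≠ 0 := hp0.eventually_ne one_ne_zero
  set a : I → ℂ := fun i => p i 1 / p i 0 with ha
  have haζ : Tendsto a l (𝓝 ζ) := by
    have := (hpk 1).div hp0 one_ne_zero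
    rw [div_one] at this
    exact this
  obtain ⟨b, hb⟩ := h₂ a haζ
  set u : I → (Fin 3 → ℂ) := fun i => D.vec (t₂ i) (a i) with hu
  have huv : Tendsto u l (𝓝 v) := D.tendsto_vec haζ (D.tendsto_f hU₂ ht hζ haζ)
  set q : I → (Fin 3 → ℂ) := fun i => (p i 0)⁻¹ • p i with hq
  have hqv : Tendsto q l (𝓝 v) := by
    have := (hp0.inv₀ one_ne_zero).smul hpv
    simpa using this
  -- `q` is the sheared point of the first graph and `u` the point of the second graph over the same
  -- base point. They differ only in the last coordinate, by the gap.
  have hqu : ∀ᶠ i in l, ‖q i - u i‖ ≤ ‖D.gap (D.step (ε i)) (t₁ i) (t₂ i) (z i)‖ := by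
    filter_upwards [hp0'] with i hi
    rw [pi_norm_le_iff_of_nonneg (norm_nonneg _)]
    intro k
    fin_cases k
    · simp [hq, hu, hi]
    · simp only [hq, hu, ha, Fin.mk_one, Pi.sub_apply, Pi.smul_apply, smul_eq_mul, vec_one]
      rw [inv_mul_eq_div, sub_self, norm_zero]
      exact norm_nonneg _
    · simp only [hq, hu, ha, Fin.reduceFinMk, Pi.sub_apply, Pi.smul_apply, smul_eq_mul, vec_two]
      rw [inv_mul_eq_div]
      rfl
  have hlip : ∀ k, ∃ K : NNReal, ∀ᶠ i in l, ‖S (q i) k / S (q i) 0 - S (u i) k / S (u i) 0‖ ≤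
      K * ‖D.gap (D.step (ε i)) (t₁ i) (t₂ i) (z i)‖ := by
    intro k
    have hsm : ∀ k, ContDiffAt ℂ 1 (fun w => S w k) v := fun k => by
      have h3 : ContDiff ℂ 1 (S : (Fin 3 → ℂ) → (Fin 3 → ℂ)) := S.contDiff
      exact (contDiff_pi.1 h3 k).contDiffAt
    have hA : ContDiffAt ℂ 1 (fun w => S w k / S w 0) v := (hsm k).div (hsm 0) hSv0
    obtain ⟨K, W, hW, hK⟩ := hA.exists_lipschitzOnWith
    refine ⟨K, ?_⟩
    filter_upwards [hqu, hqv hW, huv hW] with i h3 h4 h5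
    have h6 := hK.dist_le_mul _ h4 _ h5
    rw [dist_eq_norm, dist_eq_norm] at h6
    exact h6.trans (mul_le_mul_of_nonneg_left h3 K.2)
  obtain ⟨K₁, hK₁⟩ := hlip 1
  obtain ⟨K₂, hK₂⟩ := hlip 2
  have hA1 : ContinuousAt (fun w => S w 1 / S w 0) v :=
    (hSk 1).continuousAt.div (hSk 0).continuousAt hSv0
  have hAq : Tendsto (fun i => S (q i) 1 / S (q i) 0) l (𝓝 ζ') := hSv1 ▸ hA1.tendsto.comp hqv
  have hAu : Tendsto (fun i => S (u i) 1 / S (u i) 0) l (𝓝 ζ') := hSv1 ▸ hA1.tendsto.comp huv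
  have hSq0 : ∀ᶠ i in l, S (q i) 0 ≠ 0 :=
    ((hSk 0).continuousAt.tendsto.comp hqv).eventually_ne hSv0
  have hζ'' : ‖ζ'‖ < D'.R := by simpa using hζ'
  obtain ⟨s, hs0, hsR⟩ := exists_between hζ''
  have hζs : ball (0 : ℂ) s ∈ 𝓝 ζ' := isOpen_ball.mem_nhds (by simpa using hs0)
  set L := 1 / (D'.R - s)
  have hL : 0 < L := one_div_pos.2 (by linarith)
  -- The change of coordinates is Lipschitz near the limit point. The image of `u` lies on the
  -- corresponding graph of `D'`, whose slope is bounded by `L`, so the gap grows by at most a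
  -- constant factor.
  have hmain : ∀ᶠ i in l, ‖D'.gap (D'.step (ε i)) (t₁' i) (t₂' i) ζ'‖ ≤
      (K₂ + L * K₁) * ‖D.gap (D.step (ε i)) (t₁ i) (t₂ i) (z i)‖ := by
    filter_upwards [h₁, hb, hK₁, hK₂, hp0', hSq0, hAq hζs, hAu hζs, ht₂'] with i e1 e2 e3 e4 e5 e6 e7
      e8 e9
    obtain ⟨c0, c1, -, -⟩ := D.change_vec D' e1
    obtain ⟨d0, -, d1, d2⟩ := D.change_vec D' e2
    have hstep : S (p i) = S (D.vec (t₁ i) (z i)) 0 • D'.step (ε i) (D'.vec (t₁' i) ζ') := by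
      have h3 : S (p i) = D'.step (ε i) (S (D.vec (t₁ i) (z i))) := by
        have h4 : p i = D.vec (t₁ i) (z i) - ε i • D.field (D.vec (t₁ i) (z i)) := rfl
        have h5 : D'.step (ε i) (S (D.vec (t₁ i) (z i))) =
          S (D.vec (t₁ i) (z i)) - ε i • D'.field (S (D.vec (t₁ i) (z i))) := rfl
        rw [h4, map_sub, map_smul, h5, hS, D.change_field D']
      rw [h3]
      conv_lhs => rw [c1]
      rw [map_smul]
    have hgapeq : D'.gap (D'.step (ε i)) (t₁' i) (t₂' i) ζ' = defect (D'.f (t₂' i)) (S (q i)) := by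
      rw [gap, ← defect_smul _ _ c0, ← hstep]
      simp only [hq]
      rw [map_smul, defect_smul _ _ (inv_ne_zero e5)]
    rw [hgapeq, defect]
    have h6 := D'.norm_sub_le e9 hsR e8 e7
    change S (u i) 2 / S (u i) 0 = _ at d2
    change S (u i) 1 / S (u i) 0 = _ at d1
    rw [← d1] at d2
    have h7 : S (q i) 2 / S (q i) 0 - D'.f (t₂' i) (S (q i) 1 / S (q i) 0) =
        (S (q i) 2 / S (q i) 0 - S (u i) 2 / S (u i) 0) +
        (D'.f (t₂' i) (S (u i) 1 / S (u i) 0) - D'.f (t₂' i) (S (q i) 1 / S (q i) 0)) := by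
      rw [d2]; ring
    rw [h7]
    refine (norm_add_le _ _).trans ?_
    rw [norm_sub_rev] at e3
    have h8 := h6.trans (mul_le_mul_of_nonneg_left e3 hL.le)
    rw [add_mul, mul_assoc]
    exact add_le_add e4 h8
  have h9 := hgap.norm.const_mul ((K₂ : ℝ) + L * K₁)
  rw [norm_zero, mul_zero] at h9
  refine squeeze_zero_norm' ?_ h9
  filter_upwards [hmain] with i hi
  rw [norm_div, norm_div, mul_div_assoc']
  exact div_le_div_of_nonneg_right hi (norm_nonneg _)

/-- The field of the shears is intrinsic, so sequences of graphs with small gaps can be carried from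
one chart to the other near the common point. `tendsto_of_gap_small` then spreads the smallness over
the whole disc of `D'`. -/
theorem Degenerate.transfer {D D' : GraphChart ℒ} {t t' ζ₀ ζ₁ : ℂ} (h : D.Degenerate t)
    (ht : t ∈ D.T) (ht' : t' ∈ D'.T) (hζ₀ : ζ₀ ∈ ball (0 : ℂ) D.R) (hζ₁ : ζ₁ ∈ ball (0 : ℂ) D'.R)
    (hw₀ : D.f t ζ₀ ∈ ball (0 : ℂ) D.ρ) (hw₁ : D'.f t' ζ₁ ∈ ball (0 : ℂ) D'.ρ)
    (hpt : D.pt t ζ₀ = D'.pt t' ζ₁) : D'.Degenerate t' := by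
  obtain ⟨t₁, t₂, ε, ht₁, ht₂, hε0, hε, h₁, h₂, hn, hg⟩ := h.exists_seq ht
  have hU₁ := D.tendstoLocallyUniformlyOn_f (Eventually.of_forall ht₁) ht D.zero_mem
    tendsto_const_nhds h₁
  have hU₂ := D.tendstoLocallyUniformlyOn_f (Eventually.of_forall ht₂) ht D.zero_mem
    tendsto_const_nhds h₂
  -- On degenerate sequences spread/|ε| tends to 1 + |ν(0)|, with ν = `normal t`, so the chart
  -- dependent `spread` may be replaced by ε.
  have hgε : ∀ ζ ∈ ball (0 : ℂ) D.R, ∀ z : ℕ → ℂ, Tendsto z (hyperfilter ℕ) (𝓝 ζ) →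
      Tendsto (fun i => D.gap (D.step (ε i)) (t₁ i) (t₂ i) (z i) / ε i) (hyperfilter ℕ) (𝓝 0) := by
    intro ζ hζ z hz
    have h3 := (hg ζ hζ z hz).norm.mul ((tendsto_const_nhds (x := (1 : ℝ))).add
      (hn 0 D.zero_mem).norm)
    rw [norm_zero, zero_mul] at h3
    refine squeeze_zero_norm (fun i => le_of_eq ?_) h3
    have hs := D.spread_pos (hε0 i) (t₁ i) (t₂ i)
    have hεi : ‖ε i‖ ≠ 0 := norm_ne_zero_iff.2 (hε0 i)
    rw [norm_div, norm_div, norm_div, Complex.norm_real, Real.norm_of_nonneg hs.le]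
    have : (1 : ℝ) + ‖D.f (t₁ i) 0 - D.f (t₂ i) 0‖ / ‖ε i‖ = D.spread (ε i) (t₁ i) (t₂ i) / ‖ε i‖ := by
      rw [spread]; field_simp
    rw [this]
    field_simp
  obtain ⟨δ₁, hδ₁, hT₁⟩ := D.exists_transfer D' hζ₀ hζ₁ hw₁ hpt one_pos
  obtain ⟨δ₂, hδ₂, hT₂⟩ := D'.exists_transfer D hζ₁ hζ₀ hw₀ hpt.symm (half_pos hδ₁)
  have hcorr : ∀ s : ℕ → ℂ, (∀ i, s i ∈ D.T) →
      TendstoLocallyUniformlyOn (fun i => D.f (s i)) (D.f t) (hyperfilter ℕ) (ball 0 D.R) →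
      ∃ s' : ℕ → ℂ, (∀ i, s' i ∈ D'.T) ∧ (∀ᶠ i in (hyperfilter ℕ : Filter ℕ), ∀ ζ ∈ ball ζ₀ δ₁,
        ζ ∈ ball (0 : ℂ) D.R ∧ ∃ ζ' ∈ ball (0 : ℂ) D'.R, D.pt (s i) ζ = D'.pt (s' i) ζ') ∧
      TendstoLocallyUniformlyOn (fun i => D'.f (s' i)) (D'.f t') (hyperfilter ℕ) (ball 0 D'.R) := by
    intro s hs hU
    have h3 : ∀ i, ∃ s' ∈ D'.T, ‖D.f (s i) ζ₀ - D.f t ζ₀‖ < δ₁ → ∀ ζ ∈ ball ζ₀ δ₁,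
        ζ ∈ ball (0 : ℂ) D.R ∧ ∃ ζ' ∈ ball (0 : ℂ) D'.R, ζ' ∈ ball ζ₁ 1 ∧
          D.pt (s i) ζ = D'.pt s' ζ' := by
      intro i
      by_cases h4 : ‖D.f (s i) ζ₀ - D.f t ζ₀‖ < δ₁
      · obtain ⟨s', hs', h5⟩ := hT₁ _ (hs i) h4
        exact ⟨s', hs', fun _ => h5⟩
      · exact ⟨t', ht', fun h5 => (h4 h5).elim⟩
    choose s' hs' h4 using h3
    have h5 : ∀ᶠ i in (hyperfilter ℕ : Filter ℕ), ‖D.f (s i) ζ₀ - D.f t ζ₀‖ < δ₁ :=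
      (tendsto_iff_norm_sub_tendsto_zero.1 (hU.tendsto_at hζ₀)).eventually (gt_mem_nhds hδ₁)
    have h6 : ∀ i, ∃ κ, ‖D.f (s i) ζ₀ - D.f t ζ₀‖ < δ₁ → D.pt (s i) ζ₀ = D'.pt (s' i) κ := by
      intro i
      by_cases h7 : ‖D.f (s i) ζ₀ - D.f t ζ₀‖ < δ₁
      · obtain ⟨-, ζ', -, -, h8⟩ := h4 i h7 ζ₀ (mem_ball_self hδ₁)
        exact ⟨ζ', fun _ => h8⟩
      · exact ⟨0, fun h8 => (h7 h8).elim⟩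
    choose κ hκ using h6
    refine ⟨s', hs', ?_, ?_⟩
    · filter_upwards [h5] with i h7 ζ hζ
      obtain ⟨h8, ζ', h9, -, h10⟩ := h4 i h7 ζ hζ
      exact ⟨h8, ζ', h9, h10⟩
    · exact (tendstoLocallyUniformlyOn_transfer (z := fun _ => ζ₀) ht ht' hζ₀ hζ₁ hpt
        (Eventually.of_forall hs') tendsto_const_nhds hU (h5.mono fun i hi => hκ i hi)).2
  obtain ⟨t₁', ht₁', hc₁, hU₁'⟩ := hcorr t₁ ht₁ hU₁
  obtain ⟨t₂', ht₂', hc₂, hU₂'⟩ := hcorr t₂ ht₂ hU₂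
  -- The gap in `D'` must be tested at every ζ' near ζ₁, so each such point has to come from the old
  -- chart. The radius δ₁/2 keeps the preimages in a compact disc over which the transfer is valid.
  have hback : ∀ᶠ i in (hyperfilter ℕ : Filter ℕ), ∀ ζ' ∈ ball ζ₁ δ₂,
      ∃ ζ ∈ ball ζ₀ (δ₁ / 2), D.pt (t₁ i) ζ = D'.pt (t₁' i) ζ' := by
    have h5 : ∀ᶠ i in (hyperfilter ℕ : Filter ℕ), ‖D'.f (t₁' i) ζ₁ - D'.f t' ζ₁‖ < δ₂ :=
      (tendsto_iff_norm_sub_tendsto_zero.1 (hU₁'.tendsto_at hζ₁)).eventually (gt_mem_nhds hδ₂)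
    have h6 : ∀ i, ∃ κ ∈ ball (0 : ℂ) D'.R, (∃ ζ' ∈ ball (0 : ℂ) D'.R,
        D.pt (t₁ i) ζ₀ = D'.pt (t₁' i) ζ') → D.pt (t₁ i) ζ₀ = D'.pt (t₁' i) κ := by
      intro i
      by_cases h7 : ∃ ζ' ∈ ball (0 : ℂ) D'.R, D.pt (t₁ i) ζ₀ = D'.pt (t₁' i) ζ'
      · obtain ⟨ζ', h8, h9⟩ := h7
        exact ⟨ζ', h8, fun _ => h9⟩
      · exact ⟨0, D'.zero_mem, fun h8 => (h7 h8).elim⟩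
    choose κ hκR hκ using h6
    have h7 : ∀ᶠ i in (hyperfilter ℕ : Filter ℕ), D.pt (t₁ i) ζ₀ = D'.pt (t₁' i) (κ i) :=
      hc₁.mono fun i hi => hκ i (hi ζ₀ (mem_ball_self hδ₁)).2
    have h8 := (tendstoLocallyUniformlyOn_transfer (z := fun _ => ζ₀) ht ht' hζ₀ hζ₁ hpt
        (Eventually.of_forall ht₁') tendsto_const_nhds hU₁ h7).1
    filter_upwards [h5, h7, h8 (ball_mem_nhds _ hδ₂)] with i e1 e2 e3 ζ' hζ'
    obtain ⟨s, hs, hsT⟩ := hT₂ _ (ht₁' i) e1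
    obtain ⟨-, ξ, hξ, -, hξe⟩ := hsT (κ i) e3
    have h9 := D.eq_of_pt_eq (e2.trans hξe)
    have h10 : D.f (t₁ i) ζ₀ = D.f s ζ₀ := h9.2.trans (by rw [← h9.1])
    obtain ⟨-, ζ, hζ, hζb, hζe⟩ := hsT ζ' hζ'
    refine ⟨ζ, hζb, ?_⟩
    rw [hζe, pt, pt, D.f_eq_of_eq (ht₁ i) hs hζ₀ h10 hζ]
  have hsubR : closedBall ζ₀ (δ₁ / 2) ⊆ ball (0 : ℂ) D.R := by
    obtain ⟨i, hi⟩ := hc₁.exists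
    exact fun ζ hζ => (hi ζ (closedBall_subset_ball (by linarith) hζ)).1
  have hgap' : ∀ ζ' ∈ ball ζ₁ δ₂, ζ' ∈ ball (0 : ℂ) D'.R →
      Tendsto (fun i => D'.gap (D'.step (ε i)) (t₁' i) (t₂' i) ζ' /
        (D'.spread (ε i) (t₁' i) (t₂' i) : ℂ)) (hyperfilter ℕ) (𝓝 0) := by
    intro ζ' hζ' hζR'
    have h3 : ∀ i, ∃ z ∈ ball ζ₀ (δ₁ / 2), (∃ ζ ∈ ball ζ₀ (δ₁ / 2),
        D.pt (t₁ i) ζ = D'.pt (t₁' i) ζ') → D.pt (t₁ i) z = D'.pt (t₁' i) ζ' := by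
      intro i
      by_cases h4 : ∃ ζ ∈ ball ζ₀ (δ₁ / 2), D.pt (t₁ i) ζ = D'.pt (t₁' i) ζ'
      · obtain ⟨ζ, h5, h6⟩ := h4
        exact ⟨ζ, h5, fun _ => h6⟩
      · exact ⟨ζ₀, mem_ball_self (by linarith), fun h5 => (h4 h5).elim⟩
    choose z hz hze using h3
    have hze' : ∀ᶠ i in (hyperfilter ℕ : Filter ℕ), D.pt (t₁ i) (z i) = D'.pt (t₁' i) ζ' :=
      hback.mono fun i hi => hze i (hi ζ' hζ')
    obtain ⟨ζ, hζ, hzζ⟩ := (isCompact_closedBall ζ₀ (δ₁ / 2)).ultrafilter_le_nhds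
      ((hyperfilter ℕ).map z) (by
        simp only [Ultrafilter.coe_map, le_principal_iff, mem_map]
        exact Eventually.of_forall fun i => ball_subset_closedBall (hz i))
    have hζR := hsubR hζ
    have hmain := tendsto_gap_transfer (D := D) (D' := D') (t₂' := t₂') ht
      (Eventually.of_forall ht₂')
      hζR hζR' hU₁ hU₂ (hU₁'.tendsto_at hζR') hzζ hε hze' (fun a ha => ?_) (hgε ζ hζR z hzζ)
    · refine squeeze_zero_norm (fun i => ?_) (tendsto_zero_iff_norm_tendsto_zero.1 hmain)
      have hs := D'.spread_pos (hε0 i) (t₁' i) (t₂' i)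
      rw [norm_div, norm_div, Complex.norm_real, Real.norm_of_nonneg hs.le]
      refine div_le_div_of_nonneg_left (norm_nonneg _) (norm_pos_iff.2 (hε0 i)) ?_
      simp [spread]
    · have h4 : ∀ᶠ i in (hyperfilter ℕ : Filter ℕ), ∃ b, D.pt (t₂ i) (a i) = D'.pt (t₂' i) b := by
        have h5 : ball ζ₀ δ₁ ∈ 𝓝 ζ := isOpen_ball.mem_nhds
          (closedBall_subset_ball (by linarith) hζ)
        filter_upwards [hc₂, ha h5] with i h6 h7
        obtain ⟨-, b, -, hb⟩ := h6 _ h7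
        exact ⟨b, hb⟩
      exact h4.choice
  have h₁' : Tendsto (fun i => D'.f (t₁' i) 0) (hyperfilter ℕ) (𝓝 (D'.f t' 0)) :=
    hU₁'.tendsto_at D'.zero_mem
  have h₂' : Tendsto (fun i => D'.f (t₂' i) 0) (hyperfilter ℕ) (𝓝 (D'.f t' 0)) :=
    hU₂'.tendsto_at D'.zero_mem
  refine D'.degenerate_of_tendsto (Eventually.of_forall ht₁') (Eventually.of_forall ht₂') h₁' h₂'
    hε (Eventually.of_forall hε0) ?_
  exact (D'.tendsto_of_gap_small (hyperfilter ℕ) (Eventually.of_forall ht₁')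
    (Eventually.of_forall ht₂') ht' h₁' h₂' hε (Eventually.of_forall hε0) hδ₂ hζ₁ hgap').2

end GraphChart

/-! ### From a degenerate leaf to a germ of a line -/

lemma P2.continuousAt_of_comp_proj {Y : Type*} [TopologicalSpace Y] {g : P2 → Y}
    {v : Fin 3 → ℂ} (hv : v ≠ 0) (h : ContinuousAt (fun u => g (P2.proj u)) v) :
    ContinuousAt g (P2.proj v) := by
  intro s hs
  refine mem_map.2 (mem_of_superset (P2.image_proj_mem_nhds hv (mem_map.1 (h hs))) ?_)
  rintro _ ⟨u, hu, rfl⟩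
  exact hu

/-- The maximum principle: a compact set that is a union of germs of holomorphic curves meets every
line. -/
theorem exists_mem_linear_eq_zero {K : Set P2} (hK : IsCompact K) (hne : K.Nonempty)
    (hleaf : ∀ q ∈ K, ∃ (γ : ℂ → (Fin 3 → ℂ)) (ζ₀ : ℂ), P2.proj (γ ζ₀) = q ∧
      (∀ᶠ ζ in 𝓝 ζ₀, DifferentiableAt ℂ γ ζ ∧ γ ζ ≠ 0 ∧ P2.proj (γ ζ) ∈ K) ∧
      ∃ᶠ ζ in 𝓝 ζ₀, P2.proj (γ ζ) ≠ q)
    (l : (Fin 3 → ℂ) →L[ℂ] ℂ) : ∃ v : Fin 3 → ℂ, v ≠ 0 ∧ P2.proj v ∈ K ∧ l v = 0 := by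
  by_contra! hl
  set T := (EuclideanSpace.equiv (Fin 3) ℂ).symm
  -- If l had no zero on `K`, then v/l(v) would be a well defined lift, holomorphic along the germs.
  -- The Euclidean norm is used because it is strictly convex: at a maximum the lift itself, not
  -- just its norm, is locally constant.
  set g : P2 → ℝ := fun x => ‖T ((l x.rep)⁻¹ • x.rep)‖
  have hg : ∀ v : Fin 3 → ℂ, v ≠ 0 → g (P2.proj v) = ‖T ((l v)⁻¹ • v)‖ := by
    intro v hv
    obtain ⟨c, hc, h⟩ := (P2.proj_eq_proj_iff (P2.proj v).rep_nonzero hv).1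
      (by rw [P2.proj_of_ne_zero (P2.proj v).rep_nonzero, (P2.proj v).mk_rep])
    simp only [g, h, map_smul l, smul_smul, smul_eq_mul, mul_inv]
    rw [mul_comm c⁻¹, mul_assoc, inv_mul_cancel₀ hc, mul_one]
  have hgc : ContinuousOn g K := by
    intro x hx
    obtain ⟨v, hv, rfl⟩ := P2.exists_proj_eq x
    refine (P2.continuousAt_of_comp_proj hv ?_).continuousWithinAt
    have h1 : (fun u => g (P2.proj u)) =ᶠ[𝓝 v] fun u => ‖T ((l u)⁻¹ • u)‖ := by
      filter_upwards [isOpen_ne.mem_nhds hv] with u hu using hg u hu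
    refine ContinuousAt.congr ?_ h1.symm
    have h2 : ContinuousAt (fun u => (l u)⁻¹ • u) v :=
      (l.continuous.continuousAt.inv₀ (hl v hv hx)).smul continuousAt_id
    exact (T.continuous.continuousAt.comp h2).norm
  obtain ⟨q, hq, hmax⟩ := hK.exists_isMaxOn hne hgc
  obtain ⟨γ, ζ₀, hγq, hγ, hfr⟩ := hleaf q hq
  set φ : ℂ → EuclideanSpace ℂ (Fin 3) := fun ζ => T ((l (γ ζ))⁻¹ • γ ζ)
  have hd : ∀ᶠ ζ in 𝓝 ζ₀, DifferentiableAt ℂ φ ζ := by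
    filter_upwards [hγ] with ζ h1
    have h2 : DifferentiableAt ℂ (fun ζ => l (γ ζ)) ζ := l.differentiableAt.comp ζ h1.1
    exact T.differentiableAt.comp ζ ((h2.inv (hl _ h1.2.1 h1.2.2)).smul h1.1)
  have hloc : IsLocalMax (norm ∘ φ) ζ₀ := by
    filter_upwards [hγ] with ζ h1
    have h2 := hmax h1.2.2
    have h3 := hγ.self_of_nhds.2.1
    rw [mem_ofPred_eq, ← hγq, hg _ h1.2.1, hg _ h3] at h2
    exact h2
  obtain ⟨ζ, ⟨h1, h2⟩, h3⟩ := ((Complex.eventually_eq_of_isLocalMax_norm hd hloc).and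
    hγ |>.and_frequently hfr).exists
  apply h3
  have h4 := T.injective h1
  have h5 := hγ.self_of_nhds
  rw [← hγq, ← P2.proj_smul (γ ζ) (inv_ne_zero (hl _ h2.2.1 h2.2.2)), h4,
    P2.proj_smul _ (inv_ne_zero (hl _ h5.2.1 h5.2.2))]

namespace GraphChart

variable {X : Set P2} {ι : Type*} {ℒ : C1Lamination X ι} (D : GraphChart ℒ)

lemma differentiableAt_basis_vec {t ζ : ℂ} (ht : t ∈ D.T) (hζ : ζ ∈ ball (0 : ℂ) D.R) :
    DifferentiableAt ℂ (fun ζ => D.basis (D.vec t ζ)) ζ :=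
  D.basis.differentiableAt.comp ζ
    ((D.differentiableOn_vec ht).differentiableAt (isOpen_ball.mem_nhds hζ))

lemma frequently_pt_ne (t ζ : ℂ) : ∃ᶠ ζ' in 𝓝 ζ, D.pt t ζ' ≠ D.pt t ζ := by
  have h : ∃ᶠ ζ' in 𝓝[≠] ζ, D.pt t ζ' ≠ D.pt t ζ := by
    refine Eventually.frequently ?_
    filter_upwards [self_mem_nhdsWithin] with ζ' h1 h2
    exact h1 (congrArg Prod.fst (affPt_injective D.basis h2))
  exact h.filter_mono nhdsWithin_le_nhds

/-- If the field is tangent to a graph, then the graph lies in a line through the centre of the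
shears. -/
lemma exists_line_of_normal_eq_zero {t : ℂ} (ht : t ∈ D.T)
    (h : ∀ ζ ∈ ball (0 : ℂ) D.R, D.normal t ζ = 0) :
    ∃ a b : ℂ, (a ≠ 0 ∨ b ≠ 0) ∧ ∀ ζ ∈ ball (0 : ℂ) D.R,
      a * D.basis (D.vec t ζ) 0 + b * D.basis (D.vec t ζ) 2 = 0 := by
  set z : ℂ → ℂ := fun ζ => D.basis (D.vec t ζ) 0
  set w : ℂ → ℂ := fun ζ => D.basis (D.vec t ζ) 2
  have hd : ∀ i, ∀ ζ ∈ ball (0 : ℂ) D.R, HasDerivAt (fun ζ => D.basis (D.vec t ζ) i)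
      (D.basis ![0, 1, deriv (D.f t) ζ] i) ζ := by
    intro i ζ hζ
    have h1 : HasDerivAt (D.vec t) ![0, 1, deriv (D.f t) ζ] ζ := by
      refine hasDerivAt_pi.2 fun k => ?_
      fin_cases k
      · exact hasDerivAt_const ζ (1 : ℂ)
      · exact hasDerivAt_id ζ
      · exact ((D.hol t ht).differentiableAt (isOpen_ball.mem_nhds hζ)).hasDerivAt
    exact hasDerivAt_pi.1 (D.basis.toContinuousLinearMap.hasFDerivAt.comp_hasDerivAt ζ h1) i
  by_cases hz : ∀ ζ ∈ ball (0 : ℂ) D.R, z ζ = 0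
  · exact ⟨1, 0, Or.inl one_ne_zero, fun ζ hζ => by simpa using hz ζ hζ⟩
  push Not at hz
  obtain ⟨ζ₁, hζ₁, hz₁⟩ := hz
  -- Tangency makes the field a combination of position and velocity. Its components 0 and 2 vanish
  -- in the original coordinates, so the Wronskian of these two coordinates vanishes and their ratio
  -- is locally constant.
  have hwr : ∀ ζ ∈ ball (0 : ℂ) D.R, z ζ ≠ 0 →
      z ζ * D.basis ![0, 1, deriv (D.f t) ζ] 2 = D.basis ![0, 1, deriv (D.f t) ζ] 0 * w ζ := by
    intro ζ hζ hzζ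
    set E := D.field (D.vec t ζ) with hE
    set κ := E 1 - ζ * E 0 with hκ
    have h1 : E = E 0 • D.vec t ζ + κ • ![0, 1, deriv (D.f t) ζ] := by
      have h2 := h ζ hζ
      simp only [normal, ← hE] at h2
      ext k
      fin_cases k
      · simp
      · simp [hκ]; ring
      · simp [hκ]; linear_combination h2
    have h2 := congrArg D.basis h1
    rw [hE, basis_field, map_add, map_smul, map_smul, shearField_apply] at h2
    have e0 := congrFun h2 0
    have e1 := congrFun h2 1
    have e2 := congrFun h2 2
    simp only [Matrix.cons_val_zero, Matrix.cons_val_one, Matrix.cons_val, Pi.add_apply,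
      Pi.smul_apply, smul_eq_mul] at e0 e1 e2
    change 0 = _ * z ζ + _ at e0
    change z ζ = _ at e1
    change 0 = _ * w ζ + _ at e2
    by_cases hκ0 : κ = 0
    · rw [hκ0, zero_mul, add_zero] at e0 e1
      have : E 0 = 0 := by
        rcases mul_eq_zero.1 e0.symm with h3 | h3
        · exact h3
        · exact absurd h3 hzζ
      rw [← hE, this, zero_mul] at e1
      exact absurd e1 hzζ
    · apply mul_left_cancel₀ hκ0
      linear_combination w ζ * e0 - z ζ * e2
  have hzd : DifferentiableOn ℂ z (ball 0 D.R) := fun ζ hζ =>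
    (hd 0 ζ hζ).differentiableAt.differentiableWithinAt
  have hwd : DifferentiableOn ℂ w (ball 0 D.R) := fun ζ hζ =>
    (hd 2 ζ hζ).differentiableAt.differentiableWithinAt
  have hnear : ∀ᶠ ζ in 𝓝 ζ₁, ζ ∈ ball (0 : ℂ) D.R ∧ z ζ ≠ 0 :=
    Eventually.and (isOpen_ball.mem_nhds hζ₁)
      ((hzd.differentiableAt (isOpen_ball.mem_nhds hζ₁)).continuousAt.eventually_ne hz₁)
  obtain ⟨r, hr, hrs⟩ := Metric.eventually_nhds_iff_ball.1 hnear
  have hconst : ∀ ζ ∈ ball ζ₁ r, w ζ / z ζ = w ζ₁ / z ζ₁ := by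
    intro ζ hζ
    refine (convex_ball ζ₁ r).is_const_of_fderivWithin_eq_zero (𝕜 := ℂ)
      (f := fun ζ => w ζ / z ζ) ?_ ?_ hζ (mem_ball_self hr)
    · intro y hy
      exact ((hd 2 y (hrs y hy).1).differentiableAt.div (hd 0 y (hrs y hy).1).differentiableAt
        (hrs y hy).2).differentiableWithinAt
    · intro y hy
      have h3 := (hd 2 y (hrs y hy).1).div (hd 0 y (hrs y hy).1) (hrs y hy).2
      have h4 := hwr y (hrs y hy).1 (hrs y hy).2
      rw [show D.basis ![0, 1, deriv (D.f t) y] 2 * D.basis (D.vec t y) 0 -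
        D.basis (D.vec t y) 2 * D.basis ![0, 1, deriv (D.f t) y] 0 = 0 by
          simp only [z, w] at h4; linear_combination h4, zero_div] at h3
      have h5 := (h3.hasFDerivAt.hasFDerivWithinAt (s := ball ζ₁ r)).fderivWithin
        (isOpen_ball.uniqueDiffWithinAt hy)
      refine h5.trans ?_
      ext
      simp
  refine ⟨w ζ₁ / z ζ₁, -1, Or.inr (by simp), ?_⟩
  have hH : DifferentiableOn ℂ (fun ζ => w ζ₁ / z ζ₁ * z ζ + -1 * w ζ) (ball 0 D.R) :=
    (hzd.const_mul _).add (hwd.const_mul _)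
  refine eqOn_zero_of_differentiableOn_ball hH hζ₁ (Eventually.frequently ?_)
  refine Filter.Eventually.filter_mono nhdsWithin_le_nhds ?_
  filter_upwards [ball_mem_nhds ζ₁ hr] with ζ hζ
  have h1 := hconst ζ hζ
  have h2 := (hrs ζ hζ).2
  rw [← h1]
  field_simp
  ring

end GraphChart

namespace C1Lamination

variable {X : Set P2} {ι : Type*} (ℒ : C1Lamination X ι)

/-- The union of the degenerate leaves. -/
def degenerateSet : Set P2 :=
  {x | ∃ D : GraphChart ℒ, ∃ t ∈ D.T, ∃ ζ ∈ ball (0 : ℂ) D.R, D.f t ζ ∈ ball (0 : ℂ) D.ρ ∧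
    D.Degenerate t ∧ D.pt t ζ = x}

lemma degenerateSet_subset : ℒ.degenerateSet ⊆ X := by
  rintro _ ⟨D, t, ht, ζ, hζ, -, -, rfl⟩
  exact D.pt_mem ht hζ

/-- A limit point of the set has its own chart. Nearby degenerate germs transfer to degenerate
graphs of that chart, and `comp` makes their heights over 0 approach that of the limit graph, so
`degenerate_of_forall` applies. -/
lemma isClosed_degenerateSet (hX : IsClosed X) : IsClosed ℒ.degenerateSet := by
  refine isClosed_of_closure_subset fun x hx => ?_
  have hxX : x ∈ X := hX.closure_subset_iff.2 ℒ.degenerateSet_subset hx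
  obtain ⟨D, hD⟩ := ℒ.exists_graphChart hxX
  have hρ := mem_ball_self (x := (0 : ℂ)) D.ρ_pos
  obtain ⟨t, ht, hft⟩ := D.cover 0 D.zero_mem 0 hρ (by rwa [hD])
  refine ⟨D, t, ht, 0, D.zero_mem, by rwa [hft], ?_, by rw [GraphChart.pt, hft, hD]⟩
  refine D.degenerate_of_forall fun η hη => ?_
  have hc : ContinuousAt (fun y : ℂ × ℂ => D.C * ‖y.2 - D.f t y.1‖) (0, 0) := by
    have h1 : ContinuousAt (D.f t) ((0, 0) : ℂ × ℂ).1 :=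
      ((D.hol t ht).differentiableAt (isOpen_ball.mem_nhds D.zero_mem)).continuousAt
    have h2 : ContinuousAt (fun y : ℂ × ℂ => D.f t y.1) (0, 0) :=
      ContinuousAt.comp (f := Prod.fst) h1 continuousAt_fst
    exact (continuousAt_snd.sub h2).norm.const_mul D.C
  have hev : ∀ᶠ y in 𝓝 ((0, 0) : ℂ × ℂ), D.C * ‖y.2 - D.f t y.1‖ < η ∧
      y ∈ ball (0 : ℂ) D.R ×ˢ ball (0 : ℂ) D.ρ := by
    have h0 : D.C * ‖((0, 0) : ℂ × ℂ).2 - D.f t ((0, 0) : ℂ × ℂ).1‖ < η := by simpa [hft] using hη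
    exact (hc.eventually (gt_mem_nhds h0)).and
      (prod_mem_nhds (ball_mem_nhds _ D.R_pos) (ball_mem_nhds _ D.ρ_pos))
  have hU := affPt_image_mem_nhds D.basis hev
  rw [hD] at hU
  obtain ⟨_, ⟨⟨ζ, w⟩, ⟨h1, hζ, hw⟩, rfl⟩, D', t', ht', ζ', hζ', hw', hdeg, hpt⟩ :=
    mem_closure_iff_nhds.1 hx _ hU
  obtain ⟨s, hs, hfs⟩ := D.cover ζ hζ w hw (by rw [← hpt]; exact D'.pt_mem ht' hζ')
  simp only at h1 hζ hw hpt
  refine ⟨s, hs, hdeg.transfer ht' hs hζ' hζ hw' (by rwa [hfs]) ?_, ?_⟩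
  · rw [hpt, GraphChart.pt, hfs]
  · refine (D.comp s hs t ht 0 D.zero_mem ζ hζ).trans_lt ?_
    rwa [hfs]

/-- If some leaf is degenerate, then some leaf has a germ in a line through `[0 : 1 : 0]`. -/
theorem exists_line_of_degenerate (hX : IsCompact X) (h : ℒ.degenerateSet.Nonempty) :
    ∃ a b : ℂ, (a ≠ 0 ∨ b ≠ 0) ∧ ∃ D : GraphChart ℒ, ∃ t ∈ D.T,
      (∃ ζ ∈ ball (0 : ℂ) D.R, D.f t ζ ∈ ball (0 : ℂ) D.ρ) ∧ ∀ ζ ∈ ball (0 : ℂ) D.R,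
      a * D.basis (D.vec t ζ) 0 + b * D.basis (D.vec t ζ) 2 = 0 := by
  have hK : IsCompact ℒ.degenerateSet :=
    hX.of_isClosed_subset (ℒ.isClosed_degenerateSet hX.isClosed) ℒ.degenerateSet_subset
  have hleaf : ∀ q ∈ ℒ.degenerateSet, ∃ (γ : ℂ → (Fin 3 → ℂ)) (ζ₀ : ℂ), P2.proj (γ ζ₀) = q ∧
      (∀ᶠ ζ in 𝓝 ζ₀, DifferentiableAt ℂ γ ζ ∧ γ ζ ≠ 0 ∧ P2.proj (γ ζ) ∈ ℒ.degenerateSet) ∧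
      ∃ᶠ ζ in 𝓝 ζ₀, P2.proj (γ ζ) ≠ q := by
    rintro _ ⟨D, t, ht, ζ, hζ, hw, hdeg, rfl⟩
    refine ⟨fun ζ => D.basis (D.vec t ζ), ζ, rfl, ?_, D.frequently_pt_ne t ζ⟩
    have hc := ((D.hol t ht).differentiableAt (isOpen_ball.mem_nhds hζ)).continuousAt
    filter_upwards [isOpen_ball.mem_nhds hζ, hc (isOpen_ball.mem_nhds hw)] with ζ' h1 h2
    exact ⟨D.differentiableAt_basis_vec ht h1, affVec_ne_zero D.basis (ζ', D.f t ζ'),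
      D, t, ht, ζ', h1, h2, hdeg, rfl⟩
  -- The linear form is z, because the field z ∂/∂w vanishes identically on the line z = 0. The
  -- normal component is therefore zero at the point found.
  obtain ⟨v, hv, hvK, hv0⟩ := exists_mem_linear_eq_zero hK h hleaf
    (ContinuousLinearMap.proj (R := ℂ) (φ := fun _ : Fin 3 => ℂ) 0)
  obtain ⟨D, t, ht, ζ, hζ, hw, hdeg, hpt⟩ := hvK
  obtain ⟨c, hc, hcv⟩ := (P2.proj_eq_proj_iff (affVec_ne_zero D.basis (ζ, D.f t ζ)) hv).1 hpt
  have h0 : D.basis (D.vec t ζ) 0 = 0 := by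
    have := congrFun hcv 0
    refine this.trans ?_
    have h1 : v 0 = 0 := hv0
    simp [h1]
  have hf0 : D.field (D.vec t ζ) = 0 := by
    apply D.basis.injective
    rw [D.basis_field, shearField_apply, h0, map_zero]
    ext i; fin_cases i <;> rfl
  have hn : D.normal t ζ = 0 := by simp [GraphChart.normal, hf0]
  obtain ⟨a, b, hab, hl⟩ := D.exists_line_of_normal_eq_zero ht (hdeg.normal_eq_zero ht hζ hn)
  exact ⟨a, b, hab, D, t, ht, ⟨ζ, hζ, hw⟩, hl⟩

end C1Lamination

/-! ### A line containing a germ of a leaf -/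

namespace GraphChart

variable {X : Set P2} {ι : Type*} {ℒ : C1Lamination X ι} (D : GraphChart ℒ)
  {l : (Fin 3 → ℂ) →L[ℂ] ℂ}

/-- The linear form `l` vanishes on the graph with parameter `t`. -/
def InLine (l : (Fin 3 → ℂ) →L[ℂ] ℂ) (t : ℂ) : Prop :=
  ∀ ζ ∈ ball (0 : ℂ) D.R, l (D.basis (D.vec t ζ)) = 0

lemma inLine_of_eventually {t ζ : ℂ} (ht : t ∈ D.T) (hζ : ζ ∈ ball (0 : ℂ) D.R)
    (h : ∀ᶠ ζ' in 𝓝 ζ, l (D.basis (D.vec t ζ')) = 0) : D.InLine l t := by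
  refine eqOn_zero_of_differentiableOn_ball (H := fun ζ' => l (D.basis (D.vec t ζ')))
    (fun ζ' hζ' => ?_) hζ (h.filter_mono nhdsWithin_le_nhds).frequently
  exact (l.differentiableAt.comp ζ' (D.differentiableAt_basis_vec ht hζ')).differentiableWithinAt

lemma linear_basis_vec (v : Fin 3 → ℂ) : l (D.basis v) =
    v 0 * l (D.basis ![1, 0, 0]) + v 1 * l (D.basis ![0, 1, 0]) + v 2 * l (D.basis ![0, 0, 1]) := by
  have : v = v 0 • ![1, 0, 0] + v 1 • ![0, 1, 0] + v 2 • ![0, 0, 1] := by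
    ext i; fin_cases i <;> simp
  conv_lhs => rw [this]
  simp only [map_add, map_smul, smul_eq_mul]

/-- A line containing a graph is not vertical. Two heights over one ζ would make the vertical
coefficient of l zero, and what is left is affine in ζ and vanishes on a disc, so l = 0. -/
lemma InLine.eq_of_mem {D : GraphChart ℒ} (hl : l ≠ 0) {t : ℂ} (h : D.InLine l t) {ζ w : ℂ}
    (hζ : ζ ∈ ball (0 : ℂ) D.R) (hw : l (D.basis ![1, ζ, w]) = 0) : w = D.f t ζ := by
  have h1 := h ζ hζ
  rw [D.linear_basis_vec] at hw h1
  simp only [vec_zero, vec_one, vec_two] at h1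
  simp only [Matrix.cons_val_zero, Matrix.cons_val_one, Matrix.cons_val] at hw
  by_contra hne
  have hc : l (D.basis ![0, 0, 1]) = 0 := by
    have : (w - D.f t ζ) * l (D.basis ![0, 0, 1]) = 0 := by linear_combination hw - h1
    exact (mul_eq_zero.1 this).resolve_left (sub_ne_zero.2 hne)
  have h2 : ∀ ξ ∈ ball (0 : ℂ) D.R, l (D.basis ![1, 0, 0]) + ξ * l (D.basis ![0, 1, 0]) = 0 := by
    intro ξ hξ
    have := h ξ hξ
    rw [D.linear_basis_vec, hc] at this
    simpa using this
  have ha : l (D.basis ![1, 0, 0]) = 0 := by simpa using h2 0 D.zero_mem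
  have hR := D.R_pos
  have hb : l (D.basis ![0, 1, 0]) = 0 := by
    have := h2 ((D.R / 2 : ℝ) : ℂ) (by
      rw [mem_ball_zero_iff, Complex.norm_real, Real.norm_of_nonneg (by linarith)]; linarith)
    rw [ha, zero_add] at this
    refine (mul_eq_zero.1 this).resolve_left ?_
    exact_mod_cast (by linarith : D.R / 2 ≠ 0) 
  apply hl
  ext1 v
  rw [← D.basis.apply_symm_apply v, D.linear_basis_vec, ha, hb, hc]
  simp

lemma InLine.transfer {D D' : GraphChart ℒ} {t t' ζ ζ' : ℂ} (h : D'.InLine l t') (ht : t ∈ D.T)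
    (ht' : t' ∈ D'.T) (hζ : ζ ∈ ball (0 : ℂ) D.R) (hζ' : ζ' ∈ ball (0 : ℂ) D'.R)
    (hw : D'.f t' ζ' ∈ ball (0 : ℂ) D'.ρ) (hpt : D.pt t ζ = D'.pt t' ζ') : D.InLine l t := by
  obtain ⟨δ, hδ, hT⟩ := D.exists_transfer D' hζ hζ' hw hpt one_pos
  obtain ⟨s, hs, hsT⟩ := hT t ht (by simpa using hδ)
  obtain ⟨-, ξ, -, -, hξ⟩ := hsT ζ (mem_ball_self hδ)
  have h1 := D'.eq_of_pt_eq (hpt.symm.trans hξ)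
  have h2 : D'.f t' ζ' = D'.f s ζ' := h1.2.trans (by rw [← h1.1])
  refine D.inLine_of_eventually ht hζ ?_
  filter_upwards [ball_mem_nhds ζ hδ] with a ha
  obtain ⟨-, b, hb, -, hab⟩ := hsT a ha
  obtain ⟨c, hc, hcv⟩ := (P2.proj_eq_proj_iff (affVec_ne_zero D.basis (a, D.f t a))
    (affVec_ne_zero D'.basis (b, D'.f s b))).1 hab
  have h3 := h b hb
  have h4 : D'.vec t' b = D'.vec s b := by
    rw [vec, vec, D'.f_eq_of_eq ht' hs hζ' h2 hb]
  rw [h4] at h3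
  have h5 : D.basis (D.vec t a) = c • D'.basis (D'.vec s b) := hcv
  rw [h5, map_smul, h3, smul_zero]

end GraphChart

namespace C1Lamination

variable {X : Set P2} {ι : Type*} (ℒ : C1Lamination X ι) {l : (Fin 3 → ℂ) →L[ℂ] ℂ}

/-- The points near which the leaf lies in the line `l = 0`. -/
def lineSet (l : (Fin 3 → ℂ) →L[ℂ] ℂ) : Set P2 :=
  {x | ∃ D : GraphChart ℒ, ∃ t ∈ D.T, ∃ ζ ∈ ball (0 : ℂ) D.R, D.f t ζ ∈ ball (0 : ℂ) D.ρ ∧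
    D.InLine l t ∧ D.pt t ζ = x}

lemma lineSet_subset : ℒ.lineSet l ⊆ X := by
  rintro _ ⟨D, t, ht, ζ, hζ, -, -, rfl⟩
  exact D.pt_mem ht hζ

/-- Relative openness in the line: near such a point, the line and the graph are the same set. -/
lemma eventually_mem_lineSet (hl : l ≠ 0) {x : P2} (hx : x ∈ ℒ.lineSet l) :
    ∀ᶠ y in 𝓝 x, (∃ v, v ≠ 0 ∧ l v = 0 ∧ P2.proj v = y) → y ∈ ℒ.lineSet l := by
  obtain ⟨D, t, ht, ζ, hζ, hw, hD, rfl⟩ := hx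
  have hc := ((D.hol t ht).differentiableAt (isOpen_ball.mem_nhds hζ)).continuousAt
  have hU : {y : ℂ × ℂ | y.1 ∈ ball (0 : ℂ) D.R ∧ D.f t y.1 ∈ ball (0 : ℂ) D.ρ} ∈
      𝓝 (ζ, D.f t ζ) := by
    have h1 : ∀ᶠ a in 𝓝 ζ, a ∈ ball (0 : ℂ) D.R ∧ D.f t a ∈ ball (0 : ℂ) D.ρ :=
      Eventually.and (isOpen_ball.mem_nhds hζ) (hc (isOpen_ball.mem_nhds hw))
    exact (continuousAt_fst (p := (ζ, D.f t ζ))).eventually h1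
  filter_upwards [affPt_image_mem_nhds D.basis hU]
  rintro _ ⟨⟨a, b⟩, ⟨ha, hb⟩, rfl⟩ ⟨v, hv, hlv, hvp⟩
  obtain ⟨c, hc, hcv⟩ := (P2.proj_eq_proj_iff (affVec_ne_zero D.basis (a, b)) hv).1 hvp.symm
  have h1 : b = D.f t a := hD.eq_of_mem hl ha (by
    simp only at hcv
    rw [hcv, map_smul, hlv, smul_zero])
  exact ⟨D, t, ht, a, ha, hb, hD, by rw [GraphChart.pt, h1]⟩

/-- The chart is arbitrary, since the result is needed both for relative closedness and in the
rotated charts of `subset_line`. -/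
lemma exists_inLine_of_mem_closure (hl : l ≠ 0) {v : Fin 3 → ℂ} (hv : v ≠ 0)
    (hlv : l v = 0) (h : P2.proj v ∈ closure (ℒ.lineSet l)) (D : GraphChart ℒ)
    (hD : affPt D.basis (0, 0) = P2.proj v) : ∃ t ∈ D.T, D.InLine l t ∧ D.f t 0 = 0 := by
  have hU : ball (0 : ℂ) D.R ×ˢ ball (0 : ℂ) D.ρ ∈ 𝓝 ((0, 0) : ℂ × ℂ) :=
    prod_mem_nhds (ball_mem_nhds _ D.R_pos) (ball_mem_nhds _ D.ρ_pos)
  have hU' := affPt_image_mem_nhds D.basis hU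
  rw [hD] at hU'
  obtain ⟨_, ⟨⟨ζ, w⟩, ⟨hζ, hw⟩, rfl⟩, D', t', ht', ζ', hζ', hw', hin, hpt⟩ :=
    mem_closure_iff_nhds.1 h _ hU'
  simp only at hζ hw hpt
  obtain ⟨s, hs, hfs⟩ := D.cover ζ hζ w hw (by rw [← hpt]; exact D'.pt_mem ht' hζ')
  have hsD : D.InLine l s := hin.transfer hs ht' hζ hζ' hw' (by rw [GraphChart.pt, hfs, hpt])
  refine ⟨s, hs, hsD, (hsD.eq_of_mem hl D.zero_mem ?_).symm⟩
  obtain ⟨c, hc, hcv⟩ := (P2.proj_eq_proj_iff (affVec_ne_zero D.basis (0, 0)) hv).1 hD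
  simp only at hcv
  rw [hcv, map_smul, hlv, smul_zero]

lemma mem_lineSet_of_mem_closure (hX : IsClosed X) (hl : l ≠ 0) {v : Fin 3 → ℂ} (hv : v ≠ 0)
    (hlv : l v = 0) (h : P2.proj v ∈ closure (ℒ.lineSet l)) : P2.proj v ∈ ℒ.lineSet l := by
  obtain ⟨D, hD⟩ := ℒ.exists_graphChart (hX.closure_subset_iff.2 ℒ.lineSet_subset h)
  obtain ⟨t, ht, hin, h0⟩ := ℒ.exists_inLine_of_mem_closure hl hv hlv h D hD
  refine ⟨D, t, ht, 0, D.zero_mem, ?_, hin, by rw [GraphChart.pt, h0, hD]⟩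
  rw [h0]
  exact mem_ball_self D.ρ_pos

/-- The last coordinate in the basis `L`. -/
def lastCoord (L : (Fin 3 → ℂ) ≃L[ℂ] (Fin 3 → ℂ)) : (Fin 3 → ℂ) →L[ℂ] ℂ :=
  (ContinuousLinearMap.proj (R := ℂ) (φ := fun _ : Fin 3 => ℂ) 2).comp L.symm.toContinuousLinearMap

lemma lastCoord_apply (L : (Fin 3 → ℂ) ≃L[ℂ] (Fin 3 → ℂ)) (u : Fin 3 → ℂ) :
    lastCoord L (L u) = u 2 := by
  simp [lastCoord]

lemma lastCoord_ne_zero (L : (Fin 3 → ℂ) ≃L[ℂ] (Fin 3 → ℂ)) : lastCoord L ≠ 0 := by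
  intro h
  have := lastCoord_apply L ![0, 0, 1]
  rw [h] at this
  simp at this

/-- A line containing a germ of a leaf is a leaf. -/
theorem mem_lineSet (hX : IsClosed X) (L : (Fin 3 → ℂ) ≃L[ℂ] (Fin 3 → ℂ))
    (hne : (ℒ.lineSet (lastCoord L)).Nonempty) {v : Fin 3 → ℂ} (hv : v ≠ 0)
    (hlv : lastCoord L v = 0) : P2.proj v ∈ ℒ.lineSet (lastCoord L) := by
  set l := lastCoord L
  have hl : l ≠ 0 := lastCoord_ne_zero L
  set k : ℂ × ℂ → (Fin 3 → ℂ) := fun u => L ![u.1, u.2, 0] with hk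
  have hk0 : ∀ u : ℂ × ℂ, u ≠ 0 → k u ≠ 0 := by
    intro u hu h
    have h1 : (![u.1, u.2, 0] : Fin 3 → ℂ) = 0 := by simpa [hk] using h
    exact hu (Prod.ext (congrFun h1 0) (congrFun h1 1))
  have hkl : ∀ u, l (k u) = 0 := fun u => lastCoord_apply L _
  have hsurj : ∀ v : Fin 3 → ℂ, v ≠ 0 → l v = 0 → ∃ u : ℂ × ℂ, u ≠ 0 ∧ k u = v := by
    intro v hv hlv
    have h2 : L.symm v 2 = 0 := hlv
    have h3 : k (L.symm v 0, L.symm v 1) = v := by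
      rw [← L.apply_symm_apply v]
      simp only [hk, L.symm_apply_apply]
      congr 1
      ext i; fin_cases i <;> simp [h2]
    refine ⟨_, ?_, h3⟩
    intro h0
    rw [h0] at h3
    apply hv
    rw [← h3]
    simp only [hk, Prod.fst_zero, Prod.snd_zero]
    rw [show (![0, 0, 0] : Fin 3 → ℂ) = 0 by ext i; fin_cases i <;> rfl, map_zero]
  have hkc : Continuous k := by
    refine L.continuous.comp (continuous_pi fun i => ?_)
    fin_cases i <;> simp <;> fun_prop
  -- Connectedness is taken on the cone over the line, a punctured real 4-space, on which membership
  -- in `lineSet` is locally constant.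
  have hconn : IsPreconnected ({0}ᶜ : Set (ℂ × ℂ)) := by
    refine (isConnected_compl_singleton_of_one_lt_rank ?_ 0).isPreconnected
    rw [← Module.finrank_eq_rank, Module.finrank_prod, Complex.finrank_real_complex]
    norm_num
  obtain ⟨x, hx⟩ := hne
  obtain ⟨u₀, hu₀, hux⟩ : ∃ u : ℂ × ℂ, u ≠ 0 ∧ P2.proj (k u) ∈ ℒ.lineSet l := by
    obtain ⟨D, t, ht, ζ, hζ, hw, hin, rfl⟩ := id hx
    obtain ⟨u, hu, huk⟩ := hsurj _ (affVec_ne_zero D.basis (ζ, D.f t ζ)) (hin ζ hζ)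
    refine ⟨u, hu, ?_⟩
    rw [huk]
    exact hx
  obtain ⟨u₁, hu₁, hku₁⟩ := hsurj v hv hlv
  have key := eq_of_eventually_eq_of_isPreconnected hconn
    (g := fun u => P2.proj (k u) ∈ ℒ.lineSet l) (fun u hu => ?_) hu₀ hu₁
  · have key' : (P2.proj (k u₁) ∈ ℒ.lineSet l) = (P2.proj (k u₀) ∈ ℒ.lineSet l) := key
    rw [hku₁] at key'
    rwa [key']
  · have hcu : ContinuousAt (fun u => P2.proj (k u)) u :=
      ContinuousAt.comp (P2.continuousAt_proj (hk0 u hu)) hkc.continuousAt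
    have hne0 : ∀ᶠ u' in 𝓝 u, u' ≠ 0 := isOpen_ne.mem_nhds hu
    refine Filter.Eventually.filter_mono nhdsWithin_le_nhds ?_
    by_cases h : P2.proj (k u) ∈ ℒ.lineSet l
    · filter_upwards [hcu.eventually (ℒ.eventually_mem_lineSet hl h), hne0] with u' h1 h2
      simp only [h, eq_iff_iff, iff_true]
      exact h1 ⟨k u', hk0 u' h2, hkl u', rfl⟩
    · have h1 : P2.proj (k u) ∉ closure (ℒ.lineSet l) := fun h1 =>
        h (ℒ.mem_lineSet_of_mem_closure hX hl (hk0 u hu) (hkl u) h1)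
      filter_upwards [hcu.eventually (isClosed_closure.isOpen_compl.mem_nhds h1)] with u' h2
      simp only [h, eq_iff_iff, iff_false]
      exact fun h3 => h2 (subset_closure h3)

/-- A lamination containing a line but not contained in it accumulates at a point of the line. -/
theorem exists_mem_closure_of_line (ℒ : C1Lamination X ι) (hX : IsCompact X) {v₀ : Fin 3 → ℂ} (hl0 : l v₀ ≠ 0)
    (hX0 : P2.proj v₀ ∈ X) : ∃ v : Fin 3 → ℂ, v ≠ 0 ∧ l v = 0 ∧
      P2.proj v ∈ closure (X ∩ {x | ∃ u, l u ≠ 0 ∧ P2.proj u = x}) := by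
  have hne0 : ∀ u, l u ≠ 0 → u ≠ 0 := by
    rintro u hu rfl
    exact hu (map_zero l)
  set K := X ∩ {x | ∃ u, l u ≠ 0 ∧ P2.proj u = x}
  have hKX : closure K ⊆ X := hX.isClosed.closure_subset_iff.2 inter_subset_left
  by_contra! hcon
  -- Without accumulation on the line, the part of `X` off the line is compact and a union of germs
  -- of leaves, so the maximum principle makes it meet the line.
  have hKc : closure K ⊆ K := by
    intro x hx
    obtain ⟨u, hu, rfl⟩ := P2.exists_proj_eq x
    exact ⟨hKX hx, u, fun h0 => hcon u hu h0 hx, rfl⟩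
  have hKcl : IsClosed K := isClosed_of_closure_subset hKc
  have hleaf : ∀ q ∈ K, ∃ (γ : ℂ → (Fin 3 → ℂ)) (ζ₀ : ℂ), P2.proj (γ ζ₀) = q ∧
      (∀ᶠ ζ in 𝓝 ζ₀, DifferentiableAt ℂ γ ζ ∧ γ ζ ≠ 0 ∧ P2.proj (γ ζ) ∈ K) ∧
      ∃ᶠ ζ in 𝓝 ζ₀, P2.proj (γ ζ) ≠ q := by
    intro q hq
    obtain ⟨hqX, u, hu, rfl⟩ := hq
    obtain ⟨D, hD⟩ := ℒ.exists_graphChart hqX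
    obtain ⟨t, ht, hft⟩ := D.cover 0 D.zero_mem 0 (mem_ball_self D.ρ_pos) (by rwa [hD])
    have hpt : D.pt t 0 = P2.proj u := by rw [GraphChart.pt, hft, hD]
    refine ⟨fun ζ => D.basis (D.vec t ζ), 0, hpt, ?_, ?_⟩
    · obtain ⟨c, hc, hcu⟩ := (P2.proj_eq_proj_iff (affVec_ne_zero D.basis (0, D.f t 0))
        (hne0 u hu)).1 hpt
      have h0 : l (D.basis (D.vec t 0)) ≠ 0 := by
        have : D.basis (D.vec t 0) = c • u := hcu
        rw [this, map_smul]
        exact smul_ne_zero hc hu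
      have hc : ContinuousAt (fun ζ => l (D.basis (D.vec t ζ))) 0 :=
        l.continuous.continuousAt.comp (D.differentiableAt_basis_vec ht D.zero_mem).continuousAt
      filter_upwards [isOpen_ball.mem_nhds D.zero_mem, hc.eventually_ne h0] with ζ h1 h2
      exact ⟨D.differentiableAt_basis_vec ht h1, affVec_ne_zero D.basis (ζ, D.f t ζ),
        D.pt_mem ht h1, _, h2, rfl⟩
    · have := D.frequently_pt_ne t 0
      rwa [hpt] at this
  obtain ⟨v, hv, ⟨-, u, hu, huv⟩, hv0⟩ := exists_mem_linear_eq_zero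
    (hX.of_isClosed_subset hKcl inter_subset_left) ⟨_, hX0, v₀, hl0, rfl⟩ hleaf l
  obtain ⟨c, hc, rfl⟩ := (P2.proj_eq_proj_iff (hne0 u hu) hv).1 huv
  exact hu (by rw [map_smul, hv0, smul_zero])

end C1Lamination

-- A lamination with a line as a leaf reduces to that line

local notation "conj" => starRingEnd ℂ

/-- Invariance under rotations of the sphere of the norm of the logarithmic derivative of a section
of the tautological bundle. -/
lemma norm_logDeriv_eq_of_moebius {f F : ℂ → ℂ} {f' F' α β ζ : ℂ}
    (hαβ : α * conj α + β * conj β = 1) (hc : α - conj β * ζ ≠ 0) (hf0 : f ζ ≠ 0)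
    (hf : HasDerivAt f f' ζ) (hF : HasDerivAt F F' ((β + conj α * ζ) / (α - conj β * ζ)))
    (h : ∀ᶠ a in 𝓝 ζ, F ((β + conj α * a) / (α - conj β * a)) = f a / (α - conj β * a)) :
    ‖f' / f ζ * (1 + ζ * conj ζ) - conj ζ‖ =
      ‖F' / F ((β + conj α * ζ) / (α - conj β * ζ)) *
        (1 + (β + conj α * ζ) / (α - conj β * ζ) * conj ((β + conj α * ζ) / (α - conj β * ζ))) -
        conj ((β + conj α * ζ) / (α - conj β * ζ))‖ := by
  have hc1 : HasDerivAt (fun a => α - conj β * a) (-conj β) ζ := by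
    simpa using ((hasDerivAt_id ζ).const_mul (conj β)).const_sub α
  have hn1 : HasDerivAt (fun a => β + conj α * a) (conj α) ζ := by
    simpa using ((hasDerivAt_id ζ).const_mul (conj α)).const_add β
  have h1 := hF.comp ζ (hn1.div hc1 hc)
  have h2 := (hf.div hc1 hc).congr_of_eventuallyEq h
  have h3 := h1.unique h2
  have h4 := h.self_of_nhds
  have hF' : F' = f' * (α - conj β * ζ) + f ζ * conj β := by
    have h5 : (conj α * (α - conj β * ζ) - (β + conj α * ζ) * -conj β) = 1 := by
      linear_combination hαβ
    rw [h5] at h3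
    field_simp at h3
    linear_combination h3
  have hcc : conj α - β * conj ζ ≠ 0 := by
    have : conj (α - conj β * ζ) ≠ 0 := (map_ne_zero _).2 hc
    simpa only [map_sub, map_mul, Complex.conj_conj] using this
  -- The two expressions differ by the factor (α − β̄ζ) divided by its conjugate, of modulus one.
  have key : F' / F ((β + conj α * ζ) / (α - conj β * ζ)) *
        (1 + (β + conj α * ζ) / (α - conj β * ζ) * conj ((β + conj α * ζ) / (α - conj β * ζ))) -
        conj ((β + conj α * ζ) / (α - conj β * ζ)) =
      (α - conj β * ζ) / conj (α - conj β * ζ) * (f' / f ζ * (1 + ζ * conj ζ) - conj ζ) := by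
    rw [h4, hF']
    simp only [map_div₀, map_add, map_sub, map_mul, Complex.conj_conj]
    have h6 : (1 + (β + conj α * ζ) / (α - conj β * ζ) * ((conj β + α * conj ζ) / (conj α - β * conj ζ)))
        = (1 + ζ * conj ζ) / ((α - conj β * ζ) * (conj α - β * conj ζ)) := by
      rw [eq_div_iff (mul_ne_zero hc hcc), add_mul, div_mul_div_comm,
        div_mul_cancel₀ _ (mul_ne_zero hc hcc)]
      linear_combination (1 + ζ * conj ζ) * hαβ
    rw [h6]
    field_simp
    ring
  rw [key, norm_mul, norm_div, Complex.norm_conj, div_self (norm_ne_zero_iff.2 hc), one_mul]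

/-- There is no holomorphic `h` for which `|h (1 + |s|²) - s̄|` is maximal at the origin. -/
lemma false_of_norm_logDeriv_le {h : ℂ → ℂ} {R : ℝ} (hR : 0 < R)
    (hh : DifferentiableOn ℂ h (ball 0 R))
    (hle : ∀ s ∈ ball (0 : ℂ) R, ‖h s * (1 + s * conj s) - conj s‖ ≤ ‖h 0‖) : False := by
  set r := R / 2 with hr
  have hr0 : 0 < r := by positivity
  -- On |s| = r this holomorphic function equals s(h(s)(1 + |s|²) − s̄). Cauchy's estimate gives
  -- |h(0)|(1 + r²) ≤ |h(0)|, so h(0) = 0. Then P vanishes on the circle, although P(0) = −r².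
  set P : ℂ → ℂ := fun s => s * h s * (1 + r ^ 2) - r ^ 2
  have hsub : closedBall (0 : ℂ) r ⊆ ball 0 R := closedBall_subset_ball (by linarith)
  have hP : DifferentiableOn ℂ P (ball 0 R) :=
    ((differentiableOn_id.mul hh).mul_const _).sub_const _
  have hPc : DiffContOnCl ℂ P (ball 0 r) := by
    refine ⟨hP.mono (ball_subset_closedBall.trans hsub), ?_⟩
    rw [closure_ball _ hr0.ne']
    exact hP.continuousOn.mono hsub
  have hbd : ∀ s ∈ sphere (0 : ℂ) r, ‖P s‖ ≤ r * ‖h 0‖ := by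
    intro s hs
    have h1 : ‖s‖ = r := by simpa using hs
    have h2 : s * conj s = r ^ 2 := by rw [Complex.mul_conj, Complex.normSq_eq_norm_sq, h1]; simp
    have h3 := hle s (hsub (sphere_subset_closedBall hs))
    rw [h2] at h3
    have h4 : P s = s * (h s * (1 + r ^ 2) - conj s) := by
      simp only [P, mul_sub, h2]; ring
    rw [h4, norm_mul, h1]
    exact mul_le_mul_of_nonneg_left h3 hr0.le
  have hd : HasDerivAt P (h 0 * (1 + r ^ 2)) 0 := by
    have h1 : HasDerivAt h (deriv h 0) 0 :=
      (hh.differentiableAt (isOpen_ball.mem_nhds (mem_ball_self hR))).hasDerivAt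
    have h2 := (((hasDerivAt_id (0 : ℂ)).mul h1).mul_const (1 + (r : ℂ) ^ 2)).sub_const ((r : ℂ) ^ 2)
    have h3 : HasDerivAt P _ 0 := h2
    simpa using h3
  have h5 := Complex.norm_deriv_le_of_forall_mem_sphere_norm_le hr0 hPc hbd
  rw [hd.deriv, norm_mul, mul_div_cancel_left₀ _ hr0.ne'] at h5
  have h6 : ‖(1 + (r : ℂ) ^ 2)‖ = 1 + r ^ 2 := by
    have : (1 + (r : ℂ) ^ 2) = ((1 + r ^ 2 : ℝ) : ℂ) := by push_cast; rfl
    rw [this, Complex.norm_real, Real.norm_of_nonneg (by positivity)]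
  rw [h6] at h5
  have h7 : ‖h 0‖ = 0 := by
    have := norm_nonneg (h 0)
    nlinarith [sq_pos_of_pos hr0]
  have h8 := Complex.norm_le_of_forall_mem_frontier_norm_le isBounded_ball hPc
    (C := 0) (z := 0) (fun z hz => ?_) (subset_closure (mem_ball_self hr0))
  · have : P 0 = -(r : ℂ) ^ 2 := by simp [P]
    rw [this, norm_neg, norm_pow, Complex.norm_real, Real.norm_of_nonneg hr0.le] at h8
    nlinarith [sq_pos_of_pos hr0]
  · rw [frontier_ball _ hr0.ne'] at hz
    simpa [h7] using hbd z hz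

/-- The unitary transformation of the first two coordinates with first column `y`. -/
def rot (y : ℂ × ℂ) (u : Fin 3 → ℂ) : Fin 3 → ℂ :=
  ![y.1 * u 0 - conj y.2 * u 1, y.2 * u 0 + conj y.1 * u 1, u 2]

lemma rot_rot {y : ℂ × ℂ} (hy : y.1 * conj y.1 + y.2 * conj y.2 = 1) (u : Fin 3 → ℂ) :
    rot (conj y.1, -y.2) (rot y u) = u := by
  ext i
  fin_cases i
  · simp [rot]; linear_combination u 0 * hy
  · simp [rot]; linear_combination u 1 * hy
  · simp [rot]

lemma exists_rot_equiv (L : (Fin 3 → ℂ) ≃L[ℂ] (Fin 3 → ℂ)) {y : ℂ × ℂ}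
    (hy : y.1 * conj y.1 + y.2 * conj y.2 = 1) :
    ∃ M : (Fin 3 → ℂ) ≃L[ℂ] (Fin 3 → ℂ), ∀ u, M u = L (rot y u) := by
  let e : (Fin 3 → ℂ) ≃ₗ[ℂ] (Fin 3 → ℂ) :=
    { toFun := rot y
      invFun := rot (conj y.1, -y.2)
      map_add' := fun u v => by ext i; fin_cases i <;> simp [rot] <;> ring
      map_smul' := fun c v => by ext i; fin_cases i <;> simp [rot] <;> ring
      left_inv := rot_rot hy
      right_inv := fun u => by
        have := rot_rot (y := (conj y.1, -y.2)) (by simpa [mul_comm] using hy) u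
        simpa using this }
  exact ⟨e.toContinuousLinearEquiv.trans L, fun u => rfl⟩

lemma exists_unit_rep (L : (Fin 3 → ℂ) ≃L[ℂ] (Fin 3 → ℂ)) {v : Fin 3 → ℂ} (hv : v ≠ 0)
    (hlv : C1Lamination.lastCoord L v = 0) : ∃ y : ℂ × ℂ, y.1 * conj y.1 + y.2 * conj y.2 = 1 ∧
      P2.proj (L ![y.1, y.2, 0]) = P2.proj v := by
  set a := L.symm v 0
  set b := L.symm v 1
  have h2 : L.symm v 2 = 0 := hlv
  have hab : L.symm v = ![a, b, 0] := by
    ext i; fin_cases i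
    · rfl
    · rfl
    · exact h2
  have hpos : 0 < ‖a‖ ^ 2 + ‖b‖ ^ 2 := by
    by_contra hcon
    have h3 : ‖a‖ ^ 2 = 0 := by nlinarith [sq_nonneg ‖a‖, sq_nonneg ‖b‖]
    have h4 : ‖b‖ ^ 2 = 0 := by nlinarith [sq_nonneg ‖a‖, sq_nonneg ‖b‖]
    have h5 : a = 0 := by simpa using h3
    have h6 : b = 0 := by simpa using h4
    apply hv
    rw [← L.apply_symm_apply v, hab, h5, h6,
      show (![0, 0, 0] : Fin 3 → ℂ) = 0 by ext i; fin_cases i <;> rfl, map_zero]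
  set n := Real.sqrt (‖a‖ ^ 2 + ‖b‖ ^ 2)
  have hn : (n : ℂ) ≠ 0 := by exact_mod_cast (Real.sqrt_pos.2 hpos).ne'
  have hn2 : (n : ℂ) ^ 2 = ‖a‖ ^ 2 + ‖b‖ ^ 2 := by
    exact_mod_cast Real.sq_sqrt hpos.le
  refine ⟨((n : ℂ)⁻¹ * a, (n : ℂ)⁻¹ * b), ?_, ?_⟩
  · simp only [map_mul, map_inv₀, Complex.conj_ofReal]
    have h7 : (n : ℂ)⁻¹ * a * ((n : ℂ)⁻¹ * conj a) + (n : ℂ)⁻¹ * b * ((n : ℂ)⁻¹ * conj b) =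
      ((n : ℂ) ^ 2)⁻¹ * (a * conj a + b * conj b) := by field_simp
    rw [h7, Complex.mul_conj', Complex.mul_conj', ← hn2]
    field_simp
  · rw [show (![(n : ℂ)⁻¹ * a, (n : ℂ)⁻¹ * b, 0] : Fin 3 → ℂ) = (n : ℂ)⁻¹ • L.symm v by
      rw [hab]; ext i; fin_cases i <;> simp, map_smul, L.apply_symm_apply,
      P2.proj_smul _ (inv_ne_zero hn)]

namespace GraphChart

variable {X : Set P2} {ι : Type*} {ℒ : C1Lamination X ι} (D : GraphChart ℒ)

/-- The spherical norm of the logarithmic derivative of a graph. -/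
def slope (t ζ : ℂ) : ℝ := ‖deriv (D.f t) ζ / D.f t ζ * (1 + ζ * conj ζ) - conj ζ‖

/-- Rotated charts differ by a unitary map of the first two coordinates: the base undergoes a
rotation of the sphere and heights are divided by α − β̄ζ, as in `norm_logDeriv_eq_of_moebius`. -/
lemma slope_transfer {D D' : GraphChart ℒ} {L : (Fin 3 → ℂ) ≃L[ℂ] (Fin 3 → ℂ)} {y y' : ℂ × ℂ}
    (hy : y.1 * conj y.1 + y.2 * conj y.2 = 1) (hy' : y'.1 * conj y'.1 + y'.2 * conj y'.2 = 1)
    (hD : ∀ u, D.basis u = L (rot y u)) (hD' : ∀ u, D'.basis u = L (rot y' u)) {t t' ζ ζ' : ℂ}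
    (ht : t ∈ D.T) (ht' : t' ∈ D'.T) (hζ : ζ ∈ ball (0 : ℂ) D.R) (hζ' : ζ' ∈ ball (0 : ℂ) D'.R)
    (hw : D'.f t' ζ' ∈ ball (0 : ℂ) D'.ρ) (hpt : D.pt t ζ = D'.pt t' ζ') (hf : D.f t ζ ≠ 0) :
    D.slope t ζ = D'.slope t' ζ' := by
  -- (α, β) is the first column of the rotation for y' inverted and composed with the rotation for
  -- y.
  set α := conj y'.1 * y.1 + conj y'.2 * y.2 with hα
  set β := -y'.2 * y.1 + y'.1 * y.2 with hβ
  have hαβ : α * conj α + β * conj β = 1 := by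
    simp only [hα, hβ, map_add, map_mul, map_neg, Complex.conj_conj]
    linear_combination (y'.1 * conj y'.1 + y'.2 * conj y'.2) * hy + hy'
  have hS : ∀ a b s : ℂ, D.pt t a = D'.pt s b → α - conj β * a ≠ 0 ∧
      b = (β + conj α * a) / (α - conj β * a) ∧ D'.f s b = D.f t a / (α - conj β * a) := by
    intro a b s hab
    obtain ⟨c, hc, hcv⟩ := (P2.proj_eq_proj_iff (affVec_ne_zero D.basis (a, D.f t a))
      (affVec_ne_zero D'.basis (b, D'.f s b))).1 hab
    simp only [hD, hD', ← map_smul] at hcv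
    have h1 := L.injective hcv
    have h2 := congrArg (rot (conj y'.1, -y'.2)) h1
    have h3 : ∀ u, rot (conj y'.1, -y'.2) (c • rot y' u) = c • u := by
      intro u
      conv_rhs => rw [← rot_rot hy' u]
      ext i; fin_cases i <;> simp [rot] <;> ring
    rw [h3] at h2
    have e0 : α - conj β * a = c := by
      have := congrFun h2 0
      simp [rot] at this
      rw [← this]
      simp only [hα, hβ, map_add, map_mul, map_neg]
      ring
    have e1 : β + conj α * a = c * b := by
      have := congrFun h2 1
      simp [rot] at this
      rw [← this]
      simp only [hα, hβ, map_add, map_mul, Complex.conj_conj]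
      ring
    have e2 : D.f t a = c * D'.f s b := by
      have := congrFun h2 2
      simpa [rot] using this
    rw [e0, e1, e2]
    exact ⟨hc, by field_simp, by field_simp⟩
  obtain ⟨δ, hδ, hT⟩ := D.exists_transfer D' hζ hζ' hw hpt one_pos
  obtain ⟨s, hs, hsT⟩ := hT t ht (by simpa using hδ)
  obtain ⟨-, ξ, -, -, hξ⟩ := hsT ζ (mem_ball_self hδ)
  have h1 := D'.eq_of_pt_eq (hpt.symm.trans hξ)
  have h2 : D'.f t' ζ' = D'.f s ζ' := h1.2.trans (by rw [← h1.1])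
  obtain ⟨hc, hm, hF⟩ := hS ζ ζ' t' hpt
  have hev : ∀ᶠ a in 𝓝 ζ, D'.f t' ((β + conj α * a) / (α - conj β * a)) =
      D.f t a / (α - conj β * a) := by
    filter_upwards [ball_mem_nhds ζ hδ] with a ha
    obtain ⟨-, b, hb, -, hab⟩ := hsT a ha
    obtain ⟨-, h3, h4⟩ := hS a b s hab
    rw [← h3, D'.f_eq_of_eq ht' hs hζ' h2 hb, h4]
  have hd := ((D.hol t ht).differentiableAt (isOpen_ball.mem_nhds hζ)).hasDerivAt
  have hd' := ((D'.hol t' ht').differentiableAt (isOpen_ball.mem_nhds hζ')).hasDerivAt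
  have := norm_logDeriv_eq_of_moebius (F' := deriv (D'.f t') ζ') hαβ hc hf hd (hm ▸ hd') hev
  rw [← hm] at this
  exact this

end GraphChart

namespace C1Lamination

variable {X : Set P2} {ι : Type*} (ℒ : C1Lamination X ι)

/-- The leaf germ through each point of the line is the line itself. Its velocity lies in the line
and is independent of the position, so the horizontal component is nonzero and the rotated chart is
transverse to the leaf. -/
lemma exists_rot_chart (hX : IsClosed X) (L : (Fin 3 → ℂ) ≃L[ℂ] (Fin 3 → ℂ))
    (hne : (ℒ.lineSet (lastCoord L)).Nonempty) {y : ℂ × ℂ}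
    (hy : y.1 * conj y.1 + y.2 * conj y.2 = 1) : ∃ D : GraphChart ℒ,
      (∀ u, D.basis u = L (rot y u)) ∧ affPt D.basis (0, 0) = P2.proj (L ![y.1, y.2, 0]) := by
  obtain ⟨M, hM⟩ := exists_rot_equiv L hy
  have hM0 : affPt M (0, 0) = P2.proj (L ![y.1, y.2, 0]) := by
    rw [affPt, hM]; simp [rot]
  have hv : L ![y.1, y.2, 0] ≠ 0 := by
    intro h0
    have h1 : (![y.1, y.2, 0] : Fin 3 → ℂ) = 0 := by simpa using h0
    have e1 : y.1 = 0 := congrFun h1 0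
    have e2 : y.2 = 0 := congrFun h1 1
    simp [e1, e2] at hy
  have hmem := ℒ.mem_lineSet hX L hne hv (by rw [lastCoord_apply]; simp)
  obtain ⟨j, z₀, t₀, γ, hz₀, ht₀, hγ, hγp, hzt, hli⟩ := ℒ.exists_param (ℒ.lineSet_subset hmem)
  obtain ⟨D₁, t, ht, ζ, hζ, hw, hin, hpt⟩ := hmem
  have hl : lastCoord L (deriv γ z₀) = 0 := by
    refine D₁.linear_deriv_eq_zero ht hζ (lastCoord L) ?_ hz₀ ht₀ hγ hγp (hpt.trans hzt.symm)
    filter_upwards [isOpen_ball.mem_nhds hζ] with a ha using hin a ha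
  have hMl : ∀ v, M.symm v 2 = lastCoord L v := by
    intro v
    conv_rhs => rw [← M.apply_symm_apply v, hM, lastCoord_apply]
    rfl
  obtain ⟨D, hD⟩ := ℒ.exists_graphChart_of_box j hz₀ ht₀ hγ hγp M (hM0.trans hzt.symm) (by
    intro h1
    have h2 : M.symm (deriv γ z₀) 2 = 0 := by rw [hMl, hl]
    have h3 : P2.proj (γ z₀) = P2.proj (M ![1, 0, 0]) :=
      hγp.self_of_nhds.2.trans (hzt.trans hM0.symm)
    obtain ⟨c, hc, hcv⟩ := (P2.proj_eq_proj_iff hγp.self_of_nhds.1 (affVec_ne_zero M (0, 0))).1 h3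
    have h4 : deriv γ z₀ = (M.symm (deriv γ z₀) 0 / c) • γ z₀ := by
      simp only at hcv
      apply M.symm.injective
      rw [hcv, map_smul, map_smul, M.symm_apply_apply, smul_smul, div_mul_cancel₀ _ hc]
      ext i; fin_cases i
      · simp
      · simpa using h1
      · simpa using h2
    exact (LinearIndependent.pair_iff' hγp.self_of_nhds.1).1 hli _ h4.symm)
  subst hD
  exact ⟨D, hM, hM0⟩

end C1Lamination

namespace GraphChart

variable {X : Set P2} {ι : Type*} {ℒ : C1Lamination X ι} (D : GraphChart ℒ)

/-- The graphs close to a graph with `f = 0` have, after normalization, a nonvanishing holomorphic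
limit. -/
lemma exists_slope_limit {I : Type*} (𝒱 : Ultrafilter I) {s z : I → ℂ} {t : ℂ} (ht : t ∈ D.T)
    (h0 : ∀ ζ ∈ ball (0 : ℂ) D.R, D.f t ζ = 0) (hs : ∀ᶠ i in (𝒱 : Filter I), s i ∈ D.T)
    (hz : Tendsto z 𝒱 (𝓝 0)) (hw : Tendsto (fun i => D.f (s i) (z i)) 𝒱 (𝓝 0))
    (hw0 : ∀ᶠ i in (𝒱 : Filter I), D.f (s i) (z i) ≠ 0) :
    ∃ h : ℂ → ℂ, DifferentiableOn ℂ h (ball 0 D.R) ∧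
      (∀ ζ ∈ ball (0 : ℂ) D.R, Tendsto (fun i => D.f (s i) ζ) 𝒱 (𝓝 0) ∧
        ∀ᶠ i in (𝒱 : Filter I), D.f (s i) ζ ≠ 0) ∧
      ∀ ζ ∈ ball (0 : ℂ) D.R, ∀ x : I → ℂ, Tendsto x 𝒱 (𝓝 ζ) →
        Tendsto (fun i => D.slope (s i) (x i)) 𝒱 (𝓝 ‖h ζ * (1 + ζ * conj ζ) - conj ζ‖) := by
  have hzR : ∀ᶠ i in (𝒱 : Filter I), z i ∈ ball (0 : ℂ) D.R :=
    hz (isOpen_ball.mem_nhds D.zero_mem)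
  have hcomp : ∀ i, s i ∈ D.T → ∀ ζ ∈ ball (0 : ℂ) D.R, ∀ ζ' ∈ ball (0 : ℂ) D.R,
      ‖D.f (s i) ζ‖ ≤ D.C * ‖D.f (s i) ζ'‖ := by
    intro i hi ζ hζ ζ' hζ'
    have := D.comp _ hi t ht ζ hζ ζ' hζ'
    rwa [h0 ζ hζ, h0 ζ' hζ', sub_zero, sub_zero] at this
  have hne : ∀ᶠ i in (𝒱 : Filter I), ∀ ζ ∈ ball (0 : ℂ) D.R, D.f (s i) ζ ≠ 0 := by
    filter_upwards [hs, hzR, hw0] with i h1 h2 h3 ζ hζ h4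
    have := hcomp i h1 _ h2 ζ hζ
    rw [h4, norm_zero, mul_zero] at this
    exact h3 (norm_le_zero_iff.1 this)
  have htend : ∀ ζ ∈ ball (0 : ℂ) D.R, Tendsto (fun i => D.f (s i) ζ) 𝒱 (𝓝 0) := by
    intro ζ hζ
    have h1 := hw.norm.const_mul D.C
    rw [norm_zero, mul_zero] at h1
    refine squeeze_zero_norm' ?_ h1
    filter_upwards [hs, hzR] with i h2 h3 using hcomp i h2 ζ hζ _ h3
  set F : I → ℂ → ℂ := fun i ζ => D.f (s i) ζ / D.f (s i) 0 with hF
  have hFd : ∀ᶠ i in (𝒱 : Filter I), DifferentiableOn ℂ (F i) (ball 0 D.R) := by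
    filter_upwards [hs] with i h1 using (D.hol _ h1).div_const _
  have hFb : ∀ᶠ i in (𝒱 : Filter I), ∀ ζ ∈ ball (0 : ℂ) D.R, ‖F i ζ‖ ≤ D.C := by
    filter_upwards [hs, hne] with i h1 h2 ζ hζ
    rw [hF, norm_div, div_le_iff₀ (norm_pos_iff.2 (h2 0 D.zero_mem))]
    exact hcomp i h1 ζ hζ 0 D.zero_mem
  obtain ⟨G, hG, hGd⟩ := exists_tendstoLocallyUniformlyOn_of_bounded 𝒱 hFd hFb
  -- Comparison with the zero graph gives 1 ≤ C |F_i(ζ)|, which survives in the limit. The required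
  -- function is G'/G.
  have hG0 : ∀ ζ ∈ ball (0 : ℂ) D.R, G ζ ≠ 0 := by
    intro ζ hζ hzero
    have h1 := (hG.tendsto_at hζ).norm.const_mul D.C
    rw [hzero, norm_zero, mul_zero] at h1
    have h2 : (1 : ℝ) ≤ 0 := by
      refine ge_of_tendsto h1 ?_
      filter_upwards [hs, hne] with i h3 h4
      rw [hF, norm_div, mul_div_assoc', le_div_iff₀ (norm_pos_iff.2 (h4 0 D.zero_mem)), one_mul]
      exact hcomp i h3 0 D.zero_mem ζ hζ
    linarith
  have hGd' : DifferentiableOn ℂ (deriv G) (ball 0 D.R) := hGd.deriv isOpen_ball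
  refine ⟨fun ζ => deriv G ζ / G ζ, hGd'.div hGd hG0, fun ζ hζ =>
    ⟨htend ζ hζ, hne.mono fun i hi => hi ζ hζ⟩, fun ζ hζ x hx => ?_⟩
  have hx' : Tendsto x 𝒱 (𝓝[ball (0 : ℂ) D.R] ζ) :=
    tendsto_nhdsWithin_iff.2 ⟨hx, hx (isOpen_ball.mem_nhds hζ)⟩
  have h1 : Tendsto (fun i => F i (x i)) 𝒱 (𝓝 (G ζ)) :=
    hG.tendsto_comp (hGd.continuousOn ζ hζ) hζ hx'
  have h2 : Tendsto (fun i => deriv (F i) (x i)) 𝒱 (𝓝 (deriv G ζ)) :=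
    (hG.deriv hFd isOpen_ball).tendsto_comp (hGd'.continuousOn ζ hζ) hζ hx'
  have hcx : Tendsto (fun i => conj (x i)) 𝒱 (𝓝 (conj ζ)) :=
    Complex.continuous_conj.continuousAt.tendsto.comp hx
  have h3 := (((h2.div h1 (hG0 ζ hζ)).mul ((hx.mul hcx).const_add 1)).sub hcx).norm
  refine h3.congr' ?_
  filter_upwards [hs, hne, hx (isOpen_ball.mem_nhds hζ)] with i h4 h5 h6
  have h7 : deriv (F i) (x i) = deriv (D.f (s i)) (x i) / D.f (s i) 0 := by
    simp only [hF, deriv_div_const]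
  rw [slope, Pi.div_apply, h7]
  simp only [hF]
  rw [div_div_div_cancel_right₀ (h5 0 D.zero_mem)]

end GraphChart

namespace C1Lamination

variable {X : Set P2} {ι : Type*} (ℒ : C1Lamination X ι)

/-- A lamination by Riemann surfaces one of whose leaves contains a germ of a line is contained in
this line. -/
theorem subset_line (hX : IsCompact X) (L : (Fin 3 → ℂ) ≃L[ℂ] (Fin 3 → ℂ))
    (hne : (ℒ.lineSet (lastCoord L)).Nonempty) {v : Fin 3 → ℂ} (hvX : P2.proj v ∈ X) :
    lastCoord L v = 0 := by
  by_contra hlv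
  have hXc := hX.isClosed
  obtain ⟨v₀, hv₀, hlv₀, hcl⟩ := exists_mem_closure_of_line ℒ hX hlv hvX
  set A : Set (GraphChart ℒ × ℂ × ℂ) := {i | (∃ y : ℂ × ℂ, y.1 * conj y.1 + y.2 * conj y.2 = 1 ∧
    ∀ u, i.1.basis u = L (rot y u)) ∧ i.2.1 ∈ i.1.T ∧ i.2.2 ∈ ball (0 : ℂ) i.1.R ∧
    i.1.f i.2.1 i.2.2 ≠ 0} with hA
  set size : GraphChart ℒ × ℂ × ℂ → ℂ := fun i => i.1.f i.2.1 i.2.2 with hsize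
  -- Points of graphs off the line in all rotated charts, with height tending to zero. The charts
  -- are not centred at one place, so the extremal slope is sought over the whole line.
  set F : Filter (GraphChart ℒ × ℂ × ℂ) := comap size (𝓝 0) ⊓ 𝓟 A with hF
  have hFne : F.NeBot := by
    rw [hF, inf_principal_neBot_iff]
    intro U hU
    obtain ⟨V, hV, hVU⟩ := mem_comap.1 hU
    obtain ⟨y, hy, hyv⟩ := exists_unit_rep L hv₀ hlv₀
    obtain ⟨D, hD, hD0⟩ := ℒ.exists_rot_chart hXc L hne hy
    have hW : ball (0 : ℂ) D.R ×ˢ (ball (0 : ℂ) D.ρ ∩ V) ∈ 𝓝 ((0, 0) : ℂ × ℂ) :=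
      prod_mem_nhds (ball_mem_nhds _ D.R_pos) (inter_mem (ball_mem_nhds _ D.ρ_pos) hV)
    have hW' := affPt_image_mem_nhds D.basis hW
    rw [hD0, hyv] at hW'
    obtain ⟨_, ⟨⟨ζ, w⟩, ⟨hζ, hw, hwV⟩, rfl⟩, hxX, u, hu, hux⟩ := mem_closure_iff_nhds.1 hcl _ hW'
    simp only at hζ hw hwV hxX hux
    obtain ⟨s, hs, hfs⟩ := D.cover ζ hζ w hw hxX
    refine ⟨(D, s, ζ), hVU (by simpa [hsize, hfs] using hwV), ⟨y, hy, hD⟩, hs, hζ, ?_⟩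
    simp only [hfs]
    rintro rfl
    have hu0 : u ≠ 0 := by rintro rfl; exact hu (map_zero _)
    obtain ⟨c, hc, hcv⟩ := (P2.proj_eq_proj_iff hu0 (affVec_ne_zero D.basis (ζ, 0))).1 hux
    apply hu
    rw [hcv, map_smul, hD, lastCoord_apply]
    simp [rot]
  -- Extended values make the limsup meaningful before it is known to be finite. The ultrafilter
  -- below realizes it.
  set Φ : GraphChart ℒ × ℂ × ℂ → ENNReal := fun i => ENNReal.ofReal (i.1.slope i.2.1 i.2.2)
  have hclus : MapClusterPt (limsup Φ F) F Φ := ClusterPt.limsSup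
  obtain ⟨𝒱, h𝒱F, h𝒱⟩ := mapClusterPt_iff_ultrafilter.1 hclus
  have h𝒱A : ∀ᶠ i in (𝒱 : Filter _), i ∈ A := h𝒱F (mem_inf_of_right (mem_principal_self A))
  have h𝒱s : Tendsto size 𝒱 (𝓝 0) := tendsto_comap.mono_left (h𝒱F.trans inf_le_left)
  -- the limit point
  set p : GraphChart ℒ × ℂ × ℂ → (Fin 3 → ℂ) := fun i => L.symm (i.1.basis (i.1.vec i.2.1 i.2.2))
    with hp
  have hpA : ∀ i ∈ A, ‖p i‖ ≤ 2 ∧ p i 2 = size i ∧ 1 ≤ ‖p i 0‖ ^ 2 + ‖p i 1‖ ^ 2 := by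
    rintro ⟨D, s, ζ⟩ ⟨⟨y, hy, hD⟩, hs, hζ, -⟩
    simp only at hD hs hζ
    have hpe : p (D, s, ζ) = rot y (D.vec s ζ) := by simp only [hp, hD, L.symm_apply_apply]
    have hζ1 : ‖ζ‖ < 1 := by
      have : ‖ζ‖ < D.R := by simpa using hζ
      exact this.trans_le D.R_le
    have h1 : ‖p (D, s, ζ) 0‖ ^ 2 + ‖p (D, s, ζ) 1‖ ^ 2 = 1 + ‖ζ‖ ^ 2 := by
      have h2 : ((‖p (D, s, ζ) 0‖ ^ 2 + ‖p (D, s, ζ) 1‖ ^ 2 : ℝ) : ℂ) =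
          ((1 + ‖ζ‖ ^ 2 : ℝ) : ℂ) := by
        push_cast
        rw [← Complex.mul_conj', ← Complex.mul_conj', ← Complex.mul_conj', hpe]
        simp only [rot, GraphChart.vec_zero, GraphChart.vec_one, Matrix.cons_val_zero,
          Matrix.cons_val_one, map_sub, map_add, map_mul, Complex.conj_conj, mul_one]
        linear_combination (1 + ζ * conj ζ) * hy
      exact_mod_cast h2
    have h2 : p (D, s, ζ) 2 = size (D, s, ζ) := by rw [hpe]; rfl
    refine ⟨?_, h2, ?_⟩
    · rw [pi_norm_le_iff_of_nonneg zero_le_two]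
      have h3 : ‖ζ‖ ^ 2 ≤ 1 := pow_le_one₀ (norm_nonneg _) hζ1.le
      intro k
      fin_cases k
      · have h4 : ‖p (D, s, ζ) 0‖ ^ 2 ≤ 2 ^ 2 := by
          have := sq_nonneg ‖p (D, s, ζ) 1‖
          linarith
        exact (pow_le_pow_iff_left₀ (norm_nonneg _) zero_le_two two_ne_zero).1 h4
      · have h4 : ‖p (D, s, ζ) 1‖ ^ 2 ≤ 2 ^ 2 := by
          have := sq_nonneg ‖p (D, s, ζ) 0‖
          linarith
        exact (pow_le_pow_iff_left₀ (norm_nonneg _) zero_le_two two_ne_zero).1 h4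
      · change ‖p (D, s, ζ) 2‖ ≤ 2
        rw [h2]
        exact (D.norm_le s hs ζ hζ).trans one_le_two
    · rw [h1]
      have := sq_nonneg ‖ζ‖
      linarith
  obtain ⟨q, -, hq⟩ := (isCompact_closedBall (0 : Fin 3 → ℂ) 2).ultrafilter_le_nhds (𝒱.map p) (by
    simp only [Ultrafilter.coe_map, le_principal_iff, mem_map]
    filter_upwards [h𝒱A] with i hi
    simpa using (hpA i hi).1)
  have hpq : Tendsto p 𝒱 (𝓝 q) := hq
  have hpk : ∀ k, Tendsto (fun i => p i k) 𝒱 (𝓝 (q k)) := fun k =>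
    (continuous_apply k).continuousAt.tendsto.comp hpq
  have hq2 : q 2 = 0 := by
    refine tendsto_nhds_unique (hpk 2) (h𝒱s.congr' ?_)
    filter_upwards [h𝒱A] with i hi using (hpA i hi).2.1.symm
  have hq0 : q ≠ 0 := by
    rintro rfl
    have h1 := ((hpk 0).norm.pow 2).add ((hpk 1).norm.pow 2)
    have h2 := ge_of_tendsto h1 (h𝒱A.mono fun i hi => (hpA i hi).2.2)
    norm_num at h2
  have hLq0 : L q ≠ 0 := by simpa using hq0
  have hLq2 : lastCoord L (L q) = 0 := by rw [lastCoord_apply, hq2]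
  obtain ⟨y, hy, hyv⟩ := exists_unit_rep L hLq0 hLq2
  -- The extremal slopes are moved to a rotated chart centred at their limit point, where the
  -- limiting slope at the origin is |h(0)|.
  obtain ⟨D, hD, hD0⟩ := ℒ.exists_rot_chart hXc L hne hy
  rw [hyv] at hD0
  obtain ⟨t, ht, hin, hft⟩ := ℒ.exists_inLine_of_mem_closure (lastCoord_ne_zero L) hLq0 hLq2
    (subset_closure (ℒ.mem_lineSet hXc L hne hLq0 hLq2)) D hD0
  have hf0 : ∀ ζ ∈ ball (0 : ℂ) D.R, D.f t ζ = 0 := by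
    intro ζ hζ
    have := hin ζ hζ
    rw [hD, lastCoord_apply] at this
    exact this
  -- transfer to the chart at the limit point
  have hx : Tendsto (fun i : GraphChart ℒ × ℂ × ℂ => i.1.pt i.2.1 i.2.2) 𝒱 (𝓝 (affPt D.basis (0, 0))) := by
    rw [hD0]
    have h1 : Tendsto (fun i => P2.proj (L (p i))) 𝒱 (𝓝 (P2.proj (L q))) :=
      (P2.continuousAt_proj hLq0).tendsto.comp (L.continuous.continuousAt.tendsto.comp hpq)
    refine h1.congr fun i => ?_
    simp only [hp, L.apply_symm_apply]
    rfl
  have hex : ∀ i : GraphChart ℒ × ℂ × ℂ, ∃ a : ℂ × ℂ,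
      i.1.pt i.2.1 i.2.2 ∈ range (affPt D.basis) → affPt D.basis a = i.1.pt i.2.1 i.2.2 := by
    intro i
    by_cases h : i.1.pt i.2.1 i.2.2 ∈ range (affPt D.basis)
    · exact ⟨h.choose, fun _ => h.choose_spec⟩
    · exact ⟨0, fun h' => (h h').elim⟩
  choose a ha using hex
  have hax : ∀ᶠ i in (𝒱 : Filter _), affPt D.basis (a i) = i.1.pt i.2.1 i.2.2 :=
    Eventually.mono (hx ((isOpenEmbedding_affPt D.basis).isOpen_range.mem_nhds ⟨_, rfl⟩)) ha
  have ha0 : Tendsto a 𝒱 (𝓝 (0, 0)) :=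
    (isOpenEmbedding_affPt D.basis).isInducing.tendsto_nhds_iff.2
      (hx.congr' (hax.mono fun i hi => hi.symm))
  have haW := ha0 (prod_mem_nhds (ball_mem_nhds (0 : ℂ) D.R_pos) (ball_mem_nhds (0 : ℂ) D.ρ_pos))
  have hex2 : ∀ i : GraphChart ℒ × ℂ × ℂ, ∃ s ∈ D.T,
      (i ∈ A ∧ affPt D.basis (a i) = i.1.pt i.2.1 i.2.2 ∧
        a i ∈ ball (0 : ℂ) D.R ×ˢ ball (0 : ℂ) D.ρ) → D.f s (a i).1 = (a i).2 := by
    intro i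
    by_cases h : i ∈ A ∧ affPt D.basis (a i) = i.1.pt i.2.1 i.2.2 ∧
        a i ∈ ball (0 : ℂ) D.R ×ˢ ball (0 : ℂ) D.ρ
    · obtain ⟨s, hs, hfs⟩ := D.cover (a i).1 h.2.2.1 (a i).2 h.2.2.2
        (by rw [Prod.mk.eta, h.2.1]; exact i.1.pt_mem h.1.2.1 h.1.2.2.1)
      exact ⟨s, hs, fun _ => hfs⟩
    · exact ⟨t, ht, fun h' => (h h').elim⟩
  choose s hs hfs using hex2
  have hgood : ∀ᶠ i in (𝒱 : Filter _), D.f (s i) (a i).1 = (a i).2 ∧ D.f (s i) (a i).1 ≠ 0 ∧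
      i.1.slope i.2.1 i.2.2 = D.slope (s i) (a i).1 := by
    filter_upwards [h𝒱A, hax, haW] with i h1 h2 h3
    have h4 := hfs i ⟨h1, h2, h3⟩
    have hpt : i.1.pt i.2.1 i.2.2 = D.pt (s i) (a i).1 := by
      rw [← h2, GraphChart.pt, h4, Prod.mk.eta]
    obtain ⟨⟨y', hy', hDi⟩, h5, h6, h7⟩ := h1
    refine ⟨h4, ?_, GraphChart.slope_transfer hy' hy hDi hD h5 (hs i) h6 h3.1
      (by rw [h4]; exact h3.2) hpt h7⟩
    intro h8
    obtain ⟨c, hc, hcv⟩ := (P2.proj_eq_proj_iff (affVec_ne_zero i.1.basis _)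
      (affVec_ne_zero D.basis _)).1 hpt
    have h9 := congrArg (lastCoord L) hcv
    rw [map_smul, hDi, hD, lastCoord_apply, lastCoord_apply] at h9
    apply h7
    have h10 : i.1.f i.2.1 i.2.2 = c * D.f (s i) (a i).1 := h9
    rw [h10, h8, mul_zero]
  have hz : Tendsto (fun i => (a i).1) 𝒱 (𝓝 0) := continuousAt_fst.tendsto.comp ha0
  have hw : Tendsto (fun i => D.f (s i) (a i).1) 𝒱 (𝓝 0) := by
    have h1 : Tendsto (fun i => (a i).2) 𝒱 (𝓝 0) := continuousAt_snd.tendsto.comp ha0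
    exact h1.congr' (hgood.mono fun i hi => hi.1.symm)
  obtain ⟨h, hh, hsmall, hlim⟩ := D.exists_slope_limit 𝒱 ht hf0 (Eventually.of_forall hs) hz hw
    (hgood.mono fun i hi => hi.2.1)
  have hmax : limsup Φ F = ENNReal.ofReal ‖h 0‖ := by
    have h1 := ENNReal.tendsto_ofReal (hlim 0 D.zero_mem _ hz)
    simp only [map_zero, mul_zero, add_zero, mul_one, sub_zero] at h1
    refine tendsto_nhds_unique h𝒱 (h1.congr' ?_)
    filter_upwards [hgood] with i hi
    simp only [Φ, hi.2.2]
  refine false_of_norm_logDeriv_le D.R_pos hh fun ζ hζ => ?_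
  have h1 := ENNReal.tendsto_ofReal (hlim ζ hζ _ tendsto_const_nhds)
  -- The same graphs observed over a fixed ζ still compete in the limsup, so the slope of the limit
  -- at ζ is at most its slope at 0.
  have hj : Tendsto (fun i => ((D, s i, ζ) : GraphChart ℒ × ℂ × ℂ)) 𝒱 F := by
    refine tendsto_inf.2 ⟨tendsto_comap_iff.2 (hsmall ζ hζ).1, tendsto_principal.2 ?_⟩
    filter_upwards [(hsmall ζ hζ).2] with i hi
    exact ⟨⟨y, hy, hD⟩, hs i, hζ, hi⟩
  have h2 : limsup Φ (map (fun i => ((D, s i, ζ) : GraphChart ℒ × ℂ × ℂ)) 𝒱) ≤ limsup Φ F :=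
    limsup_le_limsup_of_le hj
  have h3 : Tendsto Φ (map (fun i => ((D, s i, ζ) : GraphChart ℒ × ℂ × ℂ)) 𝒱)
      (𝓝 (ENNReal.ofReal ‖h ζ * (1 + ζ * conj ζ) - conj ζ‖)) := tendsto_map'_iff.2 h1
  rw [h3.limsup_eq, hmax] at h2
  exact (ENNReal.ofReal_le_ofReal_iff (norm_nonneg _)).1 h2

end C1Lamination

namespace C1Lamination

variable {X : Set P2} {ι : Type*} (ℒ : C1Lamination X ι)

lemma exists_lastCoord_eq {a b : ℂ} (hab : a ≠ 0 ∨ b ≠ 0) :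
    ∃ L : (Fin 3 → ℂ) ≃L[ℂ] (Fin 3 → ℂ), ∀ v, lastCoord L v = a * v 0 + b * v 2 := by
  rcases hab with h | h
  · let e : (Fin 3 → ℂ) ≃ₗ[ℂ] (Fin 3 → ℂ) :=
      { toFun := fun v => ![v 1, v 2, a * v 0 + b * v 2]
        invFun := fun u => ![(u 2 - b * u 1) / a, u 0, u 1]
        map_add' := fun u v => by ext i; fin_cases i <;> simp; ring
        map_smul' := fun c v => by ext i; fin_cases i <;> simp; ring
        left_inv := fun v => by ext i; fin_cases i <;> simp [h]
        right_inv := fun v => by ext i; fin_cases i <;> simp; field_simp; ring }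
    exact ⟨e.toContinuousLinearEquiv.symm, fun v => rfl⟩
  · let e : (Fin 3 → ℂ) ≃ₗ[ℂ] (Fin 3 → ℂ) :=
      { toFun := fun v => ![v 0, v 1, a * v 0 + b * v 2]
        invFun := fun u => ![u 0, u 1, (u 2 - a * u 0) / b]
        map_add' := fun u v => by ext i; fin_cases i <;> simp; ring
        map_smul' := fun c v => by ext i; fin_cases i <;> simp; ring
        left_inv := fun v => by ext i; fin_cases i <;> simp [h]
        right_inv := fun v => by ext i; fin_cases i <;> simp; field_simp; ring }
    exact ⟨e.toContinuousLinearEquiv.symm, fun v => rfl⟩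

/-- A lamination with a leaf tangent at `[0 : 0 : 1]` to the field of the shears has no degenerate
leaf. -/
theorem degenerateSet_eq_empty (hX : IsCompact X) {K : Set P2} (hK : K ⊆ X)
    (hp : IsTangentGraphAtOrigin K) : ℒ.degenerateSet = ∅ := by
  by_contra hne
  obtain ⟨a, b, hab, D, t, ht, ⟨ζ, hζ, hw⟩, hl⟩ :=
    ℒ.exists_line_of_degenerate hX (nonempty_iff_ne_empty.2 hne)
  obtain ⟨L, hL⟩ := exists_lastCoord_eq hab
  have hX' : ∀ v : Fin 3 → ℂ, P2.proj v ∈ X → a * v 0 + b * v 2 = 0 := by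
    intro v hv
    rw [← hL]
    refine ℒ.subset_line hX L ⟨_, D, t, ht, ζ, hζ, hw, fun ξ hξ => ?_, rfl⟩ hv
    rw [hL]
    exact hl ξ hξ
  obtain ⟨f, hf, hf0, -, hfK⟩ := hp
  have hc : ContinuousAt (fun z : ℂ => (z, f z)) 0 := continuousAt_id.prodMk hf.continuousAt
  have h0 : ((fun z : ℂ => (z, f z)) 0) = (0, 0) := by simp [hf0]
  have hev : ∀ᶠ z : ℂ in 𝓝 0, a * z + b = 0 := by
    have := hc.eventually (p := fun x : ℂ × ℂ => P2.proj ![x.1, x.2, 1] ∈ K ↔ x.2 = f x.1)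
      (by rw [h0]; exact hfK)
    filter_upwards [this] with z hz
    have := hX' _ (hK (hz.2 rfl))
    simpa using this
  have hb : b = 0 := by simpa using hev.self_of_nhds
  obtain ⟨z, hz, hz0⟩ := ((hev.filter_mono nhdsWithin_le_nhds).and
    (self_mem_nhdsWithin (s := ({0}ᶜ : Set ℂ)) (a := 0))).exists
  have ha : a = 0 := by
    rw [hb, add_zero] at hz
    exact (mul_eq_zero.1 hz).resolve_right hz0
  exact hab.elim (fun h => h ha) fun h => h hb

end C1Lamination

/-! ### Uniform zero count near a nondegenerate graph -/

namespace GraphChart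

variable {X : Set P2} {ι : Type*} {ℒ : C1Lamination X ι} (D : GraphChart ℒ)

lemma norm_div_sub_div_le {u p : Fin 3 → ℂ} (hp : ‖p‖ ≤ 2)
    (hu0 : 1 / 2 ≤ ‖u 0‖) (hp0 : 1 / 2 ≤ ‖p 0‖) (k : Fin 3) :
    ‖u k / u 0 - p k / p 0‖ ≤ 16 * ‖u - p‖ := by
  have hu0' : u 0 ≠ 0 := norm_pos_iff.1 (by linarith)
  have hp0' : p 0 ≠ 0 := norm_pos_iff.1 (by linarith)
  have h1 : u k / u 0 - p k / p 0 = ((u k - p k) * p 0 - p k * (u 0 - p 0)) / (u 0 * p 0) := by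
    field_simp; ring
  have h2 : ∀ j, ‖u j - p j‖ ≤ ‖u - p‖ := fun j => norm_le_pi_norm (u - p) j
  have h3 : ‖(u k - p k) * p 0 - p k * (u 0 - p 0)‖ ≤ 4 * ‖u - p‖ := by
    refine (_root_.norm_sub_le _ _).trans ?_
    rw [norm_mul, norm_mul]
    have h4 : ‖u k - p k‖ * ‖p 0‖ ≤ ‖u - p‖ * 2 :=
      mul_le_mul (h2 k) ((norm_le_pi_norm p 0).trans hp) (norm_nonneg _) (norm_nonneg _)
    have h5 : ‖p k‖ * ‖u 0 - p 0‖ ≤ 2 * ‖u - p‖ :=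
      mul_le_mul ((norm_le_pi_norm p k).trans hp) (h2 0) (norm_nonneg _) zero_le_two
    linarith
  have h6 : 1 / 4 ≤ ‖u 0‖ * ‖p 0‖ := by
    have := mul_le_mul hu0 hp0 (by norm_num) (norm_nonneg _)
    linarith
  rw [h1, norm_div, norm_mul, div_le_iff₀ (by linarith)]
  have h7 := mul_le_mul_of_nonneg_left h6 (by positivity : (0 : ℝ) ≤ 16 * ‖u - p‖)
  linarith

/-- The Lipschitz constant of the gap as a function of the linear map. -/
def gapConst : ℝ := 16 * (1 + 4 / D.R)

lemma gapConst_pos : 0 < D.gapConst := by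
  have := D.R_pos
  unfold gapConst
  positivity

lemma norm_defect_sub_le {t : ℂ} (ht : t ∈ D.T) {u p : Fin 3 → ℂ} (hp : ‖p‖ ≤ 2)
    (hu0 : 1 / 2 ≤ ‖u 0‖) (hp0 : 1 / 2 ≤ ‖p 0‖) (hu1 : ‖u 1 / u 0‖ < 3 * D.R / 4)
    (hp1 : ‖p 1 / p 0‖ < 3 * D.R / 4) :
    ‖defect (D.f t) u - defect (D.f t) p‖ ≤ D.gapConst * ‖u - p‖ := by
  have hR := D.R_pos
  have h1 := D.norm_sub_le ht (s := 3 * D.R / 4) (by linarith) (a := u 1 / u 0) (b := p 1 / p 0)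
    (by simpa using hu1) (by simpa using hp1)
  have h2 : (1 / (D.R - 3 * D.R / 4)) = 4 / D.R := by field_simp; norm_num
  rw [h2] at h1
  have h3 := mul_le_mul_of_nonneg_left (norm_div_sub_div_le hp hu0 hp0 1)
    (by positivity : 0 ≤ 4 / D.R)
  have h4 := norm_div_sub_div_le hp hu0 hp0 2
  have h5 : defect (D.f t) u - defect (D.f t) p = (u 2 / u 0 - p 2 / p 0) -
    (D.f t (u 1 / u 0) - D.f t (p 1 / p 0)) := by simp only [defect]; ring
  rw [h5]
  refine (_root_.norm_sub_le _ _).trans ?_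
  unfold gapConst
  linarith

/-- A linear map close to the identity maps the graphs over the half disc into the domain of the
chart. -/
lemma bounds_of_norm_sub_id_le {N : (Fin 3 → ℂ) →L[ℂ] (Fin 3 → ℂ)}
    (hN : ‖N - ContinuousLinearMap.id ℂ _‖ ≤ D.R / 16) {t ζ : ℂ} (ht : t ∈ D.T)
    (hζ : ζ ∈ ball (0 : ℂ) (D.R / 2)) : ‖N (D.vec t ζ)‖ ≤ 2 ∧ 1 / 2 ≤ ‖N (D.vec t ζ) 0‖ ∧
      ‖N (D.vec t ζ) 1 / N (D.vec t ζ) 0‖ < 3 * D.R / 4 := by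
  have hR := D.R_pos
  have hR1 := D.R_le
  have hζ' : ‖ζ‖ < D.R / 2 := by simpa using hζ
  have hv := D.norm_vec_le ht (ball_subset_ball (by linarith) hζ)
  have h1 : ‖N (D.vec t ζ) - D.vec t ζ‖ ≤ D.R / 16 := by
    have := (N - ContinuousLinearMap.id ℂ _).le_of_opNorm_le_of_le hN hv
    rwa [mul_one] at this
  have h2 : ∀ k, ‖N (D.vec t ζ) k - D.vec t ζ k‖ ≤ D.R / 16 := fun k =>
    (norm_le_pi_norm (N (D.vec t ζ) - D.vec t ζ) k).trans h1
  have h0 : 1 - D.R / 16 ≤ ‖N (D.vec t ζ) 0‖ := by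
    have h3 := h2 0
    rw [vec_zero, norm_sub_rev] at h3
    have h4 := norm_sub_norm_le (1 : ℂ) (N (D.vec t ζ) 0)
    rw [norm_one] at h4
    linarith
  have h11 : ‖N (D.vec t ζ) 1‖ < D.R / 2 + D.R / 16 := by
    have h3 := h2 1
    rw [vec_one] at h3
    have h4 := norm_sub_norm_le (N (D.vec t ζ) 1) ζ
    linarith
  refine ⟨?_, by linarith, ?_⟩
  · have h4 := norm_sub_norm_le (N (D.vec t ζ)) (D.vec t ζ)
    linarith
  -- Because R ≤ 1, R/2 + R/16 is less than (3R/4)(1 − R/16).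
  · rw [norm_div, div_lt_iff₀ (by linarith)]
    have := mul_le_mul_of_nonneg_left h0 (by positivity : 0 ≤ 3 * D.R / 4)
    nlinarith

lemma differentiableOn_gap {N : (Fin 3 → ℂ) →L[ℂ] (Fin 3 → ℂ)}
    (hN : ‖N - ContinuousLinearMap.id ℂ _‖ ≤ D.R / 16) {t₁ t₂ : ℂ} (ht₁ : t₁ ∈ D.T)
    (ht₂ : t₂ ∈ D.T) : DifferentiableOn ℂ (D.gap N t₁ t₂) (ball 0 (D.R / 2)) := by
  have hR := D.R_pos
  have hk : ∀ k, DifferentiableOn ℂ (fun ζ => N (D.vec t₁ ζ) k) (ball 0 (D.R / 2)) := fun k =>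
    differentiableOn_pi.1 (N.differentiable.comp_differentiableOn
      ((D.differentiableOn_vec ht₁).mono (ball_subset_ball (by linarith)))) k
  have hne : ∀ ζ ∈ ball (0 : ℂ) (D.R / 2), N (D.vec t₁ ζ) 0 ≠ 0 := fun ζ hζ =>
    norm_pos_iff.1 (by linarith [(D.bounds_of_norm_sub_id_le hN ht₁ hζ).2.1])
  refine ((hk 2).div (hk 0) hne).sub ((D.hol t₂ ht₂).comp ((hk 1).div (hk 0) hne) fun ζ hζ => ?_)
  have := (D.bounds_of_norm_sub_id_le hN ht₁ hζ).2.2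
  rw [mem_ball_zero_iff]
  exact this.trans (by linarith)

/-- Uniform bound for the number of intersection points of a graph with a small shear of another
graph, near a nondegenerate graph. -/
theorem exists_bound_sum_order_gap {t₀ : ℂ} (hdeg : ¬ D.Degenerate t₀) :
    ∃ (n : ℕ) (c κ : ℝ), 0 < c ∧ 0 < κ ∧ ∀ ε : ℂ, ε ≠ 0 → ‖ε‖ < c →
      ∀ N : (Fin 3 → ℂ) →L[ℂ] (Fin 3 → ℂ), ‖N - D.step ε‖ ≤ κ * ‖ε‖ →
      ∀ t₁ ∈ D.T, ∀ t₂ ∈ D.T, ‖D.f t₁ 0 - D.f t₀ 0‖ < c → ‖D.f t₂ 0 - D.f t₀ 0‖ < c →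
      ∀ Z : Finset ℂ, (∀ a ∈ Z, a ∈ ball (0 : ℂ) (D.R / 8)) →
        ∑ a ∈ Z, analyticOrderAt (D.gap N t₁ t₂) a ≤ n := by
  have hR := D.R_pos
  have hG := D.gapConst_pos
  unfold Degenerate at hdeg
  push Not at hdeg
  obtain ⟨c, hc, hdeg⟩ := hdeg
  -- Passing from `step ε` to `N` changes the gap by at most gapConst·κ|ε| ≤ (c/2)·spread, so half
  -- of the lower bound survives.
  set κ := min 1 (c / (2 * D.gapConst))
  have hκ : 0 < κ := lt_min one_pos (by positivity)
  set E := ‖D.field‖ + 1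
  have hE : 0 < E := by positivity
  set K := |D.C| + D.gapConst * E
  obtain ⟨n, hn⟩ := exists_bound_sum_analyticOrderAt (C := K) (c := c / 2) (by positivity)
  refine ⟨n, min c (D.R / (16 * E)), κ, lt_min hc (by positivity), hκ, ?_⟩
  intro ε hε0 hε N hN t₁ ht₁ t₂ ht₂ h₁ h₂ Z hZ
  have hεc := hε.trans_le (min_le_left _ _)
  have hεE := hε.trans_le (min_le_right _ _)
  have hsp := D.spread_pos hε0 t₁ t₂
  have hεpos := norm_pos_iff.2 hε0
  have hNE : ‖N - ContinuousLinearMap.id ℂ _‖ ≤ E * ‖ε‖ := by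
    have h3 : N - ContinuousLinearMap.id ℂ _ = (N - D.step ε) - ε • D.field := by
      rw [step]; abel
    rw [h3]
    refine (_root_.norm_sub_le _ _).trans ?_
    rw [norm_smul]
    have : κ * ‖ε‖ ≤ 1 * ‖ε‖ := mul_le_mul_of_nonneg_right (min_le_left _ _) hεpos.le
    simp only [E]
    linarith
  have hSE : ‖D.step ε - ContinuousLinearMap.id ℂ _‖ ≤ E * ‖ε‖ := by
    have h3 : D.step ε - ContinuousLinearMap.id ℂ _ = -(ε • D.field) := by
      rw [step]; abel
    rw [h3, norm_neg, norm_smul]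
    simp only [E]
    linarith
  have hER : E * ‖ε‖ ≤ D.R / 16 := by
    rw [lt_div_iff₀ (by positivity)] at hεE
    linarith
  have hid : ‖ContinuousLinearMap.id ℂ (Fin 3 → ℂ) - ContinuousLinearMap.id ℂ _‖ ≤ D.R / 16 := by
    rw [sub_self, norm_zero]; positivity
  -- The zero count is used on radius R/2, and a quarter of it is the R/8 in `Degenerate`.
  refine hn (D.gap N t₁ t₂) (D.R / 2) (D.spread ε t₁ t₂) hsp
    (D.differentiableOn_gap (hNE.trans hER) ht₁ ht₂) ?_ ?_ Z ?_
  · intro ζ hζ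
    have hζR : ζ ∈ ball (0 : ℂ) D.R := ball_subset_ball (by linarith) hζ
    obtain ⟨a1, a2, a3⟩ := D.bounds_of_norm_sub_id_le (hNE.trans hER) ht₁ hζ
    obtain ⟨b1, b2, b3⟩ := D.bounds_of_norm_sub_id_le hid ht₁ hζ
    have h3 := D.norm_defect_sub_le ht₂ b1 a2 b2 a3 b3
    have h4 : ‖N (D.vec t₁ ζ) - ContinuousLinearMap.id ℂ _ (D.vec t₁ ζ)‖ ≤ E * ‖ε‖ := by
      have := (N - ContinuousLinearMap.id ℂ _).le_of_opNorm_le_of_le hNE (D.norm_vec_le ht₁ hζR)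
      rwa [mul_one] at this
    have h5 := mul_le_mul_of_nonneg_left h4 hG.le
    have h6 : defect (D.f t₂) (ContinuousLinearMap.id ℂ _ (D.vec t₁ ζ)) =
        D.f t₁ ζ - D.f t₂ ζ := by simp [defect]
    rw [h6] at h3
    have h7 := D.comp t₁ ht₁ t₂ ht₂ ζ hζR 0 D.zero_mem
    have h8 : D.C * ‖D.f t₁ 0 - D.f t₂ 0‖ ≤ |D.C| * ‖D.f t₁ 0 - D.f t₂ 0‖ :=
      mul_le_mul_of_nonneg_right (le_abs_self _) (norm_nonneg _)
    have h9 := norm_add_le (D.gap N t₁ t₂ ζ - (D.f t₁ ζ - D.f t₂ ζ)) (D.f t₁ ζ - D.f t₂ ζ)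
    rw [sub_add_cancel] at h9
    have h10 : K * D.spread ε t₁ t₂ = |D.C| * ‖D.f t₁ 0 - D.f t₂ 0‖ + D.gapConst * (E * ‖ε‖) +
        (|D.C| * ‖ε‖ + D.gapConst * E * ‖D.f t₁ 0 - D.f t₂ 0‖) := by
      simp only [K, spread]; ring
    have h11 : 0 ≤ |D.C| * ‖ε‖ + D.gapConst * E * ‖D.f t₁ 0 - D.f t₂ 0‖ := by positivity
    have h12 : ‖D.gap N t₁ t₂ ζ - (D.f t₁ ζ - D.f t₂ ζ)‖ ≤ D.gapConst *
      ‖N (D.vec t₁ ζ) - ContinuousLinearMap.id ℂ _ (D.vec t₁ ζ)‖ := h3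
    linarith
  · obtain ⟨ζ, hζ, hgap⟩ := hdeg ε hε0 hεc t₁ ht₁ t₂ ht₂ (h₁.trans_le (min_le_left _ _))
      (h₂.trans_le (min_le_left _ _))
    have hζ2 : ζ ∈ ball (0 : ℂ) (D.R / 2) := ball_subset_ball (by linarith) hζ
    have hζR : ζ ∈ ball (0 : ℂ) D.R := ball_subset_ball (by linarith) hζ
    refine ⟨ζ, ?_, ?_⟩
    · rwa [show D.R / 2 / 4 = D.R / 8 by ring]
    obtain ⟨a1, a2, a3⟩ := D.bounds_of_norm_sub_id_le (hNE.trans hER) ht₁ hζ2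
    obtain ⟨b1, b2, b3⟩ := D.bounds_of_norm_sub_id_le (hSE.trans hER) ht₁ hζ2
    have h3 := D.norm_defect_sub_le ht₂ a1 b2 a2 b3 a3
    have h4 : ‖D.step ε (D.vec t₁ ζ) - N (D.vec t₁ ζ)‖ ≤ κ * ‖ε‖ := by
      have := (N - D.step ε).le_of_opNorm_le_of_le hN (D.norm_vec_le ht₁ hζR)
      rw [mul_one] at this
      rwa [norm_sub_rev]
    have h5 := mul_le_mul_of_nonneg_left h4 hG.le
    have h6 : D.gapConst * (κ * ‖ε‖) ≤ c / 2 * D.spread ε t₁ t₂ := by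
      have h7 : D.gapConst * κ ≤ c / 2 := by
        have := mul_le_mul_of_nonneg_left (min_le_right (1 : ℝ) (c / (2 * D.gapConst))) hG.le
        refine this.trans (le_of_eq ?_)
        field_simp
      have h8 : ‖ε‖ ≤ D.spread ε t₁ t₂ := by simp [spread]
      rw [← mul_assoc]
      exact mul_le_mul h7 h8 hεpos.le (by positivity)
    have h9 := norm_sub_norm_le (D.gap (D.step ε) t₁ t₂ ζ) (D.gap N t₁ t₂ ζ)
    have h10 : ‖D.gap (D.step ε) t₁ t₂ ζ - D.gap N t₁ t₂ ζ‖ ≤ D.gapConst *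
      ‖D.step ε (D.vec t₁ ζ) - N (D.vec t₁ ζ)‖ := h3
    linarith
  · intro a ha
    rw [show D.R / 2 / 4 = D.R / 8 by ring]
    exact hZ a ha

end GraphChart

/-! ### Intersection multiplicity as an order of vanishing of the gap -/

namespace GraphChart

variable {X : Set P2} {ι : Type*} {ℒ : C1Lamination X ι} (D : GraphChart ℒ)

/-- The map `A₂⁻¹ A₁` in the coordinates of the chart. -/
def relMap (A₁ A₂ : (Fin 3 → ℂ) ≃L[ℂ] (Fin 3 → ℂ)) : (Fin 3 → ℂ) ≃L[ℂ] (Fin 3 → ℂ) :=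
  (D.basis.trans A₁).trans (D.basis.trans A₂).symm

/-- The intersection multiplicity of the images of two plaques at a common point near the centre of
a chart is bounded by the order of vanishing of the gap of the corresponding graphs. -/
theorem intersectionMultiplicity_le {A₁ A₂ : (Fin 3 → ℂ) ≃L[ℂ] (Fin 3 → ℂ)} {g₁ g₂ : P2 → P2}
    (hg₁ : ∀ v : Fin 3 → ℂ, v ≠ 0 → g₁ (P2.proj v) = P2.proj (A₁ v))
    (hg₂ : ∀ v : Fin 3 → ℂ, v ≠ 0 → g₂ (P2.proj v) = P2.proj (A₂ v)) {i : ι} {s₁ s₂ t₁ t₂ ζ₁ ζ₂ : ℂ}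
    (hs₁ : s₁ ∈ (ℒ.box i).transversal) (hs₂ : s₂ ∈ (ℒ.box i).transversal)
    (ht₁ : t₁ ∈ D.T) (ht₂ : t₂ ∈ D.T) (hζ₁ : ζ₁ ∈ ball (0 : ℂ) D.R) (hζ₂ : ζ₂ ∈ ball (0 : ℂ) D.R)
    (h₁ : D.pt t₁ ζ₁ ∈ (ℒ.box i).plaque s₁) (h₂ : D.pt t₂ ζ₂ ∈ (ℒ.box i).plaque s₂)
    (hq : g₁ (D.pt t₁ ζ₁) = g₂ (D.pt t₂ ζ₂))
    {W : Set P2} (hW : W ∈ 𝓝 (D.pt t₂ ζ₂))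
    (hWp : ∀ q ∈ (ℒ.box i).plaque s₂ ∩ W, ∃ ζ ∈ ball (0 : ℂ) D.R, q = D.pt t₂ ζ) :
    intersectionMultiplicity (g₁ '' (ℒ.box i).plaque s₁) (g₂ '' (ℒ.box i).plaque s₂)
      (g₁ (D.pt t₁ ζ₁)) ≤ analyticOrderAt (D.gap (D.relMap A₁ A₂ : _ →L[ℂ] _) t₁ t₂) ζ₁ := by
  set P₁ := D.basis.trans A₁ with hP₁
  set P₂ := D.basis.trans A₂ with hP₂
  have hvd : ∀ k, AnalyticAt ℂ (fun ζ => D.vec t₁ ζ k) ζ₁ := fun k =>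
    (differentiableOn_pi.1 (D.differentiableOn_vec ht₁) k).analyticAt (isOpen_ball.mem_nhds hζ₁)
  have hva : AnalyticAt ℂ (D.vec t₁) ζ₁ := analyticAt_pi_iff.2 hvd
  have hshift : AnalyticAt ℂ (fun s : ℂ => ζ₁ + s) 0 := by fun_prop
  set γ : ℂ → (Fin 3 → ℂ) := fun s => P₁ (D.vec t₁ (ζ₁ + s)) with hγ
  set F : (Fin 3 → ℂ) → ℂ := fun u => defect (D.f t₂) (P₂.symm u) with hF
  have hγa : AnalyticAt ℂ γ 0 := by
    have h3 : AnalyticAt ℂ (fun s : ℂ => D.vec t₁ (ζ₁ + s)) 0 :=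
      AnalyticAt.fun_comp (f := fun s : ℂ => ζ₁ + s) (by simpa using hva) hshift
    exact (P₁.toContinuousLinearMap.analyticAt _).comp h3
  have hg₁' : ∀ ζ, g₁ (D.pt t₁ ζ) = P2.proj (P₁ (D.vec t₁ ζ)) := fun ζ =>
    hg₁ _ (affVec_ne_zero D.basis (ζ, D.f t₁ ζ))
  have hg₂' : ∀ x, g₂ (affPt D.basis x) = P2.proj (P₂ ![1, x.1, x.2]) := fun x =>
    hg₂ _ (affVec_ne_zero D.basis x)
  have hγ0 : γ 0 = P₁ (D.vec t₁ ζ₁) := by simp [hγ]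
  have hparam : IsLocalParam (g₁ '' (ℒ.box i).plaque s₁) (g₁ (D.pt t₁ ζ₁)) γ := by
    refine ⟨hγa, by rw [hγ0, hg₁'], ?_, ?_⟩
    · have hd : HasDerivAt γ (P₁ ![0, 1, deriv (D.f t₁) ζ₁]) 0 := by
        have h3 : HasDerivAt (D.vec t₁) ![0, 1, deriv (D.f t₁) ζ₁] (ζ₁ + 0) := by
          rw [add_zero]
          refine hasDerivAt_pi.2 fun k => ?_
          fin_cases k
          · exact hasDerivAt_const ζ₁ (1 : ℂ)
          · exact hasDerivAt_id ζ₁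
          · exact ((D.hol t₁ ht₁).differentiableAt (isOpen_ball.mem_nhds hζ₁)).hasDerivAt
        have h4 := h3.comp_const_add ζ₁ 0
        exact P₁.toContinuousLinearMap.hasFDerivAt.comp_hasDerivAt 0 h4
      rw [hd.deriv, hγ0, LinearIndependent.pair_iff]
      intro a b hab
      rw [← map_smul, ← map_smul, ← map_add] at hab
      have h3 : a • D.vec t₁ ζ₁ + b • ![0, 1, deriv (D.f t₁) ζ₁] = 0 := by
        simpa using hab
      have h4 : a = 0 := by simpa using congrFun h3 0
      have h5 : b = 0 := by simpa [h4] using congrFun h3 1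
      exact ⟨h4, h5⟩
    · have h3 := D.eventually_mem_plaque ht₁ hζ₁ i hs₁ h₁
      have h4 : Tendsto (fun s : ℂ => ζ₁ + s) (𝓝 0) (𝓝 ζ₁) := by
        simpa using hshift.continuousAt.tendsto
      filter_upwards [h4.eventually h3] with s hs
      exact ⟨_, hs, hg₁' _⟩
  obtain ⟨c, hc, hcv⟩ : ∃ c : ℂ, c ≠ 0 ∧ P₂.symm (γ 0) = c • D.vec t₂ ζ₂ := by
    have h3 : P2.proj (γ 0) = P2.proj (P₂ (D.vec t₂ ζ₂)) := by
      rw [hγ0, ← hg₁', hq]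
      exact hg₂' _
    have h4 : γ 0 ≠ 0 := by
      rw [hγ0]
      exact affVec_ne_zero P₁ (ζ₁, D.f t₁ ζ₁)
    have h5 : P₂ (D.vec t₂ ζ₂) ≠ 0 := affVec_ne_zero P₂ (ζ₂, D.f t₂ ζ₂)
    obtain ⟨c, hc, hcv⟩ := (P2.proj_eq_proj_iff h4 h5).1 h3
    exact ⟨c, hc, by rw [hcv, map_smul, P₂.symm_apply_apply]⟩
  have hk : ∀ k, AnalyticAt ℂ (fun u => P₂.symm u k) (γ 0) := fun k =>
    (analyticAt_pi_iff.1 (P₂.symm.toContinuousLinearMap.analyticAt (γ 0))) k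
  have h0 : P₂.symm (γ 0) 0 ≠ 0 := by rw [hcv]; simpa using hc
  have h1 : P₂.symm (γ 0) 1 / P₂.symm (γ 0) 0 = ζ₂ := by rw [hcv]; simp [hc]
  have h2 : P₂.symm (γ 0) 2 / P₂.symm (γ 0) 0 = D.f t₂ ζ₂ := by rw [hcv]; simp [hc]
  have hfa : AnalyticAt ℂ (D.f t₂) ζ₂ := (D.hol t₂ ht₂).analyticAt (isOpen_ball.mem_nhds hζ₂)
  have h10 : AnalyticAt ℂ (fun u => P₂.symm u 1 / P₂.symm u 0) (γ 0) := (hk 1).div (hk 0) h0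
  have h20 : AnalyticAt ℂ (fun u => P₂.symm u 2 / P₂.symm u 0) (γ 0) := (hk 2).div (hk 0) h0
  have hFa : AnalyticAt ℂ F (γ 0) :=
    h20.sub (AnalyticAt.fun_comp (g := D.f t₂) (by rw [h1]; exact hfa) h10)
  have heq : IsLocalEquation (g₂ '' (ℒ.box i).plaque s₂) (γ 0) F := by
    refine ⟨hFa, ?_, ?_⟩
    -- The equation is reduced: in the vertical direction `F` is affine with nonzero slope.
    · intro hzero
      have hd : HasDerivAt (fun s : ℂ => F (γ 0 + s • P₂ ![0, 0, 1])) 0 0 := by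
        have h3 : HasDerivAt (fun s : ℂ => γ 0 + s • P₂ ![0, 0, 1]) (P₂ ![0, 0, 1]) 0 := by
          simpa using ((hasDerivAt_id (0 : ℂ)).smul_const (P₂ ![0, 0, 1])).const_add (γ 0)
        have h4 : HasFDerivAt F (fderiv ℂ F (γ 0)) (γ 0 + (0 : ℂ) • P₂ ![0, 0, 1]) := by
          rw [zero_smul, add_zero]; exact hFa.differentiableAt.hasFDerivAt
        have h5 := h4.comp_hasDerivAt (0 : ℂ) h3
        rw [hzero] at h5
        exact h5
      have hFs : ∀ s : ℂ, F (γ 0 + s • P₂ ![0, 0, 1]) = s / P₂.symm (γ 0) 0 + F (γ 0) := by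
        intro s
        have h6 : P₂.symm (γ 0 + s • P₂ ![0, 0, 1]) = P₂.symm (γ 0) + s • ![0, 0, 1] := by
          rw [map_add, map_smul, P₂.symm_apply_apply]
        simp only [hF, defect, h6]
        simp
        ring
      have hd' : HasDerivAt (fun s : ℂ => F (γ 0 + s • P₂ ![0, 0, 1])) (1 / P₂.symm (γ 0) 0) 0 := by
        simp only [hFs]
        exact ((hasDerivAt_id (0 : ℂ)).div_const _).add_const _
      have := hd'.unique hd
      simp [h0] at this
    · have hev1 : ∀ᶠ u in 𝓝 (γ 0), D.pt t₂ (P₂.symm u 1 / P₂.symm u 0) ∈ (ℒ.box i).plaque s₂ := by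
        have h3 := D.eventually_mem_plaque ht₂ hζ₂ i hs₂ h₂
        have h4 := h10.continuousAt.tendsto
        rw [h1] at h4
        exact h4.eventually h3
      have hev2 : ∀ᶠ u in 𝓝 (γ 0), affPt D.basis
          (P₂.symm u 1 / P₂.symm u 0, P₂.symm u 2 / P₂.symm u 0) ∈ W := by
        have h3 : ContinuousAt (fun u => affPt D.basis
            (P₂.symm u 1 / P₂.symm u 0, P₂.symm u 2 / P₂.symm u 0)) (γ 0) :=
          ContinuousAt.comp (f := fun u => (P₂.symm u 1 / P₂.symm u 0, P₂.symm u 2 / P₂.symm u 0))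
            (continuous_affPt D.basis).continuousAt
            (h10.continuousAt.prodMk h20.continuousAt)
        refine h3 ?_
        simp only [h1, h2]
        exact hW
      filter_upwards [hev1, hev2, (hk 0).continuousAt.eventually_ne h0] with u e1 e2 e3
      have hpu : P2.proj u = g₂ (affPt D.basis
          (P₂.symm u 1 / P₂.symm u 0, P₂.symm u 2 / P₂.symm u 0)) := by
        rw [hg₂']
        exact proj_eq_affPt P₂ e3
      constructor
      · intro hFu
        refine ⟨_, e1, ?_⟩
        rw [hpu, pt]
        congr 3
        exact (sub_eq_zero.1 hFu).symm
      -- The plaque might return near the point on another sheet. The neighbourhood `W` excludes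
      -- this.
      · rintro ⟨x, hx, hxu⟩
        have hinj : x = affPt D.basis (P₂.symm u 1 / P₂.symm u 0, P₂.symm u 2 / P₂.symm u 0) := by
          obtain ⟨v, hv, rfl⟩ := P2.exists_proj_eq x
          rw [hpu, hg₂', hg₂ v hv] at hxu
          obtain ⟨b, hb, hbv⟩ := (P2.proj_eq_proj_iff (by simpa using hv)
            (affVec_ne_zero P₂ _)).1 hxu
          rw [hP₂, ContinuousLinearEquiv.trans_apply, ← map_smul] at hbv
          rw [A₂.injective hbv, P2.proj_smul _ hb]
          rfl
        rw [hinj] at hx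
        obtain ⟨ζ, -, hζ⟩ := hWp _ ⟨hx, e2⟩
        have h5 := affPt_injective D.basis hζ
        have e4 : P₂.symm u 1 / P₂.symm u 0 = ζ := congrArg Prod.fst h5
        have e5 : P₂.symm u 2 / P₂.symm u 0 = D.f t₂ ζ := congrArg Prod.snd h5
        simp only [hF, defect, e4, e5, sub_self]
  have hord : analyticOrderAt (fun s => F (γ s)) 0 =
      analyticOrderAt (D.gap (D.relMap A₁ A₂ : _ →L[ℂ] _) t₁ t₂) ζ₁ := by
    have hd : deriv (fun s : ℂ => ζ₁ + s) 0 ≠ 0 := by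
      have : HasDerivAt (fun s : ℂ => ζ₁ + s) 1 0 := (hasDerivAt_id (0 : ℂ)).const_add ζ₁
      rw [this.deriv]
      exact one_ne_zero
    have h3 := analyticOrderAt_comp_of_deriv_ne_zero
      (f := D.gap (D.relMap A₁ A₂ : _ →L[ℂ] _) t₁ t₂) hshift hd
    rw [add_zero] at h3
    rw [← h3]
    rfl
  -- The multiplicity is an infimum over choices, so one parametrization with one equation gives the
  -- upper bound.
  exact sInf_le ⟨γ, F, hparam, heq, hord.symm⟩

end GraphChart

/-! ### From local to global bounds -/

namespace GraphChart

variable {X : Set P2} {ι : Type*} {ℒ : C1Lamination X ι} (D : GraphChart ℒ)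

lemma norm_relMap_sub_step_le (A₁ A₂ : (Fin 3 → ℂ) ≃L[ℂ] (Fin 3 → ℂ)) (ε : ℂ) :
    ‖(D.relMap A₁ A₂ : (Fin 3 → ℂ) →L[ℂ] (Fin 3 → ℂ)) - D.step ε‖ ≤
      ‖(D.basis.symm : (Fin 3 → ℂ) →L[ℂ] (Fin 3 → ℂ))‖ *
      ‖(D.basis : (Fin 3 → ℂ) →L[ℂ] (Fin 3 → ℂ))‖ *
      ‖(A₁.trans A₂.symm : (Fin 3 → ℂ) →L[ℂ] (Fin 3 → ℂ)) -
        (ContinuousLinearMap.id ℂ _ - ε • shearField)‖ := by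
  have h : (D.relMap A₁ A₂ : (Fin 3 → ℂ) →L[ℂ] (Fin 3 → ℂ)) - D.step ε =
      (D.basis.symm : (Fin 3 → ℂ) →L[ℂ] (Fin 3 → ℂ)).comp
        (((A₁.trans A₂.symm : (Fin 3 → ℂ) →L[ℂ] (Fin 3 → ℂ)) -
        (ContinuousLinearMap.id ℂ _ - ε • shearField)).comp
          (D.basis : (Fin 3 → ℂ) →L[ℂ] (Fin 3 → ℂ))) := by
    refine ContinuousLinearMap.ext fun v => ?_
    apply D.basis.injective
    have e1 : D.basis (D.relMap A₁ A₂ v) = A₂.symm (A₁ (D.basis v)) := by simp [relMap]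
    have e2 : D.basis (D.step ε v) = D.basis v - ε • shearField (D.basis v) := by
      rw [← D.basis_field, ← map_smul, ← map_sub]
      rfl
    simp only [_root_.sub_apply, ContinuousLinearMap.comp_apply,
      ContinuousLinearEquiv.coe_coe, map_sub, ContinuousLinearEquiv.apply_symm_apply, e1, e2,
      _root_.smul_apply, ContinuousLinearMap.id_apply,
      ContinuousLinearEquiv.trans_apply]
  rw [h]
  refine (ContinuousLinearMap.opNorm_comp_le _ _).trans ?_
  rw [mul_assoc, mul_comm ‖(D.basis : (Fin 3 → ℂ) →L[ℂ] (Fin 3 → ℂ))‖]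
  exact mul_le_mul_of_nonneg_left (ContinuousLinearMap.opNorm_comp_le _ _) (norm_nonneg _)

end GraphChart

namespace C1Lamination

variable {X : Set P2} {ι : Type*} (ℒ : C1Lamination X ι)

/-- The count of intersection points near a given point of the lamination. -/
theorem exists_local_bound [Finite ι] (hdeg : ℒ.degenerateSet = ∅) {x : P2} (hx : x ∈ X) :
    ∃ W ∈ 𝓝 x, ∃ (n : ℕ) (δ : ℝ), 0 < δ ∧ ∀ ε : ℂ, ε ≠ 0 → ‖ε‖ < δ →
      ∀ (A₁ A₂ : (Fin 3 → ℂ) ≃L[ℂ] (Fin 3 → ℂ)) (g₁ g₂ : P2 → P2),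
      ‖(A₁.trans A₂.symm : (Fin 3 → ℂ) →L[ℂ] (Fin 3 → ℂ)) -
        (ContinuousLinearMap.id ℂ _ - ε • shearField)‖ ≤ δ * ‖ε‖ →
      (∀ v : Fin 3 → ℂ, v ≠ 0 → g₁ (P2.proj v) = P2.proj (A₁ v)) →
      (∀ v : Fin 3 → ℂ, v ≠ 0 → g₂ (P2.proj v) = P2.proj (A₂ v)) →
      ∀ i, ∀ s₁ ∈ (ℒ.box i).transversal, ∀ s₂ ∈ (ℒ.box i).transversal, ∀ S : Finset P2,
      (∀ q ∈ S, q ∈ g₂ '' (ℒ.box i).plaque s₂ ∧ ∃ q₁ ∈ (ℒ.box i).plaque s₁ ∩ W, g₁ q₁ = q) →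
      ∑ q ∈ S, intersectionMultiplicity (g₁ '' (ℒ.box i).plaque s₁)
        (g₂ '' (ℒ.box i).plaque s₂) q ≤ n := by
  obtain ⟨D, hD⟩ := ℒ.exists_graphChart hx
  have hR := D.R_pos
  obtain ⟨t₀, ht₀, hf₀⟩ := D.cover 0 D.zero_mem 0 (mem_ball_self D.ρ_pos) (by rwa [hD])
  have hnd : ¬ D.Degenerate t₀ := by
    intro h
    have : D.pt t₀ 0 ∈ ℒ.degenerateSet :=
      ⟨D, t₀, ht₀, 0, D.zero_mem, by rw [hf₀]; exact mem_ball_self D.ρ_pos, h, rfl⟩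
    rwa [hdeg] at this
  obtain ⟨n, c, κ, hc, hκ, hn⟩ := D.exists_bound_sum_order_gap hnd
  choose Wi hWi hWp using fun i => D.exists_nhds_plaque_subset hx hD i (by positivity : 0 < D.R / 8)
  set V₀ : Set (ℂ × ℂ) := {y | D.C * ‖y.2 - D.f t₀ y.1‖ < c}
  have hV₀ : V₀ ∈ 𝓝 ((0, 0) : ℂ × ℂ) := by
    have h1 : ContinuousAt (D.f t₀) ((0, 0) : ℂ × ℂ).1 :=
      ((D.hol t₀ ht₀).differentiableAt (isOpen_ball.mem_nhds D.zero_mem)).continuousAt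
    have h2 : ContinuousAt (fun y : ℂ × ℂ => D.f t₀ y.1) (0, 0) :=
      ContinuousAt.comp (f := Prod.fst) h1 continuousAt_fst
    have h3 : ContinuousAt (fun y : ℂ × ℂ => D.C * ‖y.2 - D.f t₀ y.1‖) (0, 0) :=
      (continuousAt_snd.sub h2).norm.const_mul D.C
    have h0 : D.C * ‖((0, 0) : ℂ × ℂ).2 - D.f t₀ ((0, 0) : ℂ × ℂ).1‖ < c := by simpa [hf₀] using hc
    exact h3.eventually (gt_mem_nhds h0)
  have hV₀' := affPt_image_mem_nhds D.basis hV₀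
  rw [hD] at hV₀'
  set W := interior ((⋂ i, Wi i) ∩ affPt D.basis '' V₀)
  have hW : W ∈ 𝓝 x := interior_mem_nhds.2 (inter_mem (iInter_mem.2 hWi) hV₀')
  have hWo : IsOpen W := isOpen_interior
  have hWsub : W ⊆ (⋂ i, Wi i) ∩ affPt D.basis '' V₀ := interior_subset
  have hsmall : ∀ t ∈ D.T, ∀ ζ ∈ ball (0 : ℂ) D.R, D.pt t ζ ∈ W → ‖D.f t 0 - D.f t₀ 0‖ < c := by
    intro t ht ζ hζ hW
    obtain ⟨y, hy, hyp⟩ := (hWsub hW).2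
    have h1 := affPt_injective D.basis hyp
    rw [h1] at hy
    exact (D.comp t ht t₀ ht₀ 0 D.zero_mem ζ hζ).trans_lt hy
  obtain ⟨v, hv, rfl⟩ := P2.exists_proj_eq x
  have hcont : ContinuousAt (fun y : ((Fin 3 → ℂ) →L[ℂ] (Fin 3 → ℂ)) × (Fin 3 → ℂ) =>
      P2.proj (y.1 y.2)) (ContinuousLinearMap.id ℂ _, v) := by
    refine ContinuousAt.comp
      (f := fun y : ((Fin 3 → ℂ) →L[ℂ] (Fin 3 → ℂ)) × (Fin 3 → ℂ) => y.1 y.2)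
      (P2.continuousAt_proj (by simpa using hv)) ?_
    exact (continuous_fst.clm_apply continuous_snd).continuousAt
  -- For linear maps near the identity, a point q₁ near x is sent by A₂⁻¹A₁ into `W`. Thus both
  -- preimages of an intersection point lie in `W`, where each plaque is part of one graph.
  obtain ⟨U₁, hU₁, U₂, hU₂, hU⟩ := mem_nhds_prod_iff.1 (hcont hW)
  obtain ⟨δ₁, hδ₁, hδU⟩ := Metric.mem_nhds_iff.1 hU₁
  set k := ‖(D.basis.symm : (Fin 3 → ℂ) →L[ℂ] (Fin 3 → ℂ))‖ *
      ‖(D.basis : (Fin 3 → ℂ) →L[ℂ] (Fin 3 → ℂ))‖ + 1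
  have hk : 0 < k := by positivity
  set y := ‖shearField‖ + 1
  have hy : 0 < y := by positivity
  refine ⟨W ∩ P2.proj '' (U₂ ∩ {u | u ≠ 0}), inter_mem hW (P2.image_proj_mem_nhds hv
    (inter_mem hU₂ (isOpen_ne.mem_nhds hv))), n, min (min c 1) (min (κ / k) (δ₁ / y)),
    lt_min (lt_min hc one_pos) (lt_min (by positivity) (by positivity)), ?_⟩
  intro ε hε0 hε A₁ A₂ g₁ g₂ hA hg₁ hg₂ i s₁ hs₁ s₂ hs₂ S hS
  have hεpos := norm_pos_iff.2 hε0
  have hεc : ‖ε‖ < c := hε.trans_le ((min_le_left _ _).trans (min_le_left _ _))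
  have hεy : ‖ε‖ < δ₁ / y := hε.trans_le ((min_le_right _ _).trans (min_le_right _ _))
  have hA1 : ‖(A₁.trans A₂.symm : (Fin 3 → ℂ) →L[ℂ] (Fin 3 → ℂ)) -
        (ContinuousLinearMap.id ℂ _ - ε • shearField)‖ ≤ 1 * ‖ε‖ :=
    hA.trans (mul_le_mul_of_nonneg_right ((min_le_left _ _).trans (min_le_right _ _)) hεpos.le)
  have hA2 : ‖(A₁.trans A₂.symm : (Fin 3 → ℂ) →L[ℂ] (Fin 3 → ℂ)) -
        (ContinuousLinearMap.id ℂ _ - ε • shearField)‖ ≤ κ / k * ‖ε‖ :=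
    hA.trans (mul_le_mul_of_nonneg_right ((min_le_right _ _).trans (min_le_left _ _)) hεpos.le)
  have hN : ‖(D.relMap A₁ A₂ : (Fin 3 → ℂ) →L[ℂ] (Fin 3 → ℂ)) - D.step ε‖ ≤ κ * ‖ε‖ := by
    refine (D.norm_relMap_sub_step_le A₁ A₂ ε).trans ?_
    refine (mul_le_mul (b := k) (le_add_of_nonneg_right zero_le_one) hA2 (norm_nonneg _) hk.le).trans
      (le_of_eq ?_)
    field_simp
  have hB : (A₁.trans A₂.symm : (Fin 3 → ℂ) →L[ℂ] (Fin 3 → ℂ)) ∈ U₁ := by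
    apply hδU
    rw [mem_ball, dist_eq_norm]
    have h1 : (A₁.trans A₂.symm : (Fin 3 → ℂ) →L[ℂ] (Fin 3 → ℂ)) - ContinuousLinearMap.id ℂ _ =
      ((A₁.trans A₂.symm : (Fin 3 → ℂ) →L[ℂ] (Fin 3 → ℂ)) -
        (ContinuousLinearMap.id ℂ _ - ε • shearField)) - ε • shearField := by abel
    rw [h1]
    refine (norm_sub_le _ _).trans_lt ?_
    rw [norm_smul]
    rw [lt_div_iff₀ hy] at hεy
    simp only [y] at hεy
    linarith
  obtain ⟨t₁, ht₁, h₁⟩ := hWp i s₁ hs₁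
  obtain ⟨t₂, ht₂, h₂⟩ := hWp i s₂ hs₂
  have hSq : ∀ q ∈ S, ∃ ζ₁ ζ₂ : ℂ, ζ₁ ∈ ball (0 : ℂ) D.R ∧ ζ₁ ∈ ball (0 : ℂ) (D.R / 8) ∧
      ζ₂ ∈ ball (0 : ℂ) D.R ∧ D.pt t₁ ζ₁ ∈ (ℒ.box i).plaque s₁ ∩ W ∧
      D.pt t₂ ζ₂ ∈ (ℒ.box i).plaque s₂ ∩ W ∧ g₁ (D.pt t₁ ζ₁) = q ∧ g₂ (D.pt t₂ ζ₂) = q := by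
    intro q hq
    obtain ⟨⟨q₂, hq₂, hq₂q⟩, q₁, ⟨hq₁, hq₁W, u, ⟨hu, hu0⟩, huq⟩, hq₁q⟩ := hS q hq
    have hq₂W : q₂ ∈ W := by
      obtain ⟨w, hw, rfl⟩ := P2.exists_proj_eq q₂
      rw [← huq, hg₁ u hu0, ← hq₂q, hg₂ w hw] at hq₁q
      obtain ⟨b, hb, hbw⟩ := (P2.proj_eq_proj_iff (by simpa using hu0) (by simpa using hw)).1 hq₁q
      have h3 : (A₁.trans A₂.symm : (Fin 3 → ℂ) →L[ℂ] (Fin 3 → ℂ)) u = b • w := by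
        change A₂.symm (A₁ u) = b • w
        rw [hbw, map_smul, A₂.symm_apply_apply]
      have h4 := hU (mk_mem_prod hB hu)
      simp only [mem_preimage, h3, P2.proj_smul _ hb] at h4
      exact h4
    obtain ⟨ζ₁, e1, e2, rfl⟩ := h₁ q₁ ⟨hq₁, mem_iInter.1 (hWsub hq₁W).1 i⟩
    obtain ⟨ζ₂, e3, -, rfl⟩ := h₂ q₂ ⟨hq₂, mem_iInter.1 (hWsub hq₂W).1 i⟩
    exact ⟨ζ₁, ζ₂, e1, e2, e3, ⟨hq₁, hq₁W⟩, ⟨hq₂, hq₂W⟩, hq₁q, hq₂q⟩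
  rcases S.eq_empty_or_nonempty with rfl | ⟨q₀, hq₀⟩
  · simp
  have hsm : ‖D.f t₁ 0 - D.f t₀ 0‖ < c ∧ ‖D.f t₂ 0 - D.f t₀ 0‖ < c := by
    obtain ⟨ζ₁, ζ₂, e1, -, e3, e4, e5, -, -⟩ := hSq q₀ hq₀
    exact ⟨hsmall t₁ ht₁ ζ₁ e1 e4.2, hsmall t₂ ht₂ ζ₂ e3 e5.2⟩
  choose! z z' hz using hSq
  -- Distinct intersection points have distinct parameters on the first graph, so multiplicities add
  -- up to at most the total order of zeros.
  have hinj : Set.InjOn z S := by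
    intro a ha b hb hab
    rw [← (hz a ha).2.2.2.2.2.1, ← (hz b hb).2.2.2.2.2.1, hab]
  have hle : ∀ q ∈ S, intersectionMultiplicity (g₁ '' (ℒ.box i).plaque s₁)
      (g₂ '' (ℒ.box i).plaque s₂) q ≤
      analyticOrderAt (D.gap (D.relMap A₁ A₂ : _ →L[ℂ] _) t₁ t₂) (z q) := by
    intro q hq
    obtain ⟨e1, e2, e3, e4, e5, e6, e7⟩ := hz q hq
    have := D.intersectionMultiplicity_le hg₁ hg₂ hs₁ hs₂ ht₁ ht₂ e1 e3 e4.1 e5.1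
      (e6.trans e7.symm) (hWo.mem_nhds e5.2) (fun p hp => ?_)
    · rwa [e6] at this
    · obtain ⟨ζ, e8, -, e9⟩ := h₂ p ⟨hp.1, mem_iInter.1 (hWsub hp.2).1 i⟩
      exact ⟨ζ, e8, e9⟩
  refine (Finset.sum_le_sum hle).trans ?_
  rw [← Finset.sum_image (f := analyticOrderAt (D.gap (D.relMap A₁ A₂ : _ →L[ℂ] _) t₁ t₂)) hinj]
  refine hn ε hε0 hεc _ hN t₁ ht₁ t₂ ht₂ hsm.1 hsm.2 _ fun a ha => ?_
  obtain ⟨q, hq, rfl⟩ := Finset.mem_image.1 ha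
  exact (hz q hq).2.1

/-- Uniform bound for the intersections of plaques with their images under maps close to a small
shear. -/
theorem exists_bound_meetAtMost [Finite ι] (hX : IsCompact X) (hdeg : ℒ.degenerateSet = ∅) :
    ∃ (N : ℕ) (δ : ℝ), 0 < δ ∧ ∀ ε : ℂ, ε ≠ 0 → ‖ε‖ < δ →
      ∀ (A₁ A₂ : (Fin 3 → ℂ) ≃L[ℂ] (Fin 3 → ℂ)) (g₁ g₂ : P2 → P2),
      ‖(A₁.trans A₂.symm : (Fin 3 → ℂ) →L[ℂ] (Fin 3 → ℂ)) -
        (ContinuousLinearMap.id ℂ _ - ε • shearField)‖ ≤ δ * ‖ε‖ →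
      (∀ v : Fin 3 → ℂ, v ≠ 0 → g₁ (P2.proj v) = P2.proj (A₁ v)) →
      (∀ v : Fin 3 → ℂ, v ≠ 0 → g₂ (P2.proj v) = P2.proj (A₂ v)) →
      ∀ i, ∀ L₁ L₂ : Set P2, (ℒ.box i).IsLocalLeaf L₁ → (ℒ.box i).IsLocalLeaf L₂ →
        MeetAtMost N (g₁ '' L₁) (g₂ '' L₂) := by
  classical
  choose W hW n δ hδ h using fun (x : P2) (hx : x ∈ X) => ℒ.exists_local_bound hdeg hx
  obtain ⟨t, ht⟩ := hX.elim_nhds_subcover' W hW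
  -- A small d by a filter argument, which also covers an empty finite subcover.
  have hev : ∀ᶠ d in 𝓝[>] (0 : ℝ), 0 < d ∧ ∀ x ∈ t, d < δ x x.2 := by
    refine Eventually.and (self_mem_nhdsWithin (s := Ioi (0 : ℝ)) (a := 0))
      ((Filter.eventually_all_finset t).2 fun x _ => ?_)
    exact (gt_mem_nhds (hδ x x.2)).filter_mono nhdsWithin_le_nhds
  obtain ⟨d, hd, hdt⟩ := hev.exists
  refine ⟨∑ x ∈ t, n x x.2, d, hd, ?_⟩
  rintro ε hε0 hε A₁ A₂ g₁ g₂ hA hg₁ hg₂ i _ _ ⟨s₁, hs₁, rfl⟩ ⟨s₂, hs₂, rfl⟩ S hS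
  set m := intersectionMultiplicity (g₁ '' (ℒ.box i).plaque s₁) (g₂ '' (ℒ.box i).plaque s₂)
  set Q : X → P2 → Prop := fun x q => ∃ q₁ ∈ (ℒ.box i).plaque s₁ ∩ W x x.2, g₁ q₁ = q
  -- Each intersection point is seen by at least one member of the cover, so the local bounds add.
  have hle : ∀ q ∈ S, m q ≤ ∑ x ∈ t, if Q x q then m q else 0 := by
    intro q hq
    obtain ⟨q₁, hq₁, hq₁q⟩ := (hS hq).1
    have hq₁X : q₁ ∈ X := (ℒ.box i).carrier_subset ((ℒ.box i).plaque_subset_carrier hs₁ hq₁)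
    obtain ⟨x, hx, hqx⟩ := mem_iUnion₂.1 (ht hq₁X)
    have hQ : Q x q := ⟨q₁, ⟨hq₁, hqx⟩, hq₁q⟩
    calc m q = if Q x q then m q else 0 := by rw [if_pos hQ]
      _ ≤ _ := Finset.single_le_sum (f := fun x => if Q x q then m q else 0)
        (fun _ _ => zero_le) hx
  refine (Finset.sum_le_sum hle).trans ?_
  rw [Finset.sum_comm, Nat.cast_sum]
  refine Finset.sum_le_sum fun x hx => ?_
  rw [← Finset.sum_filter]
  refine h x x.2 ε hε0 (hε.trans (hdt x hx)) A₁ A₂ g₁ g₂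
    (hA.trans (mul_le_mul_of_nonneg_right (hdt x hx).le (norm_nonneg _))) hg₁ hg₂ i s₁ hs₁ s₂ hs₂ _
    fun q hq => ?_
  obtain ⟨hq1, hq2⟩ := Finset.mem_filter.1 hq
  exact ⟨(hS hq1).2, hq2⟩

end C1Lamination

/-! ### Shears, unitary maps and the conclusion -/

lemma shear_proj (ε : ℂ) {v : Fin 3 → ℂ} (hv : v ≠ 0) :
    shear ε (P2.proj v) = P2.proj (shearLinear ε v) := P2.map_proj _ hv

lemma unitaryMap_proj (A : Matrix.unitaryGroup (Fin 3) ℂ) {v : Fin 3 → ℂ} (hv : v ≠ 0) :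
    unitaryMap A (P2.proj v) = P2.proj (Matrix.UnitaryGroup.toLinearEquiv A v) := P2.map_proj _ hv

/-- The formula is exact and not only first order, since the square of `shearField` is zero. -/
lemma coe_shearLinear_symm (ε : ℂ) :
    ((shearLinear ε).toContinuousLinearEquiv.symm : (Fin 3 → ℂ) →L[ℂ] (Fin 3 → ℂ)) =
      ContinuousLinearMap.id ℂ _ - ε • shearField := by
  refine ContinuousLinearMap.ext fun v => ?_
  have : (shearLinear ε).toContinuousLinearEquiv.symm v = ![v 0, v 1 - ε * v 0, v 2] := rfl
  simp only [ContinuousLinearEquiv.coe_coe, this]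
  ext i
  fin_cases i <;> simp

/-- The action of a unitary matrix on `ℂ³` as a continuous linear map. -/
def unitaryCLM (A : Matrix.unitaryGroup (Fin 3) ℂ) : (Fin 3 → ℂ) →L[ℂ] (Fin 3 → ℂ) :=
  LinearMap.toContinuousLinearMap (Matrix.toLin' (A : Matrix (Fin 3) (Fin 3) ℂ))

lemma continuous_unitaryCLM : Continuous unitaryCLM := by
  have h : Continuous fun M : Matrix (Fin 3) (Fin 3) ℂ =>
      LinearMap.toContinuousLinearMap (Matrix.toLin' M) :=
    LinearMap.continuous_of_finiteDimensional
      ((LinearMap.toContinuousLinearMap : ((Fin 3 → ℂ) →ₗ[ℂ] (Fin 3 → ℂ)) ≃ₗ[ℂ] _).toLinearMap ∘ₗ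
        (Matrix.toLin' : Matrix (Fin 3) (Fin 3) ℂ ≃ₗ[ℂ] _).toLinearMap)
  exact h.comp continuous_subtype_val

theorem theorem3p1 {X : Set P2} (hX : IsCompact X) {ι : Type*} [Finite ι]
    (ℒ : C1Lamination X ι)
    (hp : ∃ i, ∃ L, (ℒ.box i).IsLocalLeaf L ∧ P2.proj ![0, 0, 1] ∈ L ∧ IsTangentGraphAtOrigin L) :
    ∃ N : ℕ, ∃ ε₀ : ℝ, 0 < ε₀ ∧ ∀ ε : ℂ, 0 < ‖ε‖ → ‖ε‖ < ε₀ →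
      (∀ i, ∀ L₁ L₂ : Set P2, (ℒ.box i).IsLocalLeaf L₁ → (ℒ.box i).IsLocalLeaf L₂ →
        MeetAtMost N L₁ (shear ε '' L₂)) ∧
      ∃ U ∈ 𝓝 (1 : Matrix.unitaryGroup (Fin 3) ℂ), ∀ Ψ₁ ∈ U, ∀ Ψ₂ ∈ U,
        ∀ i, ∀ L₁ L₂ : Set P2, (ℒ.box i).IsLocalLeaf L₁ → (ℒ.box i).IsLocalLeaf L₂ →
          MeetAtMost N (unitaryMap Ψ₁ '' L₁) (unitaryMap Ψ₂ '' (shear ε '' L₂)) := by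
  obtain ⟨i₀, L₀, ⟨s₀, hs₀, rfl⟩, -, hL₀⟩ := hp
  have hdeg := ℒ.degenerateSet_eq_empty hX
    (((ℒ.box i₀).plaque_subset_carrier hs₀).trans (ℒ.box i₀).carrier_subset) hL₀
  obtain ⟨N, δ, hδ, h⟩ := ℒ.exists_bound_meetAtMost hX hdeg
  refine ⟨N, δ, hδ, fun ε hε0 hε => ?_⟩
  have hε0' : ε ≠ 0 := norm_pos_iff.1 hε0
  set Φ := (shearLinear ε).toContinuousLinearEquiv
  constructor
  · intro i L₁ L₂ hL₁ hL₂
    have := h ε hε0' hε (ContinuousLinearEquiv.refl ℂ _) Φ id (shear ε) ?_ (fun v _ => rfl)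
      (fun v hv => shear_proj ε hv) i L₁ L₂ hL₁ hL₂
    · rwa [image_id] at this
    · have e : ((ContinuousLinearEquiv.refl ℂ (Fin 3 → ℂ)).trans Φ.symm :
          (Fin 3 → ℂ) →L[ℂ] (Fin 3 → ℂ)) = ContinuousLinearMap.id ℂ _ - ε • shearField := by
        rw [← coe_shearLinear_symm]
        rfl
      rw [e, sub_self, norm_zero]
      positivity
  -- The relative map is Φ⁻¹Ψ₂⁻¹Ψ₁, which tends to Φ⁻¹ as both unitary maps tend to the identity.
  -- The tolerance is δ|ε|, so the neighbourhood depends on ε while N does not.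
  · have hc : Continuous fun Ψ : Matrix.unitaryGroup (Fin 3) ℂ × Matrix.unitaryGroup (Fin 3) ℂ =>
        ‖((Φ.symm : (Fin 3 → ℂ) →L[ℂ] (Fin 3 → ℂ)).comp (unitaryCLM (Ψ.2⁻¹ * Ψ.1))) -
          (Φ.symm : (Fin 3 → ℂ) →L[ℂ] (Fin 3 → ℂ))‖ := by
      have h1 := continuous_unitaryCLM.comp
        ((continuous_snd.inv).mul (continuous_fst (X := Matrix.unitaryGroup (Fin 3) ℂ)
          (Y := Matrix.unitaryGroup (Fin 3) ℂ)))
      exact ((continuous_const.clm_comp h1).sub continuous_const).norm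
    have h1 : ‖((Φ.symm : (Fin 3 → ℂ) →L[ℂ] (Fin 3 → ℂ)).comp (unitaryCLM (1⁻¹ * 1))) -
          (Φ.symm : (Fin 3 → ℂ) →L[ℂ] (Fin 3 → ℂ))‖ < δ * ‖ε‖ := by
      have e : unitaryCLM (1⁻¹ * 1) = ContinuousLinearMap.id ℂ _ := by
        ext v
        simp [unitaryCLM]
      rw [e, ContinuousLinearMap.comp_id, sub_self, norm_zero]
      positivity
    have h2 := hc.continuousAt (x := (1, 1)) |>.eventually (gt_mem_nhds h1)
    rw [nhds_prod_eq] at h2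
    obtain ⟨U, hU, hUU⟩ := (eventually_prod_self_iff (r := fun a b =>
      ‖((Φ.symm : (Fin 3 → ℂ) →L[ℂ] (Fin 3 → ℂ)).comp (unitaryCLM (b⁻¹ * a))) -
          (Φ.symm : (Fin 3 → ℂ) →L[ℂ] (Fin 3 → ℂ))‖ < δ * ‖ε‖)).1 h2
    refine ⟨U, hU, fun Ψ₁ hΨ₁ Ψ₂ hΨ₂ i L₁ L₂ hL₁ hL₂ => ?_⟩
    set E₁ := (Matrix.UnitaryGroup.toLinearEquiv Ψ₁).toContinuousLinearEquiv
    set E₂ := (Matrix.UnitaryGroup.toLinearEquiv Ψ₂).toContinuousLinearEquiv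
    rw [← image_comp]
    refine h ε hε0' hε E₁ (Φ.trans E₂) (unitaryMap Ψ₁) (unitaryMap Ψ₂ ∘ shear ε) ?_
      (fun v hv => unitaryMap_proj Ψ₁ hv) (fun v hv => ?_) i L₁ L₂ hL₁ hL₂
    · have e : (E₁.trans (Φ.trans E₂).symm : (Fin 3 → ℂ) →L[ℂ] (Fin 3 → ℂ)) =
          (Φ.symm : (Fin 3 → ℂ) →L[ℂ] (Fin 3 → ℂ)).comp (unitaryCLM (Ψ₂⁻¹ * Ψ₁)) := by
        refine ContinuousLinearMap.ext fun v => ?_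
        change Φ.symm (E₂.symm (E₁ v)) = Φ.symm (unitaryCLM (Ψ₂⁻¹ * Ψ₁) v)
        congr 1
        apply E₂.injective
        rw [E₂.apply_symm_apply]
        change Matrix.toLin' Ψ₁.1 v = Matrix.toLin' Ψ₂.1 (Matrix.toLin' (Ψ₂⁻¹ * Ψ₁).1 v)
        rw [← Matrix.toLin'_mul_apply]
        congr 2
        rw [← Submonoid.coe_mul, mul_inv_cancel_left]
      rw [e, ← coe_shearLinear_symm]
      exact (hUU Ψ₁ hΨ₁ Ψ₂ hΨ₂).le
    · have hv' : shearLinear ε v ≠ 0 := by simpa using hv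
      rw [Function.comp_apply, shear_proj ε hv, unitaryMap_proj Ψ₂ hv']
      rfl

end
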